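/- Throughout, a language is a first-order language (with equality) with function and relation symbols of arbitrary finite arity, together with a numbering of its symbols for which it is decidable whether a number codes a function (relation) symbol and of which arity; formulas are Gödel numbered accordingly. A theory $T$ is a set of sentences of a language $L(T)$, $T\vdash\varphi$ means that $\varphi$ is provable from $T$ in classical first-order logic, $T$ is consistent if $T\nvdash\bot$, and $T$ is incomplete if there is a sentence $\varphi$ of $L(T)$ with $T\nvdash\varphi$ and $T\nvdash\neg\varphi$. A theory is recursively axiomatizable if it has the same theorems as some recursive set of sentences, and decidable if the set of its theorems is recursive. An extension of $T$ in the same language is a theory in $L(T)$ that proves all theorems of $T$. A translation $I$ of $L(T)$ into $L(S)$ consists of an $L(S)$-formula $\delta_I(x)$, an $L(S)$-formula $=_I$ in two variables, an $L(S)$-formula $R_I$ of the same arity for each relation symbol $R$ of $L(T)$, and an $L(S)$-formula $F_I$ of arity $k+1$ for each $k$-ary function symbol $F$ of $L(T)$; the assignments $R\mapsto R_I$ and $F\mapsto F_I$ are required to be recursive (which is automatic if $L(T)$ has finitely many symbols). The translation $\varphi^I$ of an $L(T)$-formula $\varphi$ is obtained by unravelling nested terms so that function symbols occur only in the form $F(\bar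 x)=y$, replacing $F(\bar x)=y$, $R(\bar x)$, $x=y$ by $F_I(\bar x,y)$, $R_I(\bar x)$, $x=_I y$, and restricting all quantifiers to $\delta_I$. $T$ is interpretable in $S$ if there is such an $I$ for which $S$ proves that each $F_I$ is total on $\delta_I$ and $S$ proves $\varphi^I$ for every theorem $\varphi$ of $T$ (including the axioms of equality). Proposition. Let $T$ be a recursively axiomatizable consistent theory. The following are equivalent: (1) $\mathsf{G1}$ holds for $T$: every recursively axiomatizable consistent theory $S$ (in any language) in which $T$ is interpretable is incomplete. (2) $T$ is essentially incomplete: every recursively axiomatizable consistent extension of $T$ in the same language is incomplete. (3) $T$ is essentially undecidable: every recursively axiomatizable consistent extension of $T$ in the same language is undecidable. -/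

import Mathlib

namespace G1

open FirstOrder.Language

universe u v

/-- An arithmetization of a first-order language: its function and relation symbols are numbered
injectively, in such a way that one can effectively decide whether a number codes a function
symbol (a relation symbol), and of which arity. Since `funcArity` is a function, symbols of
different arities have different codes, so injectivity is only asked arity by arity. -/
class Arithmetization (L : FirstOrder.Language.{u, v}) where
  funcCode : ∀ {n : ℕ}, L.Functions n → ℕ
  relCode : ∀ {n : ℕ}, L.Relations n → ℕ
  funcCode_injective : ∀ n : ℕ, Function.Injective (funcCode (n := n))
  relCode_injective : ∀ n : ℕ, Function.Injective (relCode (n := n))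
  funcArity : ℕ → Option ℕ
  relArity : ℕ → Option ℕ
  funcArity_computable : Computable funcArity
  relArity_computable : Computable relArity
  funcArity_eq_some : ∀ c n : ℕ, funcArity c = some n ↔ ∃ f : L.Functions n, funcCode f = c
  relArity_eq_some : ∀ c n : ℕ, relArity c = some n ↔ ∃ R : L.Relations n, relCode R = c

/-- Terms of `L` whose variables are among `x₀, …, x_{n-1}`. -/
abbrev Tm (L : FirstOrder.Language.{u, v}) (n : ℕ) := L.Term (Empty ⊕ Fin n)

/-- Formulas of `L` whose free variables are among `x₀, …, x_{n-1}`. For `n = 0` these are the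
sentences of `L`. The quantifier in `∀' φ` with `φ : Fm L (n + 1)` binds `x_n`. -/
abbrev Fm (L : FirstOrder.Language.{u, v}) (n : ℕ) := L.BoundedFormula Empty n

section Calculus

variable {L : FirstOrder.Language.{u, v}}

/-- The variable `x_i` as a term. -/
def tvar {n : ℕ} (i : Fin n) : Tm L n := Term.var (Sum.inr i)

/-- Simultaneous substitution of `σ i` for `x_i` in a term. -/
def substTm {m n : ℕ} (σ : Fin m → Tm L n) (t : Tm L m) : Tm L n :=
  t.subst (Sum.elim (fun e => e.elim) σ)

/-- The extension of a substitution under a quantifier: the newly bound variable `x_m` becomes the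
newly bound variable `x_n`, so that no variable is captured. -/
def liftSubst {m n : ℕ} (σ : Fin m → Tm L n) : Fin (m + 1) → Tm L (n + 1) :=
  Fin.snoc (α := fun _ => Tm L (n + 1))
    (fun i => (σ i).relabel (Sum.map id Fin.castSucc)) (tvar (Fin.last n))

/-- Simultaneous, capture-avoiding substitution of `σ i` for the free variable `x_i`. -/
def substFm : ∀ {m n : ℕ}, (Fin m → Tm L n) → Fm L m → Fm L n
  | _, _, _, .falsum => .falsum
  | _, _, σ, .equal t s => .equal (substTm σ t) (substTm σ s)
  | _, _, σ, .rel R ts => .rel R (fun i => substTm σ (ts i))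
  | _, _, σ, .imp φ ψ => .imp (substFm σ φ) (substFm σ ψ)
  | _, _, σ, .all φ => .all (substFm (liftSubst σ) φ)

/-- A formula in `x₀, …, x_{n-1}` seen as a formula in `x₀, …, x_n`. -/
def weaken {n : ℕ} (φ : Fm L n) : Fm L (n + 1) :=
  substFm (fun i => tvar i.castSucc) φ

/-- A sentence seen as a formula in `x₀, …, x_{n-1}`. -/
def ofSentence (n : ℕ) (φ : L.Sentence) : Fm L n :=
  substFm (fun i : Fin 0 => i.elim0) φ

/-- Substitution of the term `t` for the last variable `x_n`. -/
def inst {n : ℕ} (φ : Fm L (n + 1)) (t : Tm L n) : Fm L n :=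
  substFm (Fin.snoc (α := fun _ => Tm L n) tvar t) φ

/-- Provability from the axioms `T` in a Hilbert-style calculus for classical first-order logic
with equality (over nonempty domains). The inference rules are modus ponens and generalization. -/
inductive Provable (T : L.Theory) : ∀ {n : ℕ}, Fm L n → Prop
  | ax (n : ℕ) {φ : L.Sentence} : φ ∈ T → Provable T (ofSentence n φ)
  | imp_intro {n : ℕ} (φ ψ : Fm L n) : Provable T (φ.imp (ψ.imp φ))
  | imp_distrib {n : ℕ} (φ ψ χ : Fm L n) :
      Provable T ((φ.imp (ψ.imp χ)).imp ((φ.imp ψ).imp (φ.imp χ)))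
  | not_not_elim {n : ℕ} (φ : Fm L n) : Provable T (φ.not.not.imp φ)
  | all_elim {n : ℕ} (φ : Fm L (n + 1)) (t : Tm L n) : Provable T (φ.all.imp (inst φ t))
  | all_distrib {n : ℕ} (φ : Fm L n) (ψ : Fm L (n + 1)) :
      Provable T (((weaken φ).imp ψ).all.imp (φ.imp ψ.all))
  | exists_self (n : ℕ) :
      Provable T (BoundedFormula.equal (tvar (Fin.last n)) (tvar (Fin.last n)) : Fm L (n + 1)).ex
  | eq_refl {n : ℕ} (t : Tm L n) : Provable T (BoundedFormula.equal t t : Fm L n)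
  | eq_subst {n : ℕ} (φ : Fm L (n + 1)) (t s : Tm L n) :
      Provable T ((BoundedFormula.equal t s : Fm L n).imp ((inst φ t).imp (inst φ s)))
  | mp {n : ℕ} {φ ψ : Fm L n} : Provable T (φ.imp ψ) → Provable T φ → Provable T ψ
  | gen {n : ℕ} {φ : Fm L (n + 1)} : Provable T φ → Provable T φ.all

/-- `T ⊢ φ` for a sentence `φ`. -/
def Proves (T : L.Theory) (φ : L.Sentence) : Prop := Provable T (n := 0) φ

/-- No contradiction is provable in `T`. -/
def Consistent (T : L.Theory) : Prop := ¬ Proves T ⊥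

/-- Some sentence is independent of `T`. -/
def Incomplete (T : L.Theory) : Prop := ∃ φ : L.Sentence, ¬ Proves T φ ∧ ¬ Proves T φ.not

/-- `S` extends `T` (in the same language): every theorem of `T` is a theorem of `S`. -/
def Extends (S T : L.Theory) : Prop := ∀ φ : L.Sentence, Proves T φ → Proves S φ

end Calculus

section Goedel

variable {L : FirstOrder.Language.{u, v}} [Arithmetization L]

/-- The Gödel number of a term. -/
def codeTm {n : ℕ} : Tm L n → ℕ
  | .var (.inl e) => e.elim
  | .var (.inr i) => 2 * (i : ℕ)
  | .func f ts =>
      2 * Nat.pair (Arithmetization.funcCode f)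
        (Encodable.encode (List.ofFn fun i => codeTm (ts i))) + 1

/-- The Gödel number of a formula. -/
def code : ∀ {n : ℕ}, Fm L n → ℕ
  | _, .falsum => 0
  | _, .equal t s => 4 * Nat.pair (codeTm t) (codeTm s) + 1
  | _, .rel R ts =>
      4 * Nat.pair (Arithmetization.relCode R)
        (Encodable.encode (List.ofFn fun i => codeTm (ts i))) + 2
  | _, .imp φ ψ => 4 * Nat.pair (code φ) (code ψ) + 3
  | _, .all φ => 4 * code φ + 4

/-- The set of Gödel numbers of the sentences in `A` is recursive. -/
def RecursiveSet (A : Set L.Sentence) : Prop :=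
  ComputablePred fun c : ℕ => ∃ φ ∈ A, code (n := 0) φ = c

/-- `T` is decidable: the set of its theorems is recursive. -/
def DecidableTheory (T : L.Theory) : Prop := RecursiveSet {φ : L.Sentence | Proves T φ}

/-- `T` has a recursive set of axioms: its theorems are those of some recursive set `A`. -/
def RecursivelyAxiomatizable (T : L.Theory) : Prop :=
  ∃ A : L.Theory, RecursiveSet A ∧ ∀ φ : L.Sentence, Proves A φ ↔ Proves T φ

/-- Every recursively axiomatizable consistent extension of `T` in the same language is
incomplete. -/
def EssentiallyIncomplete (T : L.Theory) : Prop :=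
  ∀ S : L.Theory, RecursivelyAxiomatizable S → Consistent S → Extends S T → Incomplete S

/-- Every recursively axiomatizable consistent extension of `T` in the same language is
undecidable. -/
def EssentiallyUndecidable (T : L.Theory) : Prop :=
  ∀ S : L.Theory, RecursivelyAxiomatizable S → Consistent S → Extends S T → ¬ DecidableTheory S

end Goedel

section Interpretation

variable {L L' : FirstOrder.Language.{u, v}}

/-- A (one-dimensional, parameter-free, one-piece) translation of `L` into `L'`: a domain formula,
a formula for equality, a formula of the same arity for each relation symbol, and a formula of
arity `k + 1` for each function symbol of arity `k` (the last variable is the value). -/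
structure Translation (L L' : FirstOrder.Language.{u, v}) where
  dom : Fm L' 1
  eq : Fm L' 2
  rel : ∀ {n : ℕ}, L.Relations n → Fm L' n
  func : ∀ {n : ℕ}, L.Functions n → Fm L' (n + 1)

/-- Conjunction of a list of formulas. -/
def conj {n : ℕ} (l : List (Fm L n)) : Fm L n := l.foldr (fun φ ψ => φ ⊓ ψ) ⊤

namespace Translation

variable (I : Translation L L')

/-- `δ(x_i)`. -/
def domAt {n : ℕ} (i : Fin n) : Fm L' n := substFm (fun _ => tvar i) I.dom

/-- `∃ x_m ∈ δ, …, ∃ x_{m+k-1} ∈ δ, φ`. -/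
def bexs {m : ℕ} : ∀ k : ℕ, Fm L' (m + k) → Fm L' m
  | 0, φ => φ
  | k + 1, φ => bexs k (I.domAt (Fin.last (m + k)) ⊓ φ).ex

/-- `∀ x_m ∈ δ, …, ∀ x_{m+k-1} ∈ δ, φ`. -/
def balls {m : ℕ} : ∀ k : ℕ, Fm L' (m + k) → Fm L' m
  | 0, φ => φ
  | k + 1, φ => balls k ((I.domAt (Fin.last (m + k))).imp φ).all

/-- The translation of `t = x_y`, where the variables `x_i` of `t` are renamed to `x_{e i}`.
Nested terms are unravelled: `F(t₀, …, t_{k-1}) = x_y` becomes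
`∃ z₀, …, z_{k-1} ∈ δ, t₀ = z₀ ∧ … ∧ t_{k-1} = z_{k-1} ∧ F_I(z₀, …, z_{k-1}, x_y)`. -/
def graph {n : ℕ} : Tm L n → ∀ {m : ℕ}, (Fin n → Fin m) → Fin m → Fm L' m
  | .var (.inl a), _, _, _ => a.elim
  | .var (.inr i), _, e, y => BoundedFormula.equal (tvar (e i)) (tvar y)
  | @Term.func _ _ k f ts, m, e, y =>
      I.bexs k
        (conj (List.ofFn fun i : Fin k =>
            graph (ts i) (fun j => Fin.castAdd k (e j)) (Fin.natAdd m i)) ⊓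
          substFm (Fin.snoc (α := fun _ => Tm L' (m + k))
            (fun i : Fin k => tvar (Fin.natAdd m i)) (tvar (Fin.castAdd k y))) (I.func f))

/-- `∃ z₀, …, z_{k-1} ∈ δ, t₀ = z₀ ∧ … ∧ t_{k-1} = z_{k-1} ∧ P(z₀, …, z_{k-1})`: the translation of
an atomic formula with arguments `ts` whose predicate is translated by `P`. -/
def atom {n k : ℕ} (P : Fm L' k) (ts : Fin k → Tm L n) : Fm L' n :=
  I.bexs k
    (conj (List.ofFn fun i : Fin k => I.graph (ts i) (Fin.castAdd k) (Fin.natAdd n i)) ⊓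
      substFm (fun i : Fin k => tvar (Fin.natAdd n i)) P)

/-- The translation `φ^I`: terms are unravelled and all quantifiers are restricted to `δ`. -/
def onFm : ∀ {n : ℕ}, Fm L n → Fm L' n
  | _, .falsum => .falsum
  | _, .equal t s => I.atom I.eq ![t, s]
  | _, .rel R ts => I.atom (I.rel R) ts
  | _, .imp φ ψ => .imp (onFm φ) (onFm ψ)
  | n, .all φ => .all ((I.domAt (Fin.last n)).imp (onFm φ))

/-- `∀ x₀ ∈ δ, …, ∀ x_{k-1} ∈ δ, ∃ y ∈ δ, F_I(x₀, …, x_{k-1}, y)`. -/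
def total {k : ℕ} (f : L.Functions k) : L'.Sentence :=
  I.balls (m := 0) k
    (I.domAt (Fin.last (0 + k)) ⊓
      substFm (fun i : Fin (k + 1) => tvar (Fin.cast (by omega) i)) (I.func f)).ex

/-- The translation is effective: the formula assigned to a symbol is computable from the symbol.
Every translation of a language with finitely many symbols is effective, see
`isRecursive_of_finite`. -/
def IsRecursive [Arithmetization L] [Arithmetization L'] : Prop :=
  (∃ g : ℕ → ℕ, Computable g ∧ ∀ (n : ℕ) (R : L.Relations n),
    g (Arithmetization.relCode R) = code (I.rel R)) ∧
  ∃ h : ℕ → ℕ, Computable h ∧ ∀ (n : ℕ) (f : L.Functions n),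
    h (Arithmetization.funcCode f) = code (I.func f)

theorem exists_computable_eqOn (s : Finset ℕ) (f : ℕ → ℕ) :
    ∃ g : ℕ → ℕ, Computable g ∧ ∀ c ∈ s, g c = f c := by
  induction s using Finset.induction with
  | empty => exact ⟨fun _ => 0, Computable.const 0, by simp⟩
  | insert a s ha ih =>
    obtain ⟨g, hg, h⟩ := ih
    refine ⟨fun c => if c = a then f a else g c, ?_, ?_⟩
    · refine (Computable.cond (c := fun c => decide (c = a)) ?_ (Computable.const (f a)) hg).of_eq
        (fun c => by simp [Bool.cond_decide])
      exact (Primrec.eq.comp Primrec.id (Primrec.const a)).decide.to_comp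
    · intro c hc
      rcases Finset.mem_insert.1 hc with rfl | hc
      · simp
      · by_cases hca : c = a
        · simp [hca]
        · simp [hca, h c hc]

theorem exists_computable_of_finite {A : ℕ → Type*} [Finite (Σ n, A n)] (c d : ∀ n, A n → ℕ)
    (hcd : ∀ n a m b, c n a = c m b → d n a = d m b) :
    ∃ g : ℕ → ℕ, Computable g ∧ ∀ n (a : A n), g (c n a) = d n a := by
  classical
  obtain ⟨g, hg, h⟩ := exists_computable_eqOn
    (Set.finite_range fun p : Σ n, A n => c p.1 p.2).toFinset
    (fun k => if hk : ∃ p : Σ n, A n, c p.1 p.2 = k then d hk.choose.1 hk.choose.2 else 0)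
  refine ⟨g, hg, fun n a => ?_⟩
  have hk : ∃ p : Σ n, A n, c p.1 p.2 = c n a := ⟨⟨n, a⟩, rfl⟩
  rw [h _ (by simpa using hk), dif_pos hk]
  exact hcd _ _ _ _ hk.choose_spec

theorem isRecursive_of_finite [Arithmetization L] [Arithmetization L']
    [Finite (Σ n, L.Functions n)] [Finite (Σ n, L.Relations n)] : I.IsRecursive := by
  refine ⟨exists_computable_of_finite (fun _ R => Arithmetization.relCode R)
      (fun _ R => code (I.rel R)) ?_,
    exists_computable_of_finite (fun _ f => Arithmetization.funcCode f)
      (fun _ f => code (I.func f)) ?_⟩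
  · intro n a m b h
    have ha := (Arithmetization.relArity_eq_some (L := L) _ n).2 ⟨a, rfl⟩
    have hb := (Arithmetization.relArity_eq_some (L := L) _ m).2 ⟨b, rfl⟩
    rw [h, hb] at ha
    obtain rfl := Option.some.inj ha
    rw [Arithmetization.relCode_injective _ h]
  · intro n a m b h
    have ha := (Arithmetization.funcArity_eq_some (L := L) _ n).2 ⟨a, rfl⟩
    have hb := (Arithmetization.funcArity_eq_some (L := L) _ m).2 ⟨b, rfl⟩
    rw [h, hb] at ha
    obtain rfl := Option.some.inj ha
    rw [Arithmetization.funcCode_injective _ h]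

/-- `I` is an interpretation of `T` in `S`: `S` proves that the translations of the function symbols
are total on `δ`, and `S` proves the translations of all theorems of `T` (the axioms of equality are
among these). -/
def IsInterpretation (T : L.Theory) (S : L'.Theory) : Prop :=
  (∀ (k : ℕ) (f : L.Functions k), Proves S (I.total f)) ∧
  ∀ φ : L.Sentence, Proves T φ → Proves S (I.onFm (n := 0) φ)

end Translation

/-- `T` is interpretable in `S`. -/
def Interpretable [Arithmetization L] [Arithmetization L'] (T : L.Theory) (S : L'.Theory) : Prop :=
  ∃ I : Translation L L', I.IsRecursive ∧ I.IsInterpretation T S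

/-- Gödel's first incompleteness theorem holds for `T`: every recursively axiomatizable consistent
theory (in any arithmetized language) in which `T` is interpretable is incomplete. -/
def G1Holds [Arithmetization L] (T : L.Theory) : Prop :=
  ∀ (L' : FirstOrder.Language.{u, v}) [Arithmetization L'] (S : L'.Theory),
    RecursivelyAxiomatizable S → Consistent S → Interpretable T S → Incomplete S

end Interpretation

end G1

/-!
Provability is handled through the completeness theorem, proved by a Henkin construction for the
calculus at hand.

If a theory is essentially incomplete, it is essentially undecidable, since a decidable consistent
theory has a decidable complete consistent extension: run through all sentences, adding each one
that is consistent with the previous choices.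

If `T` is essentially undecidable and interpretable in a complete, recursively axiomatizable `S`,
then a model of `S` defines a model `N` of `T`, and the theory of `N` is decidable, a contradiction.
Indeed, every sentence is logically equivalent to one in which function symbols occur only in the
form `F(x) = y`; for such a sentence the translation does not depend on choices and can be computed,
and `S` proves the translation if and only if `N` satisfies the sentence. So the sentences true in
`N` can be enumerated, and those which are false are those whose negation is true.

Finally, a theory is interpretable in each of its extensions by the identity translation.
-/

namespace G1

open FirstOrder.Language

universe u v w w₁

/-! ### Substitution, derivability and soundness -/

section Substitution

variable {L : FirstOrder.Language.{u, v}}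

@[simp] theorem substTm_tvar {m n : ℕ} (σ : Fin m → Tm L n) (i : Fin m) :
    substTm σ (tvar i) = σ i := rfl

theorem substTm_func {m n k : ℕ} (σ : Fin m → Tm L n) (f : L.Functions k) (ts : Fin k → Tm L m) :
    substTm σ (Term.func f ts) = Term.func f fun i => substTm σ (ts i) := rfl

theorem substTm_substTm {m n k : ℕ} (τ : Fin n → Tm L k) (σ : Fin m → Tm L n) (t : Tm L m) :
    substTm τ (substTm σ t) = substTm (fun i => substTm τ (σ i)) t := by
  induction t with
  | var x =>
    rcases x with e | i
    · exact e.elim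
    · rfl
  | func f ts ih => simp only [substTm_func, ih]

theorem substTm_tvar_left {n : ℕ} (t : Tm L n) : substTm tvar t = t := by
  induction t with
  | var x =>
    rcases x with e | i
    · exact e.elim
    · rfl
  | func f ts ih => simp only [substTm_func, ih]

theorem relabel_castSucc_eq_substTm {n : ℕ} (t : Tm L n) :
    (t.relabel (Sum.map id Fin.castSucc) : Tm L (n + 1)) =
      substTm (fun i => tvar i.castSucc) t := by
  induction t with
  | var x =>
    rcases x with e | i
    · exact e.elim
    · rfl
  | func f ts ih => simp only [substTm_func, Term.relabel, ih]

theorem liftSubst_castSucc {m n : ℕ} (σ : Fin m → Tm L n) (i : Fin m) :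
    liftSubst σ i.castSucc = substTm (fun i => tvar i.castSucc) (σ i) := by
  simp [liftSubst, relabel_castSucc_eq_substTm]

@[simp] theorem liftSubst_last {m n : ℕ} (σ : Fin m → Tm L n) :
    liftSubst σ (Fin.last m) = tvar (Fin.last n) := by
  simp [liftSubst]

theorem substTm_liftSubst_liftSubst {m n k : ℕ} (τ : Fin n → Tm L k) (σ : Fin m → Tm L n) :
    (fun i => substTm (liftSubst τ) (liftSubst σ i)) = liftSubst fun i => substTm τ (σ i) := by
  funext i
  refine Fin.lastCases ?_ (fun i => ?_) i
  · simp
  · simp only [liftSubst_castSucc, substTm_substTm, substTm_tvar]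

theorem liftSubst_tvar {n : ℕ} : liftSubst (tvar : Fin n → Tm L n) = tvar := by
  funext i
  refine Fin.lastCases ?_ (fun i => ?_) i
  · simp
  · simp [liftSubst_castSucc]

theorem substFm_substFm {m : ℕ} (φ : Fm L m) : ∀ {n k : ℕ} (τ : Fin n → Tm L k)
    (σ : Fin m → Tm L n), substFm τ (substFm σ φ) = substFm (fun i => substTm τ (σ i)) φ := by
  induction φ with
  | falsum => intros; rfl
  | equal t s => intros; simp only [substFm, substTm_substTm]
  | rel R ts => intros; simp only [substFm, substTm_substTm]
  | imp φ ψ ih₁ ih₂ => intros; simp only [substFm, ih₁, ih₂]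
  | all φ ih => intros; simp only [substFm, ih, substTm_liftSubst_liftSubst]

theorem substFm_tvar {n : ℕ} (φ : Fm L n) : substFm tvar φ = φ := by
  induction φ with
  | falsum => rfl
  | equal t s => simp only [substFm, substTm_tvar_left]
  | rel R ts => simp only [substFm, substTm_tvar_left]
  | imp φ ψ ih₁ ih₂ => simp only [substFm, ih₁, ih₂]
  | all φ ih => simp only [substFm, liftSubst_tvar, ih]

theorem weaken_substFm {m n : ℕ} (σ : Fin m → Tm L n) (φ : Fm L m) :
    weaken (substFm σ φ) = substFm (liftSubst σ) (weaken φ) := by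
  simp only [weaken, substFm_substFm, substTm_tvar, liftSubst_castSucc]

theorem substTm_snoc_castSucc {n : ℕ} (s t : Tm L n) :
    substTm (Fin.snoc (α := fun _ => Tm L n) tvar t)
      (substTm (fun i => tvar i.castSucc) s) = s := by
  rw [substTm_substTm]
  simp [substTm_tvar_left]

theorem inst_liftSubst {m n : ℕ} (σ : Fin m → Tm L n) (φ : Fm L (m + 1)) (t : Tm L n) :
    inst (substFm (liftSubst σ) φ) t = substFm (Fin.snoc (α := fun _ => Tm L n) σ t) φ := by
  rw [inst, substFm_substFm]
  congr 1
  funext i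
  refine Fin.lastCases ?_ (fun i => ?_) i
  · simp
  · simp [liftSubst_castSucc, substTm_snoc_castSucc]

theorem substFm_inst {m n : ℕ} (σ : Fin m → Tm L n) (φ : Fm L (m + 1)) (t : Tm L m) :
    substFm σ (inst φ t) = inst (substFm (liftSubst σ) φ) (substTm σ t) := by
  rw [inst_liftSubst, inst, substFm_substFm]
  congr 1
  funext i
  refine Fin.lastCases ?_ (fun i => ?_) i
  · simp
  · simp

theorem substFm_ofSentence {m n : ℕ} (σ : Fin m → Tm L n) (φ : L.Sentence) :
    substFm σ (ofSentence m φ) = ofSentence n φ := by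
  simp only [ofSentence, substFm_substFm]
  congr 1
  funext i
  exact i.elim0

theorem ofSentence_zero (φ : L.Sentence) : ofSentence 0 φ = φ := by
  have h : (fun i : Fin 0 => i.elim0) = (tvar : Fin 0 → Tm L 0) := funext fun i => i.elim0
  rw [ofSentence, h, substFm_tvar]

theorem weaken_ofSentence (n : ℕ) (φ : L.Sentence) :
    weaken (ofSentence n φ) = ofSentence (n + 1) φ :=
  substFm_ofSentence _ _

end Substitution

section Deduction

variable {L : FirstOrder.Language.{u, v}} {T : L.Theory}

namespace Provable

theorem subst {m : ℕ} {φ : Fm L m} (h : Provable T φ) :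
    ∀ {n : ℕ} (σ : Fin m → Tm L n), Provable T (substFm σ φ) := by
  induction h with
  | ax n hφ => intro k σ; rw [substFm_ofSentence]; exact .ax _ hφ
  | imp_intro φ ψ => intro k σ; exact .imp_intro _ _
  | imp_distrib φ ψ χ => intro k σ; exact .imp_distrib _ _ _
  | not_not_elim φ => intro k σ; exact .not_not_elim _
  | all_elim φ t =>
    intro k σ
    simp only [substFm, substFm_inst]
    exact .all_elim _ _
  | all_distrib φ ψ =>
    intro k σ
    simp only [substFm, ← weaken_substFm]
    exact .all_distrib _ _
  | exists_self n =>
    intro k σ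
    have := Provable.exists_self (T := T) k
    simpa only [BoundedFormula.ex, BoundedFormula.not, substFm, substTm_tvar, liftSubst_last,
      Bot.bot] using this
  | eq_refl t => intro k σ; exact .eq_refl _
  | eq_subst φ t s =>
    intro k σ
    simp only [substFm, substFm_inst]
    exact .eq_subst _ _ _
  | mp _ _ ih₁ ih₂ => intro k σ; exact .mp (ih₁ σ) (ih₂ σ)
  | gen _ ih => intro k σ; exact .gen (ih _)

variable {n : ℕ} {θ φ ψ : Fm L n}

theorem imp_const (h : Provable T φ) (θ : Fm L n) : Provable T (θ.imp φ) :=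
  .mp (.imp_intro _ _) h

theorem imp_mp (h₁ : Provable T (θ.imp (φ.imp ψ))) (h₂ : Provable T (θ.imp φ)) :
    Provable T (θ.imp ψ) :=
  .mp (.mp (.imp_distrib _ _ _) h₁) h₂

theorem imp_self (θ : Fm L n) : Provable T (θ.imp θ) :=
  .imp_mp (ψ := θ) (φ := θ.imp θ) (.imp_intro _ _) (.imp_intro _ _)

theorem imp_trans (h₁ : Provable T (θ.imp φ)) (h₂ : Provable T (φ.imp ψ)) :
    Provable T (θ.imp ψ) :=
  .imp_mp (h₂.imp_const _) h₁

theorem imp_swap (h : Provable T (θ.imp (φ.imp ψ))) : Provable T (φ.imp (θ.imp ψ)) :=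
  .imp_trans (.imp_intro _ _) (.mp (.imp_distrib _ _ _) h)

theorem ex_falso (φ : Fm L n) : Provable T ((⊥ : Fm L n).imp φ) :=
  .imp_trans (.imp_intro _ _) (.not_not_elim _)

theorem imp_comp (h : Provable T (φ.imp ψ)) (χ : Fm L n) :
    Provable T ((ψ.imp χ).imp (φ.imp χ)) :=
  .imp_swap (.imp_trans h (.imp_swap (.imp_self _)))

theorem by_contra (h : Provable T (φ.not.imp ⊥)) : Provable T φ :=
  .mp (.not_not_elim _) h

theorem and_left (φ ψ : Fm L n) : Provable T ((φ ⊓ ψ).imp φ) := by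
  have h : Provable T (φ.not.imp (φ.imp ψ.not)) :=
    .imp_swap (.imp_trans (.imp_swap (.imp_self φ.not))
      (.mp (.imp_distrib _ _ _) (.imp_const (.ex_falso _) _)))
  exact .imp_trans (.imp_comp h _) (.not_not_elim _)

theorem and_right (φ ψ : Fm L n) : Provable T ((φ ⊓ ψ).imp ψ) :=
  .imp_trans (.imp_comp (.imp_intro ψ.not φ) _) (.not_not_elim _)

theorem and_intro (φ ψ : Fm L n) : Provable T (φ.imp (ψ.imp (φ ⊓ ψ))) :=
  .imp_trans (.imp_swap (.imp_self (φ.imp ψ.not)))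
    (.imp_trans (.imp_distrib _ _ _) (.imp_comp (.imp_intro _ _) _))

theorem curry (h : Provable T ((θ ⊓ φ).imp ψ)) : Provable T (θ.imp (φ.imp ψ)) :=
  .imp_trans (.and_intro θ φ) (.mp (.imp_distrib _ _ _) (h.imp_const _))

theorem gen_imp {ψ : Fm L (n + 1)} (h : Provable T ((weaken φ).imp ψ)) :
    Provable T (φ.imp ψ.all) :=
  .mp (.all_distrib _ _) (.gen h)

theorem imp_bot_of_weaken (h : Provable T ((weaken φ).imp ⊥)) : Provable T (φ.imp ⊥) :=
  .imp_mp ((Provable.exists_self n).imp_const _) (.gen_imp (.imp_trans h (.ex_falso _)))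

end Provable

namespace Proves

theorem ofSentence_imp {θ φ : L.Sentence} (h : Proves T (θ.imp φ)) (n : ℕ) :
    Provable T ((ofSentence n θ).imp (ofSentence n φ)) :=
  Provable.subst h _

theorem of_mem {φ : L.Sentence} (h : φ ∈ T) : Proves T φ := by
  rw [Proves, ← ofSentence_zero φ]
  exact .ax 0 h

end Proves

theorem Provable.exists_imp_of_directed {ι : Type*} [Preorder ι] [IsDirectedOrder ι] [Nonempty ι]
    {S : L.Theory} {Θ : ι → L.Sentence} (hmono : ∀ i j, i ≤ j → Proves T ((Θ j).imp (Θ i)))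
    (hax : ∀ φ ∈ S, ∃ i, Proves T ((Θ i).imp φ)) {n : ℕ} {φ : Fm L n} (h : Provable S φ) :
    ∃ i, Provable T ((ofSentence n (Θ i)).imp φ) := by
  have of_logical {n : ℕ} {φ : Fm L n} (h : Provable T φ) :
      ∃ i, Provable T ((ofSentence n (Θ i)).imp φ) :=
    ⟨Classical.arbitrary ι, h.imp_const _⟩
  induction h with
  | ax n hφ => exact (hax _ hφ).imp fun i hi => hi.ofSentence_imp _
  | imp_intro φ ψ => exact of_logical (.imp_intro _ _)
  | imp_distrib φ ψ χ => exact of_logical (.imp_distrib _ _ _)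
  | not_not_elim φ => exact of_logical (.not_not_elim _)
  | all_elim φ t => exact of_logical (.all_elim _ _)
  | all_distrib φ ψ => exact of_logical (.all_distrib _ _)
  | exists_self n => exact of_logical (.exists_self _)
  | eq_refl t => exact of_logical (.eq_refl _)
  | eq_subst φ t s => exact of_logical (.eq_subst _ _ _)
  | mp _ _ ih₁ ih₂ =>
    obtain ⟨i, hi⟩ := ih₁
    obtain ⟨j, hj⟩ := ih₂
    obtain ⟨k, hik, hjk⟩ := exists_ge_ge i j
    exact ⟨k, .imp_mp (.imp_trans ((hmono i k hik).ofSentence_imp _) hi)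
      (.imp_trans ((hmono j k hjk).ofSentence_imp _) hj)⟩
  | gen _ ih =>
    obtain ⟨i, hi⟩ := ih
    exact ⟨i, .gen_imp (by rwa [weaken_ofSentence])⟩

theorem Provable.imp_of_insert {θ : L.Sentence} {n : ℕ} {φ : Fm L n}
    (h : Provable (insert θ T) φ) : Provable T ((ofSentence n θ).imp φ) := by
  have hax : ∀ φ ∈ insert θ T, ∃ _ : Unit, Proves T (θ.imp φ) := by
    rintro φ (rfl | hφ)
    · exact ⟨(), .imp_self _⟩
    · exact ⟨(), .imp_const (Proves.of_mem hφ) _⟩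
  obtain ⟨_, hφ⟩ := h.exists_imp_of_directed (Θ := fun _ => θ) (fun _ _ _ => .imp_self _) hax
  exact hφ

end Deduction

section Semantics

variable {L : FirstOrder.Language.{u, v}} {T : L.Theory} {M : Type w} [L.Structure M]

/-- The value of a term under an assignment of the variables `x₀, …, x_{n-1}`. -/
abbrev evalTm {n : ℕ} (t : Tm L n) (v : Fin n → M) : M := t.realize (Sum.elim default v)

/-- Truth of a formula under an assignment of the variables `x₀, …, x_{n-1}`. -/
abbrev Sat {n : ℕ} (φ : Fm L n) (v : Fin n → M) : Prop := φ.Realize default v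

@[simp] theorem evalTm_tvar {n : ℕ} (i : Fin n) (v : Fin n → M) :
    evalTm (tvar i : Tm L n) v = v i := rfl

theorem evalTm_substTm {m n : ℕ} (σ : Fin m → Tm L n) (t : Tm L m) (v : Fin n → M) :
    evalTm (substTm σ t) v = evalTm t fun i => evalTm (σ i) v := by
  rw [evalTm, substTm, Term.realize_subst]
  congr 1
  funext x
  rcases x with e | i
  · exact e.elim
  · rfl

theorem evalTm_liftSubst {m n : ℕ} (σ : Fin m → Tm L n) (v : Fin n → M) (a : M) :
    (fun i => evalTm (liftSubst σ i) (Fin.snoc v a : Fin (n + 1) → M)) =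
      (Fin.snoc (fun i => evalTm (σ i) v) a : Fin (m + 1) → M) := by
  funext i
  refine Fin.lastCases ?_ (fun i => ?_) i
  · simp
  · simp [liftSubst_castSucc, evalTm_substTm]

theorem sat_imp {n : ℕ} {φ ψ : Fm L n} {v : Fin n → M} :
    Sat (φ.imp ψ) v ↔ (Sat φ v → Sat ψ v) := Iff.rfl

theorem sat_all {n : ℕ} {φ : Fm L (n + 1)} {v : Fin n → M} :
    Sat φ.all v ↔ ∀ a, Sat φ (Fin.snoc v a : Fin (n + 1) → M) := Iff.rfl

theorem sat_ex {n : ℕ} {φ : Fm L (n + 1)} {v : Fin n → M} :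
    Sat φ.ex v ↔ ∃ a, Sat φ (Fin.snoc v a : Fin (n + 1) → M) := BoundedFormula.realize_ex

theorem sat_inf {n : ℕ} {φ ψ : Fm L n} {v : Fin n → M} :
    Sat (φ ⊓ ψ) v ↔ Sat φ v ∧ Sat ψ v := BoundedFormula.realize_inf

theorem sat_equal {n : ℕ} {t s : Tm L n} {v : Fin n → M} :
    Sat (.equal t s) v ↔ evalTm t v = evalTm s v := Iff.rfl

theorem evalTm_func {n k : ℕ} {f : L.Functions k} {ts : Fin k → Tm L n} {v : Fin n → M} :
    evalTm (.func f ts) v = Structure.funMap f fun i => evalTm (ts i) v := rfl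

theorem sat_conj {n : ℕ} {l : List (Fm L n)} {v : Fin n → M} :
    Sat (conj l) v ↔ ∀ φ ∈ l, Sat φ v := by
  induction l with
  | nil => simp [conj, Sat]
  | cons φ l ih =>
    rw [List.forall_mem_cons, ← ih]
    exact sat_inf

@[simp] theorem sat_substFm {m : ℕ} (φ : Fm L m) : ∀ {n : ℕ} (σ : Fin m → Tm L n) (v : Fin n → M),
    Sat (substFm σ φ) v ↔ Sat φ fun i => evalTm (σ i) v := by
  induction φ with
  | falsum => intros; rfl
  | equal t s =>
    intro n σ v
    exact Eq.congr (evalTm_substTm σ t v) (evalTm_substTm σ s v)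
  | rel R ts =>
    intro n σ v
    have h : (fun i => evalTm (substTm σ (ts i)) v) =
        fun i => evalTm (ts i) fun i => evalTm (σ i) v := funext fun i => evalTm_substTm σ (ts i) v
    exact iff_of_eq (congrArg _ h)
  | imp φ ψ ih₁ ih₂ => intro n σ v; exact imp_congr (ih₁ σ v) (ih₂ σ v)
  | all φ ih =>
    intro n σ v
    refine forall_congr' fun a => ?_
    rw [← evalTm_liftSubst]
    exact ih _ _

theorem sat_inst {n : ℕ} (φ : Fm L (n + 1)) (t : Tm L n) (v : Fin n → M) :
    Sat (inst φ t) v ↔ Sat φ (Fin.snoc v (evalTm t v) : Fin (n + 1) → M) := by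
  rw [inst, sat_substFm]
  have h : (fun i => evalTm (Fin.snoc (α := fun _ => Tm L n) tvar t i) v) =
      (Fin.snoc v (evalTm t v) : Fin (n + 1) → M) := by
    funext i
    refine Fin.lastCases ?_ (fun i => ?_) i <;> simp
  rw [h]

theorem sat_weaken {n : ℕ} (φ : Fm L n) (v : Fin n → M) (a : M) :
    Sat (weaken φ) (Fin.snoc v a : Fin (n + 1) → M) ↔ Sat φ v := by
  simp [weaken]

theorem sat_ofSentence {n : ℕ} (φ : L.Sentence) (v : Fin n → M) :
    Sat (ofSentence n φ) v ↔ M ⊨ φ := by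
  rw [ofSentence, sat_substFm, Sentence.Realize, Formula.Realize, Subsingleton.elim (fun _ => _)]

theorem Provable.sound [Nonempty M] (hM : ∀ φ ∈ T, M ⊨ φ) {n : ℕ} {φ : Fm L n}
    (h : Provable T φ) : ∀ v : Fin n → M, Sat φ v := by
  induction h with
  | ax n hφ => intro v; rw [sat_ofSentence]; exact hM _ hφ
  | imp_intro φ ψ => intro v h _; exact h
  | imp_distrib φ ψ χ => intro v h₁ h₂ h; exact h₁ h (h₂ h)
  | not_not_elim φ => intro v h; exact not_not.1 h
  | all_elim φ t => intro v h; exact (sat_inst _ _ _).2 (h _)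
  | all_distrib φ ψ => intro v h₁ h a; exact h₁ a ((sat_weaken _ _ _).2 h)
  | exists_self n =>
    intro v
    obtain ⟨a⟩ := ‹Nonempty M›
    exact BoundedFormula.realize_ex.2 ⟨a, rfl⟩
  | eq_refl t => intro v; rfl
  | eq_subst φ t s =>
    intro v (h : evalTm t v = evalTm s v)
    change Sat (inst φ t) v → Sat (inst φ s) v
    rw [sat_inst, sat_inst, h]
    exact id
  | mp _ _ ih₁ ih₂ => intro v; exact ih₁ v (ih₂ v)
  | gen _ ih => intro v a; exact ih _

theorem Proves.sound [Nonempty M] (hM : ∀ φ ∈ T, M ⊨ φ) {φ : L.Sentence} (h : Proves T φ) :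
    M ⊨ φ :=
  Provable.sound hM h default

end Semantics

/-! ### The completeness theorem -/

section Equality

variable {L : FirstOrder.Language.{u, v}} {T : L.Theory}

namespace Provable

variable {n k : ℕ} {θ : Fm L k} {t s r : Tm L k} {σ τ : Fin n → Tm L k}

theorem imp_substFm_congr (h : ∀ i, Provable T (θ.imp (.equal (σ i) (τ i)))) (φ : Fm L n)
    (hφ : Provable T (θ.imp (substFm σ φ))) : Provable T (θ.imp (substFm τ φ)) := by
  classical
  -- The variables are replaced one at a time.
  have partially_replaced (s : Finset (Fin n)) :
      Provable T (θ.imp (substFm (fun i => if i ∈ s then τ i else σ i) φ)) := by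
    induction s using Finset.induction with
    | empty => simpa using hφ
    | insert a s ha ih =>
      let ρ : Fin n → Tm L (k + 1) := fun i => if i = a then tvar (Fin.last k) else
        substTm (fun i => tvar i.castSucc) (if i ∈ s then τ i else σ i)
      have inst_left : inst (substFm ρ φ) (σ a) =
          substFm (fun i => if i ∈ s then τ i else σ i) φ := by
        rw [inst, substFm_substFm]
        congr 1
        funext i
        rcases eq_or_ne i a with rfl | hi
        · simp [ρ, ha]
        · simp [ρ, hi, substTm_snoc_castSucc]
      have inst_right : inst (substFm ρ φ) (τ a) =
          substFm (fun i => if i ∈ insert a s then τ i else σ i) φ := by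
        rw [inst, substFm_substFm]
        congr 1
        funext i
        rcases eq_or_ne i a with rfl | hi
        · simp [ρ]
        · simp [ρ, hi, substTm_snoc_castSucc]
      have replace_one := Provable.eq_subst (T := T) (substFm ρ φ) (σ a) (τ a)
      rw [inst_left, inst_right] at replace_one
      exact .imp_mp (.imp_trans (h a) replace_one) ih
  simpa using partially_replaced Finset.univ

theorem imp_eq_symm (h : Provable T (θ.imp (.equal t s))) :
    Provable T (θ.imp (.equal s t)) := by
  refine imp_substFm_congr (σ := ![t, t]) (τ := ![s, t]) (fun i => ?_)
    (.equal (tvar 0) (tvar 1)) (.imp_const (.eq_refl _) _)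
  fin_cases i
  · exact h
  · exact .imp_const (.eq_refl _) _

theorem imp_eq_trans (h₁ : Provable T (θ.imp (.equal t s)))
    (h₂ : Provable T (θ.imp (.equal s r))) : Provable T (θ.imp (.equal t r)) := by
  refine imp_substFm_congr (σ := ![t, s]) (τ := ![t, r]) (fun i => ?_)
    (.equal (tvar 0) (tvar 1)) h₁
  fin_cases i
  · exact .imp_const (.eq_refl _) _
  · exact h₂

theorem imp_substTm_congr (h : ∀ i, Provable T (θ.imp (.equal (σ i) (τ i)))) (t : Tm L n) :
    Provable T (θ.imp (.equal (substTm σ t) (substTm τ t))) := by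
  let φ : Fm L (n + 1) :=
    .equal (tvar (Fin.last n)) (substTm (fun i => tvar i.castSucc) t)
  have substFm_snoc (ρ : Fin n → Tm L k) :
      substFm (Fin.snoc (α := fun _ => Tm L k) ρ (substTm σ t)) φ =
        .equal (substTm σ t) (substTm ρ t) := by
    simp [φ, substFm, substTm_substTm]
  rw [← substFm_snoc]
  refine imp_substFm_congr (σ := Fin.snoc (α := fun _ => Tm L k) σ (substTm σ t))
    (fun i => ?_) φ ?_
  · induction i using Fin.lastCases with
    | last => simpa using .imp_const (.eq_refl _) _
    | cast i => simpa using h i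
  · rw [substFm_snoc]
    exact .imp_const (.eq_refl _) _

end Provable

end Equality

section Completeness

open Filter

variable {L : FirstOrder.Language.{u, v}} {T : L.Theory}

/-- `θ` settles `φ` in the manner of Henkin: it decides `φ`, and if it refutes a universal formula
`∀ x_k χ`, then the fresh variable `x_k` of its context is a counterexample. -/
def Settles (T : L.Theory) {k : ℕ} (θ : Fm L (k + 1)) (φ : Fm L k) : Prop :=
  Provable T (θ.imp (weaken φ)) ∨
    Provable T (θ.imp (weaken φ).not) ∧ ∀ χ, φ = .all χ → Provable T (θ.imp χ.not)

theorem exists_settles {k : ℕ} (θ : Fm L k) (hθ : ¬ Provable T (θ.imp ⊥)) (φ : Fm L k) :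
    ∃ θ' : Fm L (k + 1), ¬ Provable T (θ'.imp ⊥) ∧ Provable T (θ'.imp (weaken θ)) ∧
      Settles T θ' φ := by
  by_cases h : Provable T (θ.imp φ.not)
  · by_cases hχ : ∃ χ, φ = .all χ
    · obtain ⟨χ, rfl⟩ := hχ
      refine ⟨weaken θ ⊓ χ.not, fun hbot => hθ ?_, .and_left _ _, .inr ⟨?_, ?_⟩⟩
      · exact .imp_mp h (.gen_imp (.imp_trans hbot.curry (.not_not_elim _)))
      · exact .imp_trans (.and_left _ _) (h.subst _)
      · rintro χ' h'
        cases h'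
        exact .and_right _ _
    · refine ⟨weaken θ, fun hbot => hθ hbot.imp_bot_of_weaken, .imp_self _, .inr ⟨h.subst _, ?_⟩⟩
      exact fun χ h' => absurd ⟨χ, h'⟩ hχ
  · refine ⟨weaken (θ ⊓ φ), fun hbot => h hbot.imp_bot_of_weaken.curry, ?_, .inl ?_⟩
    · exact .and_left _ _
    · exact .and_right _ _

/-- The formulas of a context seen as formulas of a larger context. -/
def embed {n k : ℕ} (h : n ≤ k) (φ : Fm L n) : Fm L k :=
  substFm (fun i => tvar (Fin.castLE h i)) φ

/-- A sequence of formulas in growing contexts, each consistent with `T` and implying the previous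
ones, which settles all formulas. It takes the place of a complete Henkin theory, the variables
serving as the witnessing constants. -/
structure HenkinChain (T : L.Theory) where
  seq : ∀ k, Fm L k
  consistent : ∀ k, ¬ Provable T ((seq k).imp ⊥)
  mono : ∀ k, Provable T ((seq (k + 1)).imp (weaken (seq k)))
  settles : ∀ {n : ℕ} (φ : Fm L n), ∃ k, ∃ h : n ≤ k, Settles T (seq (k + 1)) (embed h φ)

theorem Consistent.nonempty_henkinChain [∀ n, Countable (Fm L n)] (hT : Consistent T) :
    Nonempty (HenkinChain T) := by
  choose enum enum_surjective using fun n => exists_surjective_nat (Fm L n)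
  choose step step_consistent step_mono step_settles using @exists_settles L T
  let target (k : ℕ) : Fm L k := embed (Nat.unpair_left_le k) (enum k.unpair.1 k.unpair.2)
  let chain (k : ℕ) : {θ : Fm L k // ¬ Provable T (θ.imp ⊥)} :=
    Nat.rec ⟨⊤, fun h => hT (.mp h (.imp_self _))⟩
      (fun k θ => ⟨step θ.1 θ.2 (target k), step_consistent _ _ _⟩) k
  refine ⟨⟨fun k => (chain k).1, fun k => (chain k).2, fun k => step_mono _ _ _, fun {n} φ => ?_⟩⟩
  obtain ⟨c, rfl⟩ := enum_surjective n φ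
  have target_pair : embed (Nat.left_le_pair n c) (enum n c) = target (Nat.pair n c) := by
    have embed_congr : ∀ n' c' (h' : n' ≤ Nat.pair n c), n = n' → c = c' →
        embed (Nat.left_le_pair n c) (enum n c) = embed h' (enum n' c') := by
      rintro n' c' h' rfl rfl
      rfl
    exact embed_congr _ _ _ (by simp) (by simp)
  refine ⟨Nat.pair n c, Nat.left_le_pair _ _, ?_⟩
  rw [target_pair]
  exact step_settles _ _ _

namespace HenkinChain

/-- The substitution of the variable `x_{v i}` for `x_i`. -/
def vars {n k : ℕ} (v : Fin n → ℕ) (h : ∀ i, v i < k) : Fin n → Tm L k := fun i => tvar ⟨v i, h i⟩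

theorem vars_snoc {n k : ℕ} (v : Fin n → ℕ) (h : ∀ i, v i < k) (j : ℕ) (hj : j < k)
    (h' : ∀ i, (Fin.snoc v j : Fin (n + 1) → ℕ) i < k) :
    (vars (Fin.snoc v j) h' : Fin (n + 1) → Tm L k) =
      Fin.snoc (α := fun _ => Tm L k) (vars v h) (tvar ⟨j, hj⟩) := by
  funext i
  refine Fin.lastCases ?_ (fun i => ?_) i <;> simp [vars]

theorem snoc_lt {n k : ℕ} {v : Fin n → ℕ} (h : ∀ i, v i < k) {j : ℕ} (hj : j < k) :
    ∀ i, (Fin.snoc v j : Fin (n + 1) → ℕ) i < k := by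
  intro i
  refine Fin.lastCases ?_ (fun i => ?_) i
  · simpa
  · simpa using h i

theorem weaken_substFm_vars {n k : ℕ} (v : Fin n → ℕ) (h : ∀ i, v i < k) (φ : Fm L n) :
    weaken (substFm (vars v h) φ) =
      substFm (vars v fun i => (h i).trans (Nat.lt_succ_self k)) φ := by
  rw [weaken, substFm_substFm]
  rfl

theorem embed_substFm_vars {n k m : ℕ} (v : Fin n → ℕ) (h : ∀ i, v i < k) (hk : k ≤ m)
    (φ : Fm L n) :
    embed hk (substFm (vars v h) φ) = substFm (vars v fun i => (h i).trans_le hk) φ := by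
  rw [embed, substFm_substFm]
  rfl

theorem liftSubst_vars {n k : ℕ} (v : Fin n → ℕ) (h : ∀ i, v i < k) :
    liftSubst (vars v h : Fin n → Tm L k) = vars (Fin.snoc v k : Fin (n + 1) → ℕ)
      (snoc_lt (fun i => (h i).trans (Nat.lt_succ_self k)) (Nat.lt_succ_self k)) := by
  funext i
  refine Fin.lastCases ?_ (fun i => ?_) i
  · simp [vars]; rfl
  · simp [liftSubst_castSucc, vars]

theorem eventually_lt {n : ℕ} (v : Fin n → ℕ) : ∀ᶠ k in atTop, ∀ i, v i < k :=
  eventually_all.2 fun i => eventually_gt_atTop (v i)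

variable (C : HenkinChain T)

/-- The members of the chain eventually imply `φ` with `x_{v i}` substituted for `x_i`: this will be
truth of `φ` at the elements denoted by the variables `x_{v i}`. -/
def Forces {n : ℕ} (φ : Fm L n) (v : Fin n → ℕ) : Prop :=
  ∀ᶠ k in atTop, ∀ h : ∀ i, v i < k, Provable T ((C.seq k).imp (substFm (vars v h) φ))

/-- The members of the chain eventually imply `t = x_j`, with `x_{v i}` substituted for `x_i` in
`t`. -/
def ForcesVal {n : ℕ} (t : Tm L n) (v : Fin n → ℕ) (j : ℕ) : Prop :=
  ∀ᶠ k in atTop, ∀ (h : ∀ i, v i < k) (hj : j < k),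
    Provable T ((C.seq k).imp (.equal (substTm (vars v h) t) (tvar ⟨j, hj⟩)))

variable {C} {n : ℕ} {v : Fin n → ℕ}

theorem Forces.of_stage {φ : Fm L n} (k : ℕ) (h : ∀ i, v i < k)
    (hφ : Provable T ((C.seq k).imp (substFm (vars v h) φ))) : C.Forces φ v := by
  refine eventually_atTop.2 ⟨k, fun m hm => ?_⟩
  induction m, hm using Nat.le_induction with
  | base => exact fun _ => hφ
  | succ m hm ih =>
    intro _
    have hv : ∀ i, v i < m := fun i => (h i).trans_le hm
    rw [← weaken_substFm_vars v hv]
    exact .imp_trans (C.mono m) ((ih hv).subst _)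

theorem Forces.of_provable {φ : Fm L n} (h : Provable T φ) (v : Fin n → ℕ) : C.Forces φ v :=
  Eventually.of_forall fun _ _ => .imp_const (h.subst _) _

theorem Forces.mp {φ ψ : Fm L n} (h₁ : C.Forces (φ.imp ψ) v) (h₂ : C.Forces φ v) :
    C.Forces ψ v := by
  filter_upwards [h₁, h₂] with k h₁ h₂ h
  exact .imp_mp (h₁ h) (h₂ h)

theorem not_forces_bot (v : Fin n → ℕ) : ¬ C.Forces (⊥ : Fm L n) v := by
  intro h
  obtain ⟨k, hk, hv⟩ := (h.and (eventually_lt v)).exists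
  exact C.consistent k (hk hv)

theorem forces_or_forces_not (φ : Fm L n) (v : Fin n → ℕ) : C.Forces φ v ∨ C.Forces φ.not v := by
  obtain ⟨m, hm⟩ := (eventually_lt v).exists
  obtain ⟨k, hk, h⟩ := C.settles (substFm (vars v hm) φ)
  rw [embed_substFm_vars, Settles, weaken_substFm_vars] at h
  rcases h with h | ⟨h, _⟩
  · exact .inl (.of_stage _ _ h)
  · exact .inr (.of_stage _ _ h)

theorem forces_imp {φ ψ : Fm L n} : C.Forces (φ.imp ψ) v ↔ (C.Forces φ v → C.Forces ψ v) := by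
  refine ⟨Forces.mp, fun h => ?_⟩
  rcases forces_or_forces_not φ v with hφ | hφ
  · exact .mp (.of_provable (.imp_intro _ _) _) (h hφ)
  · filter_upwards [hφ] with k hφ hv
    exact .imp_trans (hφ hv) (.mp (.imp_distrib _ _ _) (.imp_const (.ex_falso _) _))

theorem forces_all {χ : Fm L (n + 1)} :
    C.Forces χ.all v ↔ ∀ j, C.Forces χ (Fin.snoc v j : Fin (n + 1) → ℕ) := by
  constructor
  · intro h j
    filter_upwards [h, eventually_lt v, eventually_gt_atTop j] with k hk hv hj h'
    have all_elim := Provable.all_elim (T := T) (substFm (liftSubst (vars v hv)) χ) (tvar ⟨j, hj⟩)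
    rw [inst_liftSubst, ← vars_snoc v hv j hj h'] at all_elim
    exact .imp_trans (hk hv) all_elim
  · intro h
    obtain ⟨m, hm⟩ := (eventually_lt v).exists
    obtain ⟨k, hk, settled⟩ := C.settles (substFm (vars v hm) χ.all)
    rw [embed_substFm_vars, Settles, weaken_substFm_vars] at settled
    rcases settled with proved | ⟨_, refuted⟩
    · exact .of_stage _ _ proved
    · have counterexample := refuted _ rfl
      rw [liftSubst_vars] at counterexample
      have hχ : C.Forces χ.not (Fin.snoc v k : Fin (n + 1) → ℕ) := .of_stage _ _ counterexample
      exact absurd (hχ.mp (h k)) (not_forces_bot _)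

theorem exists_forcesVal (t : Tm L n) (v : Fin n → ℕ) : ∃ j, C.ForcesVal t v j := by
  by_contra hcon
  let ε : Fm L (n + 1) := .equal (substTm (fun i => tvar i.castSucc) t) (tvar (Fin.last n))
  have substFm_snoc {k : ℕ} (h : ∀ i, v i < k) (s : Tm L k) :
      substFm (Fin.snoc (α := fun _ => Tm L k) (vars v h) s) ε =
        .equal (substTm (vars v h) t) s := by
    simp [ε, substFm, substTm_substTm]
  have forces_not (j : ℕ) : C.Forces ε.not (Fin.snoc v j : Fin (n + 1) → ℕ) := by
    refine (forces_or_forces_not ε _).resolve_left fun hε => hcon ⟨j, ?_⟩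
    filter_upwards [hε] with k hk hv hj
    have := hk (snoc_lt hv hj)
    rwa [vars_snoc v hv j hj, substFm_snoc] at this
  obtain ⟨k, hk, hv⟩ := ((forces_all.2 forces_not).and (eventually_lt v)).exists
  have all_elim := Provable.all_elim (T := T) (substFm (liftSubst (vars v hv)) ε.not)
    (substTm (vars v hv) t)
  rw [inst_liftSubst] at all_elim
  refine C.consistent k (.imp_mp (φ := .equal (substTm (vars v hv) t) (substTm (vars v hv) t))
    ?_ (.imp_const (.eq_refl _) _))
  rw [← substFm_snoc]
  exact .imp_trans (hk hv) all_elim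

theorem forces_substFm {m : ℕ} {σ : Fin m → Tm L n} {g : Fin m → ℕ}
    (hg : ∀ i, C.ForcesVal (σ i) v (g i)) (φ : Fm L m) :
    C.Forces (substFm σ φ) v ↔ C.Forces φ g := by
  constructor
  · intro h
    filter_upwards [h, eventually_all.2 hg, eventually_lt v] with k h hg hv hgk
    refine .imp_substFm_congr (fun i => hg i hv (hgk i)) φ ?_
    rw [← substFm_substFm]
    exact h hv
  · intro h
    filter_upwards [h, eventually_all.2 hg, eventually_lt g] with k h hg hgk hv
    rw [substFm_substFm]
    exact .imp_substFm_congr (fun i => (hg i hv (hgk i)).imp_eq_symm) φ (h hgk)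

theorem forcesVal_substTm {m : ℕ} {σ : Fin m → Tm L n} {g : Fin m → ℕ}
    (hg : ∀ i, C.ForcesVal (σ i) v (g i)) (t : Tm L m) {j : ℕ} :
    C.ForcesVal (substTm σ t) v j ↔ C.ForcesVal t g j := by
  have congr_eventually : ∀ᶠ k in atTop, ∀ (hv : ∀ i, v i < k) (hgk : ∀ i, g i < k), Provable T
      ((C.seq k).imp (.equal (substTm (vars v hv) (substTm σ t)) (substTm (vars g hgk) t))) := by
    filter_upwards [eventually_all.2 hg] with k hg hv hgk
    rw [substTm_substTm]
    exact .imp_substTm_congr (fun i => hg i hv (hgk i)) t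
  constructor
  · intro h
    filter_upwards [h, congr_eventually, eventually_lt v] with k h hk hv hgk hj
    exact (hk hv hgk).imp_eq_symm.imp_eq_trans (h hv hj)
  · intro h
    filter_upwards [h, congr_eventually, eventually_lt g] with k h hk hgk hv hj
    exact (hk hv hgk).imp_eq_trans (h hgk hj)

theorem forces_equal_iff {t s : Tm L n} {j : ℕ} (hs : C.ForcesVal s v j) :
    C.Forces (.equal t s) v ↔ C.ForcesVal t v j := by
  constructor
  · intro h
    filter_upwards [h, hs] with k h hs hv hj
    exact (h hv).imp_eq_trans (hs hv hj)
  · intro h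
    filter_upwards [h, hs, eventually_gt_atTop j] with k h hs hj hv
    exact (h hv hj).imp_eq_trans (hs hv hj).imp_eq_symm

/-- Forced equality of variables. -/
def varSetoid (C : HenkinChain T) : Setoid ℕ where
  r i j := ∀ᶠ k in atTop, ∀ (hi : i < k) (hj : j < k),
    Provable T ((C.seq k).imp (.equal (tvar ⟨i, hi⟩) (tvar ⟨j, hj⟩)))
  iseqv :=
    { refl _ := Eventually.of_forall fun _ _ _ => .imp_const (.eq_refl _) _
      symm h := h.mono fun _ h hi hj => (h hj hi).imp_eq_symm
      trans {_ j _} h₁ h₂ := by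
        filter_upwards [h₁, h₂, eventually_gt_atTop j] with k h₁ h₂ hj hi hl
        exact (h₁ hi hj).imp_eq_trans (h₂ hj hl) }

variable (C) in
/-- The domain of the term model: variables up to forced equality. Terms are not needed, since every
term is forced to be equal to a variable. -/
def Domain : Type := Quotient C.varSetoid

variable (C) in
/-- The element of the term model denoted by the variable `x_i`. -/
def elem (i : ℕ) : C.Domain := Quotient.mk C.varSetoid i

/-- The index of some variable denoting a given element. -/
noncomputable def name (x : C.Domain) : ℕ := Quotient.out (s := C.varSetoid) x

@[simp] theorem elem_name (x : C.Domain) : C.elem (name x) = x :=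
  Quotient.out_eq (s := C.varSetoid) x

theorem forcesVal_tvar {i : Fin n} {j : ℕ} :
    C.ForcesVal (tvar i) v j ↔ C.elem (v i) = C.elem j := by
  refine Iff.trans ?_ (Quotient.eq (r := C.varSetoid)).symm
  constructor
  · intro h
    filter_upwards [h, eventually_lt v] with k h hv _ hj
    exact h hv hj
  · intro h
    filter_upwards [h] with k h hv hj
    exact h (hv i) hj

theorem ForcesVal.iff_elem_eq {t : Tm L n} {i j : ℕ} (hi : C.ForcesVal t v i) :
    C.ForcesVal t v j ↔ C.elem i = C.elem j := by
  have h := forcesVal_substTm (g := ![i]) (σ := fun _ : Fin 1 => t) (fun _ => by simpa using hi)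
    (tvar 0) (j := j)
  exact h.trans forcesVal_tvar

noncomputable instance : L.Structure C.Domain where
  funMap f x := C.elem (exists_forcesVal (C := C) (Term.func f tvar) fun i => name (x i)).choose
  RelMap R x := C.Forces (.rel R tvar) fun i => name (x i)

instance : Nonempty C.Domain := ⟨C.elem 0⟩

theorem forcesVal_tvar_name (g : Fin n → ℕ) (i : Fin n) :
    C.ForcesVal (tvar i) (fun i => name (C.elem (g i))) (g i) :=
  forcesVal_tvar.2 (elem_name _)

theorem funMap_elem_eq {f : L.Functions n} {g : Fin n → ℕ} {j : ℕ} :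
    Structure.funMap f (fun i => C.elem (g i)) = C.elem j ↔ C.ForcesVal (.func f tvar) g j := by
  rw [← forcesVal_substTm (forcesVal_tvar_name g), substTm_tvar_left]
  exact (ForcesVal.iff_elem_eq (Exists.choose_spec _)).symm

theorem relMap_elem {R : L.Relations n} {g : Fin n → ℕ} :
    Structure.RelMap R (fun i => C.elem (g i)) ↔ C.Forces (.rel R tvar) g := by
  rw [← forces_substFm (forcesVal_tvar_name g), substFm_tvar]
  rfl

theorem evalTm_eq_elem (t : Tm L n) (v : Fin n → ℕ) (j : ℕ) :
    evalTm t (fun i => C.elem (v i)) = C.elem j ↔ C.ForcesVal t v j := by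
  induction t generalizing j with
  | var x =>
    rcases x with e | i
    · exact e.elim
    · exact forcesVal_tvar.symm
  | func f ts ih =>
    choose g hg using fun i => exists_forcesVal (C := C) (ts i) v
    have evalTm_ts : (fun i => evalTm (ts i) fun i => C.elem (v i)) = fun i => C.elem (g i) :=
      funext fun i => (ih i _).2 (hg i)
    rw [evalTm_func, evalTm_ts, funMap_elem_eq, ← forcesVal_substTm hg]
    rfl

theorem elem_comp_snoc (v : Fin n → ℕ) (j : ℕ) :
    (fun i => C.elem ((Fin.snoc v j : Fin (n + 1) → ℕ) i)) =
      (Fin.snoc (fun i => C.elem (v i)) (C.elem j) : Fin (n + 1) → C.Domain) :=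
  Fin.comp_snoc C.elem v j

theorem sat_iff_forces (φ : Fm L n) (v : Fin n → ℕ) :
    Sat φ (fun i => C.elem (v i)) ↔ C.Forces φ v := by
  induction φ with
  | falsum => exact ⟨False.elim, not_forces_bot v⟩
  | equal t s =>
    obtain ⟨j, hj⟩ := exists_forcesVal (C := C) s v
    rw [sat_equal, (evalTm_eq_elem s v j).2 hj, evalTm_eq_elem, forces_equal_iff hj]
  | rel R ts =>
    choose g hg using fun i => exists_forcesVal (C := C) (ts i) v
    have evalTm_ts : (fun i => evalTm (ts i) fun i => C.elem (v i)) = fun i => C.elem (g i) :=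
      funext fun i => (evalTm_eq_elem _ _ _).2 (hg i)
    change Structure.RelMap R (fun i => evalTm (ts i) fun i => C.elem (v i)) ↔ _
    rw [evalTm_ts, relMap_elem, ← forces_substFm hg]
    rfl
  | imp φ ψ ih₁ ih₂ => rw [forces_imp, sat_imp, ih₁, ih₂]
  | all χ ih =>
    have elem_surjective : Function.Surjective C.elem := fun x => ⟨name x, elem_name x⟩
    rw [forces_all, sat_all, elem_surjective.forall]
    exact forall_congr' fun j => by rw [← ih, elem_comp_snoc]

end HenkinChain

theorem Consistent.exists_model [∀ n, Countable (Fm L n)] (hT : Consistent T) :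
    ∃ (M : Type) (_ : L.Structure M) (_ : Nonempty M), ∀ φ ∈ T, M ⊨ φ := by
  obtain ⟨C⟩ := hT.nonempty_henkinChain
  refine ⟨C.Domain, inferInstance, inferInstance, fun φ hφ => ?_⟩
  have h := (HenkinChain.sat_iff_forces (C := C) φ Fin.elim0).2 (.of_provable (Proves.of_mem hφ) _)
  rwa [Sat, Subsingleton.elim (fun _ => _) (default : Fin 0 → C.Domain)] at h

theorem proves_of_forall_models [∀ n, Countable (Fm L n)] {φ : L.Sentence}
    (h : ∀ (M : Type) [L.Structure M] [Nonempty M], (∀ ψ ∈ T, M ⊨ ψ) → M ⊨ φ) : Proves T φ := by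
  by_contra hφ
  have consistent_insert : Consistent (insert φ.not T) := by
    intro hbot
    have := Provable.imp_of_insert hbot
    rw [ofSentence_zero] at this
    exact hφ this.by_contra
  obtain ⟨M, _, _, hM⟩ := consistent_insert.exists_model
  exact hM _ (Set.mem_insert _ _) (h M fun ψ hψ => hM ψ (Set.mem_insert_of_mem _ hψ))

end Completeness

/-! ### Structures defined by translations -/

namespace Translation

variable {L L' : FirstOrder.Language.{u, v}} (I : Translation L L')

section TranslationSemantics

variable {M : Type w} [L'.Structure M]

variable (M) in
/-- The elements of an `L'`-structure satisfying the domain formula `δ`. -/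
abbrev Domain : Type w := {x : M // Sat I.dom fun _ => x}

variable {I} in
theorem coe_snoc {n : ℕ} (v : Fin n → I.Domain M) (a : I.Domain M) :
    (fun i => ((Fin.snoc v a : Fin (n + 1) → I.Domain M) i : M)) =
      (Fin.snoc (fun i => (v i : M)) (a : M) : Fin (n + 1) → M) :=
  Fin.comp_snoc Subtype.val v a

theorem sat_domAt {n : ℕ} {i : Fin n} {v : Fin n → M} :
    Sat (I.domAt i) v ↔ Sat I.dom fun _ => v i := by
  simp [domAt]

theorem sat_bex {n : ℕ} {φ : Fm L' (n + 1)} {v : Fin n → M} :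
    Sat (I.domAt (Fin.last n) ⊓ φ).ex v ↔
      ∃ a : I.Domain M, Sat φ (Fin.snoc v a : Fin (n + 1) → M) := by
  simp only [sat_ex, sat_inf, sat_domAt, Fin.snoc_last, Subtype.exists, exists_prop]

theorem sat_ball {n : ℕ} {φ : Fm L' (n + 1)} {v : Fin n → M} :
    Sat ((I.domAt (Fin.last n)).imp φ).all v ↔
      ∀ a : I.Domain M, Sat φ (Fin.snoc v a : Fin (n + 1) → M) := by
  simp only [sat_all, sat_imp, sat_domAt, Fin.snoc_last, Subtype.forall]

theorem sat_bexs {m : ℕ} (k : ℕ) (φ : Fm L' (m + k)) (v : Fin m → M) :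
    Sat (I.bexs k φ) v ↔ ∃ z : Fin k → I.Domain M, Sat φ (Fin.append v fun i => z i) := by
  induction k with
  | zero =>
    rw [Fin.exists_fin_zero_pi, Subsingleton.elim (fun i => _) Fin.elim0, Fin.append_elim0]
    rfl
  | succ k ih =>
    simp only [bexs, ih, sat_bex]
    constructor
    · rintro ⟨z, a, h⟩
      exact ⟨Fin.snoc z a, by rwa [coe_snoc, Fin.append_snoc]⟩
    · rintro ⟨z, h⟩
      exact ⟨Fin.init z, z (Fin.last k),
        by rwa [← Fin.append_snoc, ← coe_snoc, Fin.snoc_init_self]⟩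

theorem sat_balls {m : ℕ} (k : ℕ) (φ : Fm L' (m + k)) (v : Fin m → M) :
    Sat (I.balls k φ) v ↔ ∀ z : Fin k → I.Domain M, Sat φ (Fin.append v fun i => z i) := by
  induction k with
  | zero =>
    rw [Fin.forall_fin_zero_pi, Subsingleton.elim (fun i => _) Fin.elim0, Fin.append_elim0]
    rfl
  | succ k ih =>
    simp only [balls, ih, sat_ball]
    constructor
    · intro h z
      rw [← Fin.snoc_init_self z, coe_snoc, Fin.append_snoc]
      exact h _ _
    · intro h z a
      rw [← Fin.append_snoc, ← coe_snoc]
      exact h _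

/-- `y` is a value of the unravelled term `t`. -/
def Val {n : ℕ} : Tm L n → (Fin n → M) → M → Prop
  | .var (.inl a), _, _ => a.elim
  | .var (.inr i), v, y => v i = y
  | .func f ts, v, y => ∃ z : Fin _ → I.Domain M, (∀ i, Val (ts i) v (z i)) ∧
      Sat (I.func f) (Fin.snoc (fun i => (z i : M)) y : Fin _ → M)

theorem sat_graph {n : ℕ} (t : Tm L n) : ∀ {m : ℕ} (e : Fin n → Fin m) (y : Fin m) (v : Fin m → M),
    Sat (I.graph t e y) v ↔ I.Val t (fun i => v (e i)) (v y) := by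
  induction t with
  | var x =>
    rcases x with e | i
    · exact e.elim
    · intros; rfl
  | func f ts ih =>
    intro m e y v
    rw [graph, sat_bexs, Val]
    refine exists_congr fun z => ?_
    rw [sat_inf, sat_conj, List.forall_mem_ofFn_iff, sat_substFm]
    refine and_congr (forall_congr' fun i => ?_) (iff_of_eq (congrArg _ ?_))
    · rw [ih]
      simp
    · funext i
      refine Fin.lastCases ?_ (fun i => ?_) i <;> simp

theorem sat_atom {n k : ℕ} (P : Fm L' k) (ts : Fin k → Tm L n) (v : Fin n → M) :
    Sat (I.atom P ts) v ↔
      ∃ z : Fin k → I.Domain M, (∀ i, I.Val (ts i) v (z i)) ∧ Sat P fun i => (z i : M) := by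
  rw [atom, sat_bexs]
  refine exists_congr fun z => ?_
  rw [sat_inf, sat_conj, List.forall_mem_ofFn_iff, sat_substFm]
  simp [sat_graph]

theorem sat_atom_tvar {n k : ℕ} (P : Fm L' k) (σ : Fin k → Fin n) (v : Fin n → I.Domain M) :
    Sat (I.atom P fun i => (tvar (σ i) : Tm L n)) (fun i => (v i : M)) ↔
      Sat P fun i => (v (σ i) : M) := by
  rw [sat_atom]
  constructor
  · rintro ⟨z, h, hP⟩
    obtain rfl : (fun i => v (σ i)) = z := funext fun i => Subtype.ext (h i)
    exact hP
  · exact fun h => ⟨fun i => v (σ i), fun i => rfl, h⟩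

theorem sat_onFm_all {n : ℕ} (φ : Fm L (n + 1)) (v : Fin n → I.Domain M) :
    Sat (I.onFm φ.all) (fun i => (v i : M)) ↔ ∀ a : I.Domain M,
      Sat (I.onFm φ) fun i => ((Fin.snoc v a : Fin (n + 1) → I.Domain M) i : M) := by
  simp only [coe_snoc]
  exact I.sat_ball

theorem sat_onFm_alls {n : ℕ} (φ : Fm L n) : Sat (I.onFm (n := 0) φ.alls) (default : Fin 0 → M) ↔
    ∀ v : Fin n → I.Domain M, Sat (I.onFm φ) fun i => (v i : M) := by
  induction n with
  | zero =>
    rw [Fin.forall_fin_zero_pi, Subsingleton.elim (fun i => _) (default : Fin 0 → M)]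
    rfl
  | succ n ih =>
    rw [BoundedFormula.alls, ih]
    simp only [sat_onFm_all]
    constructor
    · intro h v
      rw [← Fin.snoc_init_self v]
      exact h _ _
    · exact fun h v a => h _

theorem sat_onFm_conj {n : ℕ} {l : List (Fm L n)} {v : Fin n → M} :
    Sat (I.onFm (conj l)) v ↔ ∀ φ ∈ l, Sat (I.onFm φ) v := by
  induction l with
  | nil => exact ⟨fun _ _ h => (List.not_mem_nil h).elim, fun _ => id⟩
  | cons φ l ih =>
    rw [List.forall_mem_cons, ← ih]
    exact sat_inf

theorem sat_total {k : ℕ} (f : L.Functions k) :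
    Sat (I.total f) (default : Fin 0 → M) ↔ ∀ a : Fin k → I.Domain M, ∃ b : I.Domain M,
      Sat (I.func f) (Fin.snoc (fun i => (a i : M)) (b : M) : Fin (k + 1) → M) := by
  rw [total, sat_balls]
  refine forall_congr' fun a => I.sat_bex.trans <| exists_congr fun b => ?_
  rw [sat_substFm]
  refine iff_of_eq (congrArg _ (funext fun i => ?_))
  induction i using Fin.lastCases with
  | last =>
    have cast_last : Fin.cast (by omega : k + 1 = 0 + k + 1) (Fin.last k) = Fin.last (0 + k) := by
      ext; simp
    simp only [evalTm_tvar, cast_last, Fin.snoc_last]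
  | cast i =>
    have cast_castSucc : Fin.cast (by omega : k + 1 = 0 + k + 1) i.castSucc =
        (Fin.natAdd 0 i).castSucc := by
      ext; simp
    simp only [evalTm_tvar, cast_castSucc, Fin.snoc_castSucc, Fin.append_right]

end TranslationSemantics

/-- The `L`-structure `N` is the one defined by the translation `I` in the `L'`-structure `M`;
`proj` maps the elements of the domain to the elements of `N` they represent. -/
structure Defines (M : Type w) (N : Type w₁) [L'.Structure M] [L.Structure N] where
  proj : I.Domain M → N
  proj_surjective : Function.Surjective proj
  sat_eq : ∀ a b : I.Domain M, Sat I.eq ![(a : M), b] ↔ proj a = proj b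
  sat_rel : ∀ {k : ℕ} (R : L.Relations k) (a : Fin k → I.Domain M),
    Sat (I.rel R) (fun i => (a i : M)) ↔ Structure.RelMap R fun i => proj (a i)
  funMap_eq : ∀ {k : ℕ} (f : L.Functions k) (a : Fin k → I.Domain M) (b : I.Domain M),
    Sat (I.func f) (Fin.snoc (fun i => (a i : M)) (b : M) : Fin (k + 1) → M) →
      Structure.funMap f (fun i => proj (a i)) = proj b
  func_total : ∀ {k : ℕ} (f : L.Functions k) (a : Fin k → I.Domain M), ∃ b : I.Domain M,
    Sat (I.func f) (Fin.snoc (fun i => (a i : M)) (b : M) : Fin (k + 1) → M)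

namespace Defines

variable {I} {M : Type w} {N : Type w₁} [L'.Structure M] [L.Structure N] (D : I.Defines M N)
include D

theorem evalTm_of_val {n : ℕ} {t : Tm L n} {v : Fin n → I.Domain M} {y : I.Domain M}
    (h : I.Val t (fun i => (v i : M)) y) : evalTm t (fun i => D.proj (v i)) = D.proj y := by
  induction t generalizing y with
  | var x =>
    rcases x with e | i
    · exact e.elim
    · exact congrArg D.proj (Subtype.ext h)
  | func f ts ih =>
    obtain ⟨z, hts, hf⟩ := h
    rw [← D.funMap_eq f z y hf, evalTm_func]
    exact congrArg _ (funext fun i => ih i (hts i))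

theorem exists_val {n : ℕ} (t : Tm L n) (v : Fin n → I.Domain M) :
    ∃ y : I.Domain M, I.Val t (fun i => (v i : M)) y := by
  induction t with
  | var x =>
    rcases x with e | i
    · exact e.elim
    · exact ⟨v i, rfl⟩
  | func f ts ih =>
    choose z hts using ih
    obtain ⟨y, h⟩ := D.func_total f z
    exact ⟨y, z, hts, h⟩

theorem sat_atom_iff {n k : ℕ} {P : Fm L' k} {Q : (Fin k → N) → Prop}
    (hPQ : ∀ a : Fin k → I.Domain M, Sat P (fun i => (a i : M)) ↔ Q fun i => D.proj (a i))
    (ts : Fin k → Tm L n) (v : Fin n → I.Domain M) :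
    Sat (I.atom P ts) (fun i => (v i : M)) ↔ Q fun i => evalTm (ts i) fun i => D.proj (v i) := by
  rw [sat_atom]
  constructor
  · rintro ⟨z, hts, h⟩
    simpa only [D.evalTm_of_val (hts _)] using (hPQ z).1 h
  · intro h
    choose z hts using fun i => D.exists_val (ts i) v
    refine ⟨z, hts, (hPQ z).2 ?_⟩
    simpa only [D.evalTm_of_val (hts _)] using h

theorem forall_snoc_iff {n : ℕ} (v : Fin n → I.Domain M) {P : (Fin (n + 1) → N) → Prop} :
    (∀ y : N, P (Fin.snoc (fun i => D.proj (v i)) y : Fin (n + 1) → N)) ↔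
      ∀ a, P fun i => D.proj ((Fin.snoc v a : Fin (n + 1) → I.Domain M) i) := by
  rw [D.proj_surjective.forall]
  exact forall_congr' fun a => iff_of_eq (congrArg P (Fin.comp_snoc D.proj v a).symm)

theorem sat_onFm {n : ℕ} (φ : Fm L n) (v : Fin n → I.Domain M) :
    Sat (I.onFm φ) (fun i => (v i : M)) ↔ Sat φ fun i => D.proj (v i) := by
  induction φ with
  | falsum => rfl
  | equal t s =>
    refine D.sat_atom_iff (Q := fun a => a 0 = a 1) (fun a => ?_) ![t, s] v
    rw [← D.sat_eq]
    refine iff_of_eq (congrArg _ (funext fun i => ?_))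
    fin_cases i <;> rfl
  | rel R ts => exact D.sat_atom_iff (D.sat_rel R) ts v
  | imp φ ψ ih₁ ih₂ => exact imp_congr (ih₁ v) (ih₂ v)
  | all φ ih =>
    rw [sat_onFm_all, sat_all, D.forall_snoc_iff]
    exact forall_congr' fun a => ih _

theorem models_onFm (φ : L.Sentence) : M ⊨ I.onFm (n := 0) φ ↔ N ⊨ φ := by
  have h := D.sat_onFm φ Fin.elim0
  rwa [Sat, Sat, Subsingleton.elim (fun _ => _) (default : Fin 0 → M),
    Subsingleton.elim (fun _ => _) (default : Fin 0 → N)] at h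

end Defines

variable {I}

section DefinedStructure

variable {T : L.Theory} {S : L'.Theory} {M : Type w} [L'.Structure M] {n k : ℕ}

theorem sat_onFm_equal_tvar (v : Fin n → I.Domain M) (i j : Fin n) :
    Sat (I.onFm (.equal (tvar i) (tvar j))) (fun i => (v i : M)) ↔
      Sat I.eq ![(v i : M), v j] := by
  have tvar_comp : (fun l => (tvar (![i, j] l) : Tm L n)) = ![tvar i, tvar j] := by
    funext l; fin_cases l <;> rfl
  have val_comp : (fun l => (v (![i, j] l) : M)) = ![(v i : M), v j] := by
    funext l; fin_cases l <;> rfl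
  have h := I.sat_atom_tvar (L := L) I.eq ![i, j] v
  rwa [tvar_comp, val_comp] at h

/-- The conjunction of the equations `x_{p i} = x_{q i}`. -/
def eqs (p q : Fin k → Fin n) : Fm L n :=
  conj (List.ofFn fun i => .equal (tvar (p i)) (tvar (q i)))

theorem sat_eqs {A : Type w₁} [L.Structure A] {p q : Fin k → Fin n} {v : Fin n → A} :
    Sat (eqs p q : Fm L n) v ↔ (fun i => v (p i)) = fun i => v (q i) := by
  rw [eqs, sat_conj, List.forall_mem_ofFn_iff, funext_iff]
  rfl

theorem sat_onFm_eqs {p q : Fin k → Fin n} {v : Fin n → I.Domain M} :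
    Sat (I.onFm (eqs p q)) (fun i => (v i : M)) ↔
      ∀ i, Sat I.eq ![(v (p i) : M), v (q i)] := by
  rw [eqs, sat_onFm_conj, List.forall_mem_ofFn_iff]
  exact forall_congr' fun i => sat_onFm_equal_tvar v _ _

namespace IsInterpretation

variable [∀ n, Countable (Fm L n)] [Nonempty M] (hI : I.IsInterpretation T S)
  (hM : ∀ ψ ∈ S, M ⊨ ψ)
include hI hM

theorem sat_onFm_of_valid {φ : Fm L n}
    (h : ∀ (A : Type) [L.Structure A] [Nonempty A] (v : Fin n → A), Sat φ v)
    (v : Fin n → I.Domain M) : Sat (I.onFm φ) fun i => (v i : M) := by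
  refine (I.sat_onFm_alls φ).1 ?_ v
  refine Proves.sound hM (hI.2 _ (proves_of_forall_models fun A _ _ _ => ?_))
  exact BoundedFormula.realize_alls.2 fun v => h A v

theorem eq_refl (a : I.Domain M) : Sat I.eq ![(a : M), a] :=
  (sat_onFm_equal_tvar ![a] 0 0).1 <|
    hI.sat_onFm_of_valid hM (n := 1) (φ := .equal (tvar 0) (tvar 0)) (fun _ _ _ _ => rfl) ![a]

theorem eq_symm {a b : I.Domain M} (h : Sat I.eq ![(a : M), b]) : Sat I.eq ![(b : M), a] := by
  have symm_valid := hI.sat_onFm_of_valid hM (n := 2)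
    (φ := .imp (.equal (tvar 0) (tvar 1)) (.equal (tvar 1) (tvar 0)))
    (fun _ _ _ _ h => Eq.symm h) ![a, b]
  exact (sat_onFm_equal_tvar ![a, b] 1 0).1 (symm_valid ((sat_onFm_equal_tvar ![a, b] 0 1).2 h))

theorem eq_trans {a b c : I.Domain M} (hab : Sat I.eq ![(a : M), b])
    (hbc : Sat I.eq ![(b : M), c]) : Sat I.eq ![(a : M), c] := by
  have trans_valid := hI.sat_onFm_of_valid hM (n := 3)
    (φ := .imp (.equal (tvar 0) (tvar 1))
      (.imp (.equal (tvar 1) (tvar 2)) (.equal (tvar 0) (tvar 2))))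
    (fun _ _ _ _ h h' => Eq.trans h h') ![a, b, c]
  exact (sat_onFm_equal_tvar ![a, b, c] 0 2).1 <| trans_valid
    ((sat_onFm_equal_tvar ![a, b, c] 0 1).2 hab) ((sat_onFm_equal_tvar ![a, b, c] 1 2).2 hbc)

theorem rel_congr (R : L.Relations k) {a b : Fin k → I.Domain M}
    (hab : ∀ i, Sat I.eq ![(a i : M), b i]) (hR : Sat (I.rel R) fun i => (a i : M)) :
    Sat (I.rel R) fun i => (b i : M) := by
  have congr_valid := hI.sat_onFm_of_valid hM (φ := .imp (eqs (Fin.castAdd k) (Fin.natAdd k))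
      (.imp (.rel R fun i => tvar (Fin.castAdd k i)) (.rel R fun i => tvar (Fin.natAdd k i))))
    (fun _ _ _ _ h hR => Eq.mp (congrArg (Structure.RelMap R) (sat_eqs.1 h)) hR)
    (Fin.append a b)
  have h := (I.sat_atom_tvar (L := L) (I.rel R) (Fin.natAdd k) (Fin.append a b)).1 <|
    congr_valid (sat_onFm_eqs.2 (by simpa only [Fin.append_left, Fin.append_right] using hab))
      ((I.sat_atom_tvar (I.rel R) (Fin.castAdd k) _).2 (by simpa only [Fin.append_left] using hR))
  simpa only [Fin.append_right] using h

theorem sat_onFm_equal_func_tvar (f : L.Functions k) (v : Fin n → I.Domain M) (p : Fin k → Fin n)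
    (j : Fin n) (h : Sat (I.func f)
      (Fin.snoc (fun i => (v (p i) : M)) (v j : M) : Fin (k + 1) → M)) :
    Sat (I.onFm (.equal (.func f fun i => tvar (p i)) (tvar j))) fun i => (v i : M) := by
  refine (I.sat_atom _ _ _).2 ⟨![v j, v j], fun i => ?_, ?_⟩
  · fin_cases i
    · exact ⟨fun i => v (p i), fun i => rfl, h⟩
    · rfl
  · convert hI.eq_refl hM (v j) using 2 with i
    fin_cases i <;> rfl

theorem func_congr (f : L.Functions k) {a b : Fin k → I.Domain M} {x y : I.Domain M}
    (hab : ∀ i, Sat I.eq ![(a i : M), b i])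
    (hx : Sat (I.func f) (Fin.snoc (fun i => (a i : M)) (x : M) : Fin (k + 1) → M))
    (hy : Sat (I.func f) (Fin.snoc (fun i => (b i : M)) (y : M) : Fin (k + 1) → M)) :
    Sat I.eq ![(x : M), y] := by
  let p (i : Fin k) : Fin (k + k + 2) := Fin.castAdd 2 (Fin.castAdd k i)
  let q (i : Fin k) : Fin (k + k + 2) := Fin.castAdd 2 (Fin.natAdd k i)
  let r (i : Fin 2) : Fin (k + k + 2) := Fin.natAdd (k + k) i
  let v : Fin (k + k + 2) → I.Domain M := Fin.append (Fin.append a b) ![x, y]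
  have hp (i) : v (p i) = a i := by simp only [v, p, Fin.append_left]
  have hq (i) : v (q i) = b i := by simp only [v, q, Fin.append_left, Fin.append_right]
  have hx' : v (r 0) = x := Fin.append_right _ ![x, y] 0
  have hy' : v (r 1) = y := Fin.append_right _ ![x, y] 1
  have congr_valid := hI.sat_onFm_of_valid hM
    (φ := .imp (eqs p q) (.imp (.equal (.func f fun i => tvar (p i)) (tvar (r 0)))
      (.imp (.equal (.func f fun i => tvar (q i)) (tvar (r 1)))
        (.equal (tvar (r 0)) (tvar (r 1))))))
    (fun _ _ _ _ hpq hx hy =>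
      hx.symm.trans ((congrArg (Structure.funMap f) (sat_eqs.1 hpq)).trans hy)) v
  have h := (sat_onFm_equal_tvar v (r 0) (r 1)).1 <| congr_valid
    (sat_onFm_eqs.2 (by simpa only [hp, hq] using hab))
    (hI.sat_onFm_equal_func_tvar hM f v p (r 0) (by simpa only [hp, hx'] using hx))
    (hI.sat_onFm_equal_func_tvar hM f v q (r 1) (by simpa only [hq, hy'] using hy))
  simpa only [hx', hy'] using h

theorem nonempty_domain : Nonempty (I.Domain M) := by
  by_contra hempty
  have exists_valid := hI.sat_onFm_of_valid hM (n := 0) (φ := .imp (.all .falsum) .falsum)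
    (fun _ _ hA _ h => h hA.some) Fin.elim0
  exact exists_valid ((I.sat_onFm_all _ _).2 fun a => hempty ⟨a⟩)

theorem exists_defines :
    ∃ (N : Type w) (_ : L.Structure N) (_ : Nonempty N), Nonempty (I.Defines M N) := by
  let s : Setoid (I.Domain M) :=
    { r a b := Sat I.eq ![(a : M), b]
      iseqv := ⟨hI.eq_refl hM, hI.eq_symm hM, hI.eq_trans hM⟩ }
  choose F hF using fun {k} (f : L.Functions k) => (I.sat_total f).1 (Proves.sound hM (hI.1 k f))
  let inst : L.Structure (Quotient s) :=
    { funMap f x := Quotient.mk s (F f fun i => (x i).out)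
      RelMap R x := Sat (I.rel R) fun i => ((x i).out : M) }
  have eq_out (a : I.Domain M) : Sat I.eq ![((Quotient.mk s a).out : M), a] :=
    Quotient.exact (s := s) (Quotient.out_eq _)
  refine ⟨Quotient s, inst, (hI.nonempty_domain hM).map (Quotient.mk s), ⟨?_⟩⟩
  exact
    { proj := Quotient.mk s
      proj_surjective := Quotient.mk_surjective
      sat_eq _ _ := (Quotient.eq (r := s)).symm
      sat_rel R _ := ⟨hI.rel_congr hM R fun _ => hI.eq_symm hM (eq_out _),
        hI.rel_congr hM R fun _ => eq_out _⟩
      funMap_eq f _ _ h := Quotient.sound (hI.func_congr hM f (fun _ => eq_out _) (hF f _) h)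
      func_total f a := ⟨F f a, hF f a⟩ }

end IsInterpretation

end DefinedStructure

section Identity

variable (L) in
/-- The identity translation. -/
def identity : Translation L L where
  dom := ⊤
  eq := .equal (tvar 0) (tvar 1)
  rel R := .rel R tvar
  func f := .equal (.func f fun i => tvar i.castSucc) (tvar (Fin.last _))

theorem sat_identity_func {M : Type w} [L.Structure M] {k : ℕ} (f : L.Functions k) (a : Fin k → M)
    (b : M) : Sat ((identity L).func f) (Fin.snoc a b : Fin (k + 1) → M) ↔
      Structure.funMap f a = b := by
  rw [identity, sat_equal, evalTm_func]
  simp only [evalTm_tvar, Fin.snoc_castSucc, Fin.snoc_last]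

/-- The identity translation defines every structure in itself. -/
def identityDefines (M : Type w) [L.Structure M] : (identity L).Defines M M where
  proj := Subtype.val
  proj_surjective y := ⟨⟨y, id⟩, rfl⟩
  sat_eq _ _ := Iff.rfl
  sat_rel _ _ := Iff.rfl
  funMap_eq f _ _ := (sat_identity_func f _ _).1
  func_total f a := ⟨⟨Structure.funMap f fun i => a i, id⟩, (sat_identity_func f _ _).2 rfl⟩

theorem identity_isInterpretation [∀ n, Countable (Fm L n)] {T S : L.Theory} (h : Extends S T) :
    (identity L).IsInterpretation T S := by
  refine ⟨fun k f => proves_of_forall_models fun M _ _ _ => ?_, fun φ hφ =>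
    proves_of_forall_models fun M _ _ hM => ?_⟩
  · exact ((identity L).sat_total f).2 ((identityDefines M).func_total f)
  · exact ((identityDefines M).models_onFm φ).2 (Proves.sound hM (h φ hφ))

end Identity

end Translation

/-! ### Unnested formulas -/

namespace Translation

variable {L L' : FirstOrder.Language.{u, v}}

section Unnested

variable (I : Translation L L')

/-- `x_i =_I x_j`. -/
def eqAt {n : ℕ} (i j : Fin n) : Fm L' n := substFm (fun l => tvar (![i, j] l)) I.eq

/-- `F_I(x_{σ 0}, …, x_{σ (k-1)}, x_j)`. -/
def funcAt {n k : ℕ} (f : L.Functions k) (σ : Fin k → Fin n) (j : Fin n) : Fm L' n :=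
  substFm (fun l => tvar ((Fin.snoc σ j : Fin (k + 1) → Fin n) l)) (I.func f)

/-- The atomic subformulas of `φ` contain at most one function symbol, and `ψ` is obtained from `φ`
by translating them and relativizing the quantifiers. In contrast to `onFm` nothing has to be
unravelled, so the code of `ψ` is easily computed from that of `φ`. -/
inductive UnnestedTranslation : ∀ {n : ℕ}, Fm L n → Fm L' n → Prop
  | falsum (n : ℕ) : UnnestedTranslation (.falsum : Fm L n) .falsum
  | equal {n : ℕ} (i j : Fin n) : UnnestedTranslation (.equal (tvar i) (tvar j)) (I.eqAt i j)
  | func {n k : ℕ} (f : L.Functions k) (σ : Fin k → Fin n) (j : Fin n) :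
      UnnestedTranslation (.equal (.func f fun l => tvar (σ l)) (tvar j))
        (.all ((I.domAt (Fin.last n)).imp
          ((I.funcAt f (fun l => (σ l).castSucc) (Fin.last n)).imp
            (I.eqAt (Fin.last n) j.castSucc))))
  | rel {n k : ℕ} (R : L.Relations k) (σ : Fin k → Fin n) :
      UnnestedTranslation (.rel R fun l => tvar (σ l)) (substFm (fun l => tvar (σ l)) (I.rel R))
  | imp {n : ℕ} {φ₁ φ₂ : Fm L n} {ψ₁ ψ₂ : Fm L' n} :
      UnnestedTranslation φ₁ ψ₁ → UnnestedTranslation φ₂ ψ₂ →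
        UnnestedTranslation (φ₁.imp φ₂) (ψ₁.imp ψ₂)
  | all {n : ℕ} {φ : Fm L (n + 1)} {ψ : Fm L' (n + 1)} : UnnestedTranslation φ ψ →
      UnnestedTranslation φ.all (.all ((I.domAt (Fin.last n)).imp ψ))

/-- `φ` is unnested, that is, it is in the scope of `UnnestedTranslation`. -/
def IsUnnested {n : ℕ} (φ : Fm L n) : Prop := ∃ ψ, I.UnnestedTranslation φ ψ

variable {I}

section Semantics

variable {M : Type w} [L'.Structure M]

theorem sat_eqAt {n : ℕ} {i j : Fin n} {v : Fin n → M} :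
    Sat (I.eqAt i j) v ↔ Sat I.eq ![v i, v j] := by
  rw [eqAt, sat_substFm]
  refine iff_of_eq (congrArg _ (funext fun l => ?_))
  fin_cases l <;> rfl

theorem sat_funcAt {n k : ℕ} {f : L.Functions k} {σ : Fin k → Fin n} {j : Fin n} {v : Fin n → M} :
    Sat (I.funcAt f σ j) v ↔
      Sat (I.func f) (Fin.snoc (fun l => v (σ l)) (v j) : Fin (k + 1) → M) := by
  rw [funcAt, sat_substFm]
  exact iff_of_eq (congrArg _ (Fin.comp_snoc v σ j))

end Semantics

namespace Defines

variable {M : Type w} {N : Type w₁} [L'.Structure M] [L.Structure N] (D : I.Defines M N)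
include D

theorem sat_unnestedTranslation {n : ℕ} {φ : Fm L n} {ψ : Fm L' n}
    (h : I.UnnestedTranslation φ ψ) (v : Fin n → I.Domain M) :
    Sat ψ (fun i => (v i : M)) ↔ Sat φ fun i => D.proj (v i) := by
  induction h with
  | falsum => rfl
  | equal i j => exact sat_eqAt.trans (D.sat_eq _ _)
  | func f σ j =>
    simp only [sat_ball, sat_imp, sat_funcAt, sat_eqAt, Fin.snoc_castSucc, Fin.snoc_last, D.sat_eq,
      sat_equal, evalTm_func, evalTm_tvar]
    constructor
    · intro h
      obtain ⟨b, hb⟩ := D.func_total f fun l => v (σ l)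
      exact (D.funMap_eq f _ b hb).trans (h b hb)
    · exact fun h b hb => (D.funMap_eq f _ b hb).symm.trans h
  | rel R σ =>
    rw [sat_substFm]
    exact D.sat_rel R fun l => v (σ l)
  | imp _ _ ih₁ ih₂ => exact imp_congr (ih₁ v) (ih₂ v)
  | all _ ih =>
    rw [sat_ball, sat_all, D.forall_snoc_iff]
    simp only [← coe_snoc, ih]

theorem models_unnestedTranslation {φ : L.Sentence} {ψ : L'.Sentence}
    (h : I.UnnestedTranslation (n := 0) φ ψ) : M ⊨ ψ ↔ N ⊨ φ := by
  have h := D.sat_unnestedTranslation h Fin.elim0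
  rwa [Sat, Sat, Subsingleton.elim (fun _ => _) (default : Fin 0 → M),
    Subsingleton.elim (fun _ => _) (default : Fin 0 → N)] at h

end Defines

namespace IsUnnested

protected theorem falsum (n : ℕ) : I.IsUnnested (.falsum : Fm L n) := ⟨_, .falsum n⟩

protected theorem imp {n : ℕ} {φ ψ : Fm L n} :
    I.IsUnnested φ → I.IsUnnested ψ → I.IsUnnested (φ.imp ψ)
  | ⟨_, hφ⟩, ⟨_, hψ⟩ => ⟨_, .imp hφ hψ⟩

protected theorem all {n : ℕ} {φ : Fm L (n + 1)} : I.IsUnnested φ → I.IsUnnested φ.all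
  | ⟨_, hφ⟩ => ⟨_, .all hφ⟩

protected theorem not {n : ℕ} {φ : Fm L n} (hφ : I.IsUnnested φ) : I.IsUnnested φ.not :=
  hφ.imp (.falsum n)

protected theorem top (n : ℕ) : I.IsUnnested (⊤ : Fm L n) := .not (.falsum n)

protected theorem inf {n : ℕ} {φ ψ : Fm L n} (hφ : I.IsUnnested φ) (hψ : I.IsUnnested ψ) :
    I.IsUnnested (φ ⊓ ψ) :=
  .not (hφ.imp hψ.not)

theorem bexs {m : ℕ} (k : ℕ) {φ : Fm L (m + k)} (hφ : I.IsUnnested φ) :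
    I.IsUnnested ((identity L).bexs k φ) := by
  induction k with
  | zero => exact hφ
  | succ k ih => exact ih (.not (.all (.not ((IsUnnested.top _).inf hφ))))

theorem conj {n : ℕ} {l : List (Fm L n)} (h : ∀ φ ∈ l, I.IsUnnested φ) :
    I.IsUnnested (conj l) := by
  induction l with
  | nil => exact .top n
  | cons φ l ih =>
    rw [List.forall_mem_cons] at h
    exact h.1.inf (ih h.2)

theorem graph {n : ℕ} (t : Tm L n) : ∀ {m : ℕ} (e : Fin n → Fin m) (y : Fin m),
    I.IsUnnested ((identity L).graph t e y) := by
  induction t with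
  | var x =>
    rcases x with e | i
    · exact e.elim
    · exact fun e y => ⟨_, .equal _ _⟩
  | func f ts ih =>
    intro m e y
    refine bexs _ (.inf (conj ?_) ?_)
    · rw [List.forall_mem_ofFn_iff]
      exact fun i => ih i _ _
    · simp only [identity, substFm, substTm_func, substTm_tvar, Fin.snoc_castSucc, Fin.snoc_last]
      exact ⟨_, .func f _ _⟩

theorem atom {n k : ℕ} {P : Fm L k} (ts : Fin k → Tm L n)
    (h : ∀ (m : ℕ) (σ : Fin k → Fin m), I.IsUnnested (substFm (fun i => tvar (σ i)) P)) :
    I.IsUnnested ((identity L).atom P ts) := by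
  refine bexs k (.inf (conj ?_) (h _ _))
  rw [List.forall_mem_ofFn_iff]
  exact fun i => graph _ _ _

theorem onFm_identity {n : ℕ} (φ : Fm L n) : I.IsUnnested ((identity L).onFm φ) := by
  induction φ with
  | falsum => exact .falsum _
  | equal t s => exact atom _ fun m σ => ⟨_, .equal _ _⟩
  | rel R ts => exact atom _ fun m σ => ⟨_, .rel R σ⟩
  | imp φ ψ ih₁ ih₂ => exact ih₁.imp ih₂
  | all φ ih => exact .all (.imp (.top _) ih)

end IsUnnested

end Unnested

end Translation

/-! ### Recursion on Gödel numbers -/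

section Codes

open Encodable

/-- The list with code `c`; every number codes a list. -/
def listOf (c : ℕ) : List ℕ := (decode (α := List ℕ) c).getD []

@[simp] theorem listOf_encode (l : List ℕ) : listOf (encode l) = l := by
  simp [listOf]

@[simp] theorem encode_listOf (c : ℕ) : encode (listOf c) = c := by
  rw [listOf, Denumerable.decode_eq_ofNat]
  exact Denumerable.encode_ofNat c

theorem lt_encode_of_mem {l : List ℕ} {x : ℕ} (h : x ∈ l) : x < encode l := by
  induction l with
  | nil => simp at h
  | cons a l ih =>
    rw [Encodable.encode_list_cons, encode_nat, Nat.lt_succ_iff]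
    rcases List.mem_cons.1 h with rfl | h
    · exact Nat.left_le_pair _ _
    · exact (ih h).le.trans (Nat.right_le_pair _ _)

theorem lt_of_mem_listOf {c x : ℕ} (h : x ∈ listOf c) : x < c := by
  simpa using lt_encode_of_mem h

/-- Operations along which values of term codes (in `τ`) and of formula codes (in `σ`) are computed
by recursion. Functions of terms and formulas which are to be computable on Gödel numbers are given
by such an algebra. -/
structure CodeAlgebra (τ σ : Type*) where
  var : ℕ → τ
  func : ℕ → List τ → τ
  falsum : σ
  equal : τ → τ → σ
  rel : ℕ → List τ → σ
  imp : σ → σ → σ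
  all : σ → σ

namespace CodeAlgebra

variable {τ σ : Type*} (A : CodeAlgebra τ σ)

/-- The value of the term with code `c`. Every number is treated as a term code. -/
def term (c : ℕ) : τ :=
  if c % 2 = 0 then A.var (c / 2)
  else A.func (c / 2).unpair.1 ((listOf (c / 2).unpair.2).attach.map fun x => term x.1)
termination_by c
decreasing_by
  have h₁ := lt_of_mem_listOf x.2
  have h₂ := Nat.unpair_right_le (c / 2)
  omega

theorem term_var (i : ℕ) : A.term (2 * i) = A.var i := by
  rw [term, if_pos (by omega)]
  congr 1
  omega

theorem term_func (a b : ℕ) :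
    A.term (2 * Nat.pair a b + 1) = A.func a ((listOf b).map A.term) := by
  have h : (2 * Nat.pair a b + 1) / 2 = Nat.pair a b := by omega
  rw [term, if_neg (by omega), h, Nat.unpair_pair, List.attach_map_val (f := A.term)]

/-- The value of the formula with code `c`. Every number is treated as a formula code. -/
def form : ℕ → σ
  | 0 => A.falsum
  | c + 1 =>
    if c % 4 = 0 then A.equal (A.term (c / 4).unpair.1) (A.term (c / 4).unpair.2)
    else if c % 4 = 1 then A.rel (c / 4).unpair.1 ((listOf (c / 4).unpair.2).map A.term)
    else if c % 4 = 2 then A.imp (form (c / 4).unpair.1) (form (c / 4).unpair.2)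
    else A.all (form (c / 4))
termination_by c => c
decreasing_by
  all_goals
    have h₁ := Nat.unpair_left_le (c / 4)
    have h₂ := Nat.unpair_right_le (c / 4)
    omega

theorem form_falsum : A.form 0 = A.falsum := by rw [form]

theorem form_equal (a b : ℕ) :
    A.form (4 * Nat.pair a b + 1) = A.equal (A.term a) (A.term b) := by
  have h : 4 * Nat.pair a b / 4 = Nat.pair a b := by omega
  rw [form, if_pos (by omega), h, Nat.unpair_pair]

theorem form_rel (a b : ℕ) :
    A.form (4 * Nat.pair a b + 2) = A.rel a ((listOf b).map A.term) := by
  have h : (4 * Nat.pair a b + 1) / 4 = Nat.pair a b := by omega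
  rw [form, if_neg (by omega), if_pos (by omega), h, Nat.unpair_pair]

theorem form_imp (a b : ℕ) :
    A.form (4 * Nat.pair a b + 3) = A.imp (A.form a) (A.form b) := by
  have h : (4 * Nat.pair a b + 2) / 4 = Nat.pair a b := by omega
  rw [form, if_neg (by omega), if_neg (by omega), if_pos (by omega), h, Nat.unpair_pair]

theorem form_all (a : ℕ) : A.form (4 * a + 4) = A.all (A.form a) := by
  have h : (4 * a + 3) / 4 = a := by omega
  rw [form, if_neg (by omega), if_neg (by omega), if_neg (by omega), h]

theorem term_codeTm_func {L : FirstOrder.Language.{u, v}} [Arithmetization L] {n k : ℕ}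
    (f : L.Functions k) (ts : Fin k → Tm L n) :
    A.term (codeTm (.func f ts)) =
      A.func (Arithmetization.funcCode f) (List.ofFn fun i => A.term (codeTm (ts i))) := by
  rw [codeTm, term_func, listOf_encode, List.map_ofFn]
  rfl

theorem form_code_rel {L : FirstOrder.Language.{u, v}} [Arithmetization L] {n k : ℕ}
    (R : L.Relations k) (ts : Fin k → Tm L n) :
    A.form (code (.rel R ts)) =
      A.rel (Arithmetization.relCode R) (List.ofFn fun i => A.term (codeTm (ts i))) := by
  rw [code, form_rel, listOf_encode, List.map_ofFn]
  rfl

/-- The value of the term code `c`, given the list `H` of the values of all smaller codes. -/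
def termStep [Inhabited τ] [Inhabited σ] (H : List (τ × σ)) (c : ℕ) : τ :=
  if c % 2 = 0 then A.var (c / 2)
  else A.func (c / 2).unpair.1 ((listOf (c / 2).unpair.2).map fun x => (H.getI x).1)

/-- The value of the formula code `c`, given the list `H` of the values of all smaller codes. -/
def formStep [Inhabited τ] [Inhabited σ] (H : List (τ × σ)) : ℕ → σ
  | 0 => A.falsum
  | c + 1 =>
    if c % 4 = 0 then A.equal (H.getI (c / 4).unpair.1).1 (H.getI (c / 4).unpair.2).1
    else if c % 4 = 1 then
      A.rel (c / 4).unpair.1 ((listOf (c / 4).unpair.2).map fun x => (H.getI x).1)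
    else if c % 4 = 2 then A.imp (H.getI (c / 4).unpair.1).2 (H.getI (c / 4).unpair.2).2
    else A.all (H.getI (c / 4)).2

/-- The values of all codes smaller than `c`. -/
def history (c : ℕ) : List (τ × σ) := (List.range c).map fun x => (A.term x, A.form x)

section History

variable [Inhabited τ] [Inhabited σ]

theorem getI_history {c x : ℕ} (hx : x < c) : (A.history c).getI x = (A.term x, A.form x) := by
  rw [List.getI_eq_getElem _ (by simpa [history] using hx)]
  simp [history]

theorem map_getI_history {b c : ℕ} (hb : b < c) :
    ((listOf b).map fun x => ((A.history c).getI x).1) = (listOf b).map A.term :=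
  List.map_congr_left fun x hx => by rw [A.getI_history ((lt_of_mem_listOf hx).trans hb)]

theorem termStep_history (c : ℕ) : A.termStep (A.history c) c = A.term c := by
  rw [term, termStep]
  split_ifs with hc
  · rfl
  · have := Nat.unpair_right_le (c / 2)
    rw [A.map_getI_history (by omega), List.attach_map_val (f := A.term)]

theorem formStep_history (c : ℕ) : A.formStep (A.history c) c = A.form c := by
  cases c with
  | zero => rw [form, formStep]
  | succ c =>
    have := Nat.unpair_left_le (c / 4)
    have := Nat.unpair_right_le (c / 4)
    rw [form, formStep, A.map_getI_history (by omega), A.getI_history (by omega),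
      A.getI_history (by omega), A.getI_history (by omega)]

end History

end CodeAlgebra

theorem computable_mod (k : ℕ) : Computable fun c : ℕ => c % k :=
  (Primrec.nat_mod.comp Primrec.id (Primrec.const k)).to_comp

theorem computable_div (k : ℕ) : Computable fun c : ℕ => c / k :=
  (Primrec.nat_div.comp Primrec.id (Primrec.const k)).to_comp

theorem computable_beq {α : Type*} [Primcodable α] {f g : α → ℕ} (hf : Computable f)
    (hg : Computable g) : Computable fun a => decide (f a = g a) :=
  (PrimrecRel.decide Primrec.eq).to_comp.comp hf hg

theorem computable_ite {α σ : Type*} [Primcodable α] [Primcodable σ] {p : α → Prop}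
    [DecidablePred p] {f g : α → σ} (hp : Computable fun a => decide (p a)) (hf : Computable f)
    (hg : Computable g) : Computable fun a => if p a then f a else g a :=
  (Computable.cond hp hf hg).of_eq fun a => by by_cases h : p a <;> simp [h]

theorem computable_map_getI {β γ : Type*} [Primcodable β] [Primcodable γ] [Inhabited β]
    [Inhabited γ] :
    Computable₂ fun (H : List (β × γ)) (c : ℕ) => (listOf c).map fun x => (H.getI x).1 := by
  have hlistOf : Primrec listOf := Primrec.option_getD.comp Primrec.decode (Primrec.const [])
  exact (Primrec.list_map (hlistOf.comp Primrec.snd) (Primrec.fst.comp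
    (Primrec.list_getI.comp (Primrec.fst.comp Primrec.fst) Primrec.snd)).to₂).to_comp

/-- A family of algebras with uniformly computable operations. -/
structure ComputableAlgebra {α τ σ : Type*} [Primcodable α] [Primcodable τ] [Primcodable σ]
    (A : α → CodeAlgebra τ σ) : Prop where
  var : Computable fun p : α × ℕ => (A p.1).var p.2
  func : Computable fun p : α × ℕ × List τ => (A p.1).func p.2.1 p.2.2
  falsum : Computable fun a => (A a).falsum
  equal : Computable fun p : α × τ × τ => (A p.1).equal p.2.1 p.2.2
  rel : Computable fun p : α × ℕ × List τ => (A p.1).rel p.2.1 p.2.2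
  imp : Computable fun p : α × σ × σ => (A p.1).imp p.2.1 p.2.2
  all : Computable fun p : α × σ => (A p.1).all p.2

namespace ComputableAlgebra

variable {α τ σ : Type*} [Primcodable α] [Primcodable τ] [Primcodable σ]
  [Inhabited τ] [Inhabited σ] {A : α → CodeAlgebra τ σ}

theorem computable_termStep (hA : ComputableAlgebra A) :
    Computable fun p : α × List (τ × σ) × ℕ => (A p.1).termStep p.2.1 p.2.2 := by
  have hH : Computable fun p : α × List (τ × σ) × ℕ => p.2.1 := Computable.fst.comp .snd
  have hc : Computable fun p : α × List (τ × σ) × ℕ => p.2.2 := Computable.snd.comp .snd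
  have hdiv := (computable_div 2).comp hc
  have hunpair := Computable.unpair.comp hdiv
  refine computable_ite (computable_beq ((computable_mod 2).comp hc) (.const 0)) ?_ ?_
  · exact hA.var.comp (.pair .fst hdiv)
  · exact hA.func.comp (.pair .fst (.pair (Computable.fst.comp hunpair)
      (computable_map_getI.comp hH (Computable.snd.comp hunpair))))

theorem computable_formStep (hA : ComputableAlgebra A) :
    Computable fun p : α × List (τ × σ) × ℕ => (A p.1).formStep p.2.1 p.2.2 := by
  have hH : Computable fun p : (α × List (τ × σ) × ℕ) × ℕ => p.1.2.1 :=
    Computable.fst.comp (Computable.snd.comp .fst)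
  have ha : Computable fun p : (α × List (τ × σ) × ℕ) × ℕ => p.1.1 := Computable.fst.comp .fst
  have hmod := (computable_mod 4).comp (Computable.snd (α := α × List (τ × σ) × ℕ))
  have hdiv := (computable_div 4).comp (Computable.snd (α := α × List (τ × σ) × ℕ))
  have hleft := Computable.fst.comp (Computable.unpair.comp hdiv)
  have hright := Computable.snd.comp (Computable.unpair.comp hdiv)
  have hterm : Computable₂ fun (H : List (τ × σ)) x => (H.getI x).1 :=
    (Primrec.fst.comp Primrec.list_getI).to_comp
  have hform : Computable₂ fun (H : List (τ × σ)) x => (H.getI x).2 :=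
    (Primrec.snd.comp Primrec.list_getI).to_comp
  refine (Computable.nat_casesOn (Computable.snd.comp .snd) (hA.falsum.comp .fst)
    (computable_ite (computable_beq hmod (.const 0))
      (hA.equal.comp (.pair ha (.pair (hterm.comp hH hleft) (hterm.comp hH hright))))
    (computable_ite (computable_beq hmod (.const 1))
      (hA.rel.comp (.pair ha (.pair hleft (computable_map_getI.comp hH hright))))
    (computable_ite (computable_beq hmod (.const 2))
      (hA.imp.comp (.pair ha (.pair (hform.comp hH hleft) (hform.comp hH hright))))
      (hA.all.comp (.pair ha (hform.comp hH hdiv)))))).to₂).of_eq ?_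
  rintro ⟨a, H, _ | c⟩ <;> rfl

theorem computable_term_form (hA : ComputableAlgebra A) :
    Computable₂ fun a c => ((A a).term c, (A a).form c) := by
  have hstep : Computable fun p : α × List (τ × σ) => (p.1, p.2, p.2.length) :=
    .pair .fst (.pair .snd (Computable.list_length.comp .snd))
  refine Computable.nat_strong_rec _ (g := fun a H =>
    some ((A a).termStep H H.length, (A a).formStep H H.length)) (Computable.option_some.comp
      (.pair (hA.computable_termStep.comp hstep) (hA.computable_formStep.comp hstep))) ?_
  intro a c
  change some ((A a).termStep ((A a).history c) _, (A a).formStep ((A a).history c) _) = _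
  rw [List.length_map, List.length_range, CodeAlgebra.termStep_history,
    CodeAlgebra.formStep_history]

theorem computable_term (hA : ComputableAlgebra A) : Computable₂ fun a c => (A a).term c :=
  Computable.fst.comp hA.computable_term_form

theorem computable_form (hA : ComputableAlgebra A) : Computable₂ fun a c => (A a).form c :=
  Computable.snd.comp hA.computable_term_form

end ComputableAlgebra

end Codes

/-! ### Syntactic operations on Gödel numbers -/

section FormulaCodes

open Encodable

/-- The code of `φ → ψ`, where `a` and `b` are the codes of `φ` and `ψ`. -/
def impCode (a b : ℕ) : ℕ := 4 * Nat.pair a b + 3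

/-- The code of `∀ x, φ`, where `a` is the code of `φ`. -/
def allCode (a : ℕ) : ℕ := 4 * a + 4

/-- The code of `t = s`, where `a` and `b` are the codes of `t` and `s`. -/
def equalCode (a b : ℕ) : ℕ := 4 * Nat.pair a b + 1

/-- The code of an atomic formula, from the code `a` of its relation symbol and the codes `l` of the
arguments. -/
def relAppCode (a : ℕ) (l : List ℕ) : ℕ := 4 * Nat.pair a (encode l) + 2

/-- The code of a compound term, from the code `a` of its head symbol and the codes `l` of the
arguments. -/
def funcAppCode (a : ℕ) (l : List ℕ) : ℕ := 2 * Nat.pair a (encode l) + 1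

theorem primrec_affine_pair (k r : ℕ) : Primrec₂ fun a b : ℕ => k * Nat.pair a b + r :=
  Primrec.nat_add.comp (Primrec.nat_mul.comp (Primrec.const k) Primrec₂.natPair) (Primrec.const r)

theorem computable_impCode : Computable₂ impCode := (primrec_affine_pair 4 3).to_comp

theorem computable_equalCode : Computable₂ equalCode := (primrec_affine_pair 4 1).to_comp

theorem computable_allCode : Computable allCode :=
  (Primrec.nat_add.comp (Primrec.nat_mul.comp (Primrec.const 4) Primrec.id)
    (Primrec.const 4)).to_comp

theorem computable_relAppCode : Computable₂ relAppCode :=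
  ((primrec_affine_pair 4 2).comp Primrec.fst (Primrec.encode.comp Primrec.snd)).to_comp

theorem computable_funcAppCode : Computable₂ funcAppCode :=
  ((primrec_affine_pair 2 1).comp Primrec.fst (Primrec.encode.comp Primrec.snd)).to_comp

variable {L : FirstOrder.Language.{u, v}} [Arithmetization L]

theorem code_imp {n : ℕ} (φ ψ : Fm L n) : code (φ.imp ψ) = impCode (code φ) (code ψ) := rfl

theorem code_all {n : ℕ} (φ : Fm L (n + 1)) : code φ.all = allCode (code φ) := rfl

theorem code_equal {n : ℕ} (t s : Tm L n) :
    code (.equal t s : Fm L n) = equalCode (codeTm t) (codeTm s) := rfl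

theorem codeTm_tvar {n : ℕ} (i : Fin n) : codeTm (tvar i : Tm L n) = 2 * (i : ℕ) := rfl

/-- Substitution of the term with code `V i` for the variable `x_i`. Bound variables are not treated
specially: since `x_n` is the variable bound in the context of length `n`, the map `V` has to
renumber them itself. -/
def substAlgebra (V : ℕ → ℕ) : CodeAlgebra ℕ ℕ where
  var := V
  func := funcAppCode
  falsum := 0
  equal := equalCode
  rel := relAppCode
  imp := impCode
  all := allCode

theorem computable_substAlgebra {α : Type*} [Primcodable α] {V : α → ℕ → ℕ}
    (hV : Computable₂ V) : ComputableAlgebra fun a => substAlgebra (V a) where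
  var := hV
  func := computable_funcAppCode.comp (Computable.fst.comp .snd) (Computable.snd.comp .snd)
  falsum := .const 0
  equal := computable_equalCode.comp (Computable.fst.comp .snd) (Computable.snd.comp .snd)
  rel := computable_relAppCode.comp (Computable.fst.comp .snd) (Computable.snd.comp .snd)
  imp := computable_impCode.comp (Computable.fst.comp .snd) (Computable.snd.comp .snd)
  all := computable_allCode.comp .snd

theorem substAlgebra_term {V : ℕ → ℕ} {m n : ℕ} {σ : Fin m → Tm L n}
    (hσ : ∀ i, codeTm (σ i) = V i) (t : Tm L m) :
    (substAlgebra V).term (codeTm t) = codeTm (substTm σ t) := by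
  induction t with
  | var x =>
    rcases x with e | i
    · exact e.elim
    · exact ((substAlgebra V).term_var i).trans (hσ i).symm
  | func f ts ih =>
    rw [CodeAlgebra.term_codeTm_func, substTm_func, codeTm]
    simp only [ih]
    rfl

theorem codeTm_relabel_castSucc {n : ℕ} (t : Tm L n) :
    codeTm (t.relabel (Sum.map id Fin.castSucc) : Tm L (n + 1)) = codeTm t := by
  induction t with
  | var x =>
    rcases x with e | i
    · exact e.elim
    · rfl
  | func f ts ih => simp only [Term.relabel, codeTm, ih]

theorem substAlgebra_form {V : ℕ → ℕ} {m : ℕ} (φ : Fm L m) : ∀ {n : ℕ} {σ : Fin m → Tm L n},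
    (∀ i, codeTm (σ i) = V i) → (∀ j, m ≤ j → V j = 2 * (j - m + n)) →
    (substAlgebra V).form (code φ) = code (substFm σ φ) := by
  induction φ with
  | falsum => intros; exact CodeAlgebra.form_falsum _
  | equal t s =>
    intro n σ hσ _
    rw [code, CodeAlgebra.form_equal, substAlgebra_term hσ, substAlgebra_term hσ]
    rfl
  | rel R ts =>
    intro n σ hσ _
    rw [CodeAlgebra.form_code_rel, substFm, code]
    simp only [substAlgebra_term hσ]
    rfl
  | imp φ ψ ihφ ihψ =>
    intro n σ hσ hV
    rw [code, CodeAlgebra.form_imp, ihφ hσ hV, ihψ hσ hV]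
    rfl
  | @all m φ ih =>
    intro n σ hσ hV
    rw [code, CodeAlgebra.form_all, ih (n := n + 1) (σ := liftSubst σ)]
    · rfl
    · intro i
      refine Fin.lastCases ?_ (fun i => ?_) i
      · rw [liftSubst_last, codeTm_tvar, Fin.val_last, Fin.val_last, hV m le_rfl]
        omega
      · rw [liftSubst, Fin.snoc_castSucc, codeTm_relabel_castSucc, hσ]
        rfl
    · intro j hj
      rw [hV j (by omega)]
      omega

/-- The variable map renaming `x_i` to `x_{l[i]}`, with values in a context of length `n`. -/
def renameMap (p : ℕ × List ℕ) (i : ℕ) : ℕ :=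
  if i < p.2.length then 2 * p.2.getI i else 2 * (i - p.2.length + p.1)

/-- The code of a formula after renaming `x_i` to `x_{l[i]}`. -/
def renameCode (n : ℕ) (l : List ℕ) (c : ℕ) : ℕ := (substAlgebra (renameMap (n, l))).form c

theorem computable_renameMap : Computable₂ renameMap := by
  have hlength : Primrec fun q : (ℕ × List ℕ) × ℕ => q.1.2.length :=
    Primrec.list_length.comp (Primrec.snd.comp Primrec.fst)
  refine Primrec.to_comp (Primrec.ite (Primrec.nat_lt.comp Primrec.snd hlength) ?_ ?_)
  · exact Primrec.nat_mul.comp (Primrec.const 2)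
      (Primrec.list_getI.comp (Primrec.snd.comp Primrec.fst) Primrec.snd)
  · exact Primrec.nat_mul.comp (Primrec.const 2) (Primrec.nat_add.comp
      (Primrec.nat_sub.comp Primrec.snd hlength) (Primrec.fst.comp Primrec.fst))

theorem computable_renameCode :
    Computable fun p : ℕ × List ℕ × ℕ => renameCode p.1 p.2.1 p.2.2 :=
  (computable_substAlgebra computable_renameMap).computable_form.comp
    (Computable.pair .fst (Computable.fst.comp .snd)) (Computable.snd.comp .snd)

theorem code_rename {m n : ℕ} (ρ : Fin m → Fin n) (φ : Fm L m) :
    code (substFm (fun i => tvar (ρ i)) φ) =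
      renameCode n (List.ofFn fun i => (ρ i : ℕ)) (code φ) := by
  refine (substAlgebra_form φ (fun i => ?_) fun j hj => ?_).symm
  · rw [codeTm_tvar, renameMap, if_pos (by simp), List.getI_eq_getElem _ (by simp)]
    simp
  · simp [renameMap, hj]

theorem code_ofSentence (n : ℕ) (φ : L.Sentence) :
    code (ofSentence n φ) = renameCode n [] (code (n := 0) φ) := by
  have hempty : (fun i : Fin 0 => i.elim0 : Fin 0 → Tm L n) =
      fun i => tvar ((fun i : Fin 0 => i.elim0 : Fin 0 → Fin n) i) := funext fun i => i.elim0
  rw [ofSentence, hempty, code_rename]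
  simp

theorem code_weaken {n : ℕ} (φ : Fm L n) :
    code (weaken φ) = renameCode (n + 1) (List.range n) (code φ) := by
  rw [weaken, code_rename]
  congr 1
  apply List.ext_getElem <;> simp

/-- The variable map substituting the term with code `t` for `x_n`. -/
def instMap (p : ℕ × ℕ) (i : ℕ) : ℕ :=
  if i < p.1 then 2 * i else if i = p.1 then p.2 else 2 * (i - 1)

/-- The code of a formula after substituting the term with code `t` for `x_n`. -/
def instCode (n t c : ℕ) : ℕ := (substAlgebra (instMap (n, t))).form c

theorem computable_instMap : Computable₂ instMap := by
  have hfst : Primrec fun q : (ℕ × ℕ) × ℕ => q.1.1 := Primrec.fst.comp Primrec.fst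
  refine Primrec.to_comp (Primrec.ite (Primrec.nat_lt.comp Primrec.snd hfst)
    (Primrec.nat_mul.comp (Primrec.const 2) Primrec.snd)
    (Primrec.ite (Primrec.eq.comp Primrec.snd hfst) (Primrec.snd.comp Primrec.fst) ?_))
  exact Primrec.nat_mul.comp (Primrec.const 2) (Primrec.pred.comp Primrec.snd)

theorem computable_instCode :
    Computable fun p : ℕ × ℕ × ℕ => instCode p.1 p.2.1 p.2.2 :=
  (computable_substAlgebra computable_instMap).computable_form.comp
    (Computable.pair .fst (Computable.fst.comp .snd)) (Computable.snd.comp .snd)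

theorem code_inst {n : ℕ} (φ : Fm L (n + 1)) (t : Tm L n) :
    code (inst φ t) = instCode n (codeTm t) (code φ) := by
  refine (substAlgebra_form φ (fun i => ?_) fun j hj => ?_).symm
  · refine Fin.lastCases ?_ (fun i => ?_) i
    · simp [instMap]
    · simp [instMap, codeTm_tvar]
  · simp only [instMap, show ¬ j < n by omega, show j ≠ n by omega, if_false]
    omega

end FormulaCodes

/-! ### Recognizing Gödel numbers of terms and formulas -/

section WellFormed

open Encodable

/-- The conjunction of the flags and the maximum of the bounds in a list of values of
`infoAlgebra`. -/
def combineInfo (l : List (Bool × ℕ)) : Bool × ℕ :=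
  l.foldr (fun p q => (p.1 && q.1, max p.2 q.2)) (true, 0)

/-- The condition on the value of `infoAlgebra` at a number for being the code of a term or formula
in the context of length `n`. -/
def InfoOk (n : ℕ) (p : Bool × ℕ) : Prop := p.1 = true ∧ p.2 ≤ n

theorem infoOk_combineInfo {n : ℕ} {l : List (Bool × ℕ)} :
    InfoOk n (combineInfo l) ↔ ∀ p ∈ l, InfoOk n p := by
  induction l with
  | nil => simp [combineInfo, InfoOk]
  | cons p l ih =>
    rw [List.forall_mem_cons, ← ih]
    simp only [combineInfo, InfoOk, List.foldr_cons, Bool.and_eq_true, max_le_iff]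
    tauto

variable (L : FirstOrder.Language.{u, v}) [Arithmetization L]

/-- Computes whether the arities are respected, and the length of the shortest context in which
the free variables are contained. -/
def infoAlgebra : CodeAlgebra (Bool × ℕ) (Bool × ℕ) where
  var i := (true, i + 1)
  func a l := (decide (encode (Arithmetization.funcArity L a) = encode (some l.length)) &&
    (combineInfo l).1, (combineInfo l).2)
  falsum := (true, 0)
  equal p q := combineInfo [p, q]
  rel a l := (decide (encode (Arithmetization.relArity L a) = encode (some l.length)) &&
    (combineInfo l).1, (combineInfo l).2)
  imp p q := combineInfo [p, q]
  all p := (p.1, p.2 - 1)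

theorem computable_combineInfo : Computable combineInfo := by
  refine (Primrec.list_foldr (f := fun l : List (Bool × ℕ) => l) (g := fun _ => (true, 0))
    (h := fun _ p => (p.1.1 && p.2.1, max p.1.2 p.2.2)) Primrec.id (Primrec.const _) ?_).to_comp
  refine Primrec.pair (Primrec.and.comp ?_ ?_) (Primrec.nat_max.comp ?_ ?_)
  · exact Primrec.fst.comp (Primrec.fst.comp Primrec.snd)
  · exact Primrec.fst.comp (Primrec.snd.comp Primrec.snd)
  · exact Primrec.snd.comp (Primrec.fst.comp Primrec.snd)
  · exact Primrec.snd.comp (Primrec.snd.comp Primrec.snd)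

theorem computable_arityCheck {ar : ℕ → Option ℕ} (har : Computable ar) :
    Computable fun p : Unit × ℕ × List (Bool × ℕ) =>
      ((decide (encode (ar p.2.1) = encode (some p.2.2.length)) && (combineInfo p.2.2).1,
        (combineInfo p.2.2).2) : Bool × ℕ) := by
  have hl : Computable fun p : Unit × ℕ × List (Bool × ℕ) => p.2.2 := Computable.snd.comp .snd
  have hc := computable_combineInfo.comp hl
  refine Computable.pair (Primrec.and.to_comp.comp (computable_beq ?_ ?_) (Computable.fst.comp hc))
    (Computable.snd.comp hc)
  · exact Computable.encode.comp (har.comp (Computable.fst.comp .snd))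
  · exact Computable.encode.comp (Computable.option_some.comp (Computable.list_length.comp hl))

theorem computable_infoAlgebra : ComputableAlgebra fun _ : Unit => infoAlgebra L := by
  have hpair : Computable fun p : Unit × (Bool × ℕ) × (Bool × ℕ) =>
      combineInfo [p.2.1, p.2.2] :=
    computable_combineInfo.comp (Computable.list_cons.comp (Computable.fst.comp .snd)
      (Computable.list_cons.comp (Computable.snd.comp .snd) (.const [])))
  exact
    { var := Computable.pair (.const true) (Computable.succ.comp .snd)
      func := computable_arityCheck Arithmetization.funcArity_computable
      falsum := .const _
      equal := hpair
      rel := computable_arityCheck Arithmetization.relArity_computable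
      imp := hpair
      all := Computable.pair (Computable.fst.comp .snd)
        (Computable.pred.comp (Computable.snd.comp .snd)) }

/-- Whether a number is the code of a term in the context of length `n`. -/
def isTmCode (n c : ℕ) : Bool :=
  ((infoAlgebra L).term c).1 && decide (((infoAlgebra L).term c).2 ≤ n)

/-- Whether a number is the code of a formula in the context of length `n`. -/
def isFmCode (n c : ℕ) : Bool :=
  ((infoAlgebra L).form c).1 && decide (((infoAlgebra L).form c).2 ≤ n)

theorem computable_isTmCode : Computable₂ (isTmCode L) := by
  have h : Computable fun p : ℕ × ℕ => (infoAlgebra L).term p.2 :=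
    (computable_infoAlgebra L).computable_term.comp (.const ()) .snd
  exact Primrec.and.to_comp.comp (Computable.fst.comp h)
    ((PrimrecRel.decide Primrec.nat_le).to_comp.comp (Computable.snd.comp h) .fst)

theorem computable_isFmCode : Computable₂ (isFmCode L) := by
  have h : Computable fun p : ℕ × ℕ => (infoAlgebra L).form p.2 :=
    (computable_infoAlgebra L).computable_form.comp (.const ()) .snd
  exact Primrec.and.to_comp.comp (Computable.fst.comp h)
    ((PrimrecRel.decide Primrec.nat_le).to_comp.comp (Computable.snd.comp h) .fst)

variable {L}

theorem infoOk_func {n a : ℕ} {l : List (Bool × ℕ)} : InfoOk n ((infoAlgebra L).func a l) ↔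
    Arithmetization.funcArity L a = some l.length ∧ ∀ p ∈ l, InfoOk n p := by
  rw [← infoOk_combineInfo]
  simp only [infoAlgebra, InfoOk, Bool.and_eq_true, decide_eq_true_eq, encode_inj, and_assoc]

theorem infoOk_rel {n a : ℕ} {l : List (Bool × ℕ)} : InfoOk n ((infoAlgebra L).rel a l) ↔
    Arithmetization.relArity L a = some l.length ∧ ∀ p ∈ l, InfoOk n p := by
  rw [← infoOk_combineInfo]
  simp only [infoAlgebra, InfoOk, Bool.and_eq_true, decide_eq_true_eq, encode_inj, and_assoc]

theorem infoOk_term_codeTm {n : ℕ} (t : Tm L n) : InfoOk n ((infoAlgebra L).term (codeTm t)) := by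
  induction t with
  | var x =>
    rcases x with e | i
    · exact e.elim
    · rw [codeTm, CodeAlgebra.term_var]
      exact ⟨rfl, i.2⟩
  | func f ts ih =>
    rw [CodeAlgebra.term_codeTm_func, infoOk_func, List.length_ofFn]
    exact ⟨(Arithmetization.funcArity_eq_some _ _).2 ⟨f, rfl⟩, (List.forall_mem_ofFn_iff).2 ih⟩

theorem infoOk_form_code {n : ℕ} (φ : Fm L n) : InfoOk n ((infoAlgebra L).form (code φ)) := by
  induction φ with
  | falsum => rw [code, CodeAlgebra.form_falsum]; exact ⟨rfl, Nat.zero_le _⟩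
  | equal t s =>
    rw [code, CodeAlgebra.form_equal]
    exact infoOk_combineInfo.2 (by simp [infoOk_term_codeTm])
  | rel R ts =>
    rw [CodeAlgebra.form_code_rel, infoOk_rel, List.length_ofFn]
    exact ⟨(Arithmetization.relArity_eq_some _ _).2 ⟨R, rfl⟩,
      (List.forall_mem_ofFn_iff).2 fun i => infoOk_term_codeTm (ts i)⟩
  | imp φ ψ ihφ ihψ =>
    rw [code, CodeAlgebra.form_imp]
    exact infoOk_combineInfo.2 (by simp [ihφ, ihψ])
  | all φ ih =>
    rw [code, CodeAlgebra.form_all]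
    exact ⟨ih.1, Nat.sub_le_of_le_add ih.2⟩

theorem exists_ofFn_comp_eq {α β : Type*} {l : List α} {f : β → α} (h : ∀ x ∈ l, ∃ b, f b = x) :
    ∃ g : Fin l.length → β, (List.ofFn fun i => f (g i)) = l := by
  choose g hg using fun i : Fin l.length => h l[i] (List.getElem_mem _)
  exact ⟨g, by simp only [hg]; exact List.ofFn_getElem⟩

theorem exists_tm_of_infoOk {n : ℕ} (c : ℕ) (h : InfoOk n ((infoAlgebra L).term c)) :
    ∃ t : Tm L n, codeTm t = c := by
  induction c using Nat.strong_induction_on with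
  | _ c ih =>
    rcases Nat.even_or_odd' c with ⟨b, rfl | rfl⟩
    · rw [CodeAlgebra.term_var] at h
      exact ⟨tvar ⟨b, h.2⟩, rfl⟩
    · obtain ⟨a, d, rfl⟩ : ∃ a d, b = Nat.pair a d := ⟨_, _, (Nat.pair_unpair b).symm⟩
      have hlt {x : ℕ} (hx : x ∈ listOf d) : x < 2 * Nat.pair a d + 1 := by
        have := lt_of_mem_listOf hx
        have := Nat.right_le_pair a d
        omega
      rw [CodeAlgebra.term_func, infoOk_func, List.length_map] at h
      obtain ⟨f, hf⟩ := (Arithmetization.funcArity_eq_some _ _).1 h.1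
      obtain ⟨ts, hts⟩ := exists_ofFn_comp_eq (f := (codeTm : Tm L n → ℕ)) fun x hx =>
        ih x (hlt hx) (h.2 _ (List.mem_map_of_mem hx))
      refine ⟨.func f ts, ?_⟩
      rw [codeTm, hts, hf, encode_listOf]

theorem eq_zero_or_exists_eq_code (c : ℕ) :
    c = 0 ∨ (∃ a b, c = equalCode a b) ∨ (∃ a l, c = relAppCode a l) ∨
      (∃ a b, c = impCode a b) ∨ ∃ a, c = allCode a := by
  obtain rfl | ⟨b, hb⟩ :
      c = 0 ∨ ∃ b, c = 4 * b + 1 ∨ c = 4 * b + 2 ∨ c = 4 * b + 3 ∨ c = 4 * b + 4 := by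
    rcases Nat.eq_zero_or_pos c with hc | hc
    · exact .inl hc
    · exact .inr ⟨(c - 1) / 4, by omega⟩
  · exact .inl rfl
  · obtain ⟨a, d, hab⟩ : ∃ a d, b = Nat.pair a d := ⟨_, _, (Nat.pair_unpair b).symm⟩
    rcases hb with hc | hc | hc | hc
    · exact .inr (.inl ⟨a, d, by rw [hc, hab, equalCode]⟩)
    · exact .inr (.inr (.inl ⟨a, listOf d, by rw [hc, hab, relAppCode, encode_listOf]⟩))
    · exact .inr (.inr (.inr (.inl ⟨a, d, by rw [hc, hab, impCode]⟩)))
    · exact .inr (.inr (.inr (.inr ⟨b, hc⟩)))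

theorem exists_fm_of_infoOk (c : ℕ) : ∀ {n : ℕ}, InfoOk n ((infoAlgebra L).form c) →
    ∃ φ : Fm L n, code φ = c := by
  induction c using Nat.strong_induction_on with
  | _ c ih =>
    intro n h
    rcases eq_zero_or_exists_eq_code c with
      rfl | ⟨a, b, rfl⟩ | ⟨a, l, rfl⟩ | ⟨a, b, rfl⟩ | ⟨a, rfl⟩
    · exact ⟨.falsum, rfl⟩
    · rw [equalCode, CodeAlgebra.form_equal] at h
      have hargs := infoOk_combineInfo.1 h
      obtain ⟨t, ht⟩ := exists_tm_of_infoOk (L := L) (n := n) a (hargs _ (by simp))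
      obtain ⟨s, hs⟩ := exists_tm_of_infoOk (L := L) (n := n) b (hargs _ (by simp))
      exact ⟨.equal t s, by rw [code_equal, ht, hs]⟩
    · rw [relAppCode, CodeAlgebra.form_rel, listOf_encode, infoOk_rel, List.length_map] at h
      obtain ⟨R, hR⟩ := (Arithmetization.relArity_eq_some _ _).1 h.1
      obtain ⟨ts, hts⟩ := exists_ofFn_comp_eq (f := (codeTm : Tm L n → ℕ)) fun x hx =>
        exists_tm_of_infoOk x (h.2 _ (List.mem_map_of_mem hx))
      exact ⟨.rel R ts, by rw [code, hts, hR, relAppCode]⟩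
    · have hab : a < impCode a b ∧ b < impCode a b := by
        have := Nat.left_le_pair a b
        have := Nat.right_le_pair a b
        rw [impCode]
        omega
      rw [impCode, CodeAlgebra.form_imp] at h
      have hargs := infoOk_combineInfo.1 h
      obtain ⟨φ, hφ⟩ := ih a hab.1 (n := n) (hargs _ (by simp))
      obtain ⟨ψ, hψ⟩ := ih b hab.2 (n := n) (hargs _ (by simp))
      exact ⟨.imp φ ψ, by rw [code_imp, hφ, hψ]⟩
    · have ha : a < allCode a := by
        rw [allCode]
        omega
      rw [allCode, CodeAlgebra.form_all] at h
      obtain ⟨φ, hφ⟩ := ih a ha (n := n + 1) ⟨h.1, Nat.le_add_of_sub_le h.2⟩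
      exact ⟨.all φ, by rw [code_all, hφ]⟩

theorem isTmCode_iff {n c : ℕ} : isTmCode L n c = true ↔ ∃ t : Tm L n, codeTm t = c := by
  simp only [isTmCode, Bool.and_eq_true, decide_eq_true_eq]
  exact ⟨exists_tm_of_infoOk c, by rintro ⟨t, rfl⟩; exact infoOk_term_codeTm t⟩

theorem isFmCode_iff {n c : ℕ} : isFmCode L n c = true ↔ ∃ φ : Fm L n, code φ = c := by
  simp only [isFmCode, Bool.and_eq_true, decide_eq_true_eq]
  exact ⟨exists_fm_of_infoOk c, by rintro ⟨φ, rfl⟩; exact infoOk_form_code φ⟩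

theorem arity_eq_of_funcCode_eq {j k : ℕ} {f : L.Functions j} {g : L.Functions k}
    (h : Arithmetization.funcCode f = Arithmetization.funcCode g) : j = k := by
  have hj := (Arithmetization.funcArity_eq_some (L := L) _ _).2 ⟨f, rfl⟩
  have hk := (Arithmetization.funcArity_eq_some (L := L) _ _).2 ⟨g, rfl⟩
  exact Option.some.inj (hj.symm.trans (h ▸ hk))

theorem arity_eq_of_relCode_eq {j k : ℕ} {R : L.Relations j} {Q : L.Relations k}
    (h : Arithmetization.relCode R = Arithmetization.relCode Q) : j = k := by
  have hj := (Arithmetization.relArity_eq_some (L := L) _ _).2 ⟨R, rfl⟩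
  have hk := (Arithmetization.relArity_eq_some (L := L) _ _).2 ⟨Q, rfl⟩
  exact Option.some.inj (hj.symm.trans (h ▸ hk))

theorem codeTm_injective {n : ℕ} : Function.Injective (codeTm : Tm L n → ℕ) := by
  intro t
  induction t with
  | var x =>
    rcases x with e | i
    · exact e.elim
    · intro s h
      rcases s with x | ⟨g, ss⟩
      · rcases x with e | j
        · exact e.elim
        · simp only [codeTm] at h
          have : i = j := Fin.ext (by omega)
          rw [this]
      · simp only [codeTm] at h
        omega
  | @func k f ts ih =>
    intro s h
    rcases s with x | ⟨g, ss⟩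
    · rcases x with e | j
      · exact e.elim
      · simp only [codeTm] at h
        omega
    · simp only [codeTm, Nat.add_right_cancel_iff, Nat.mul_left_cancel_iff (Nat.zero_lt_two),
        Nat.pair_eq_pair, encode_inj] at h
      obtain rfl := arity_eq_of_funcCode_eq h.1
      obtain rfl := Arithmetization.funcCode_injective _ h.1
      have hargs := List.ofFn_injective h.2
      rw [show ts = ss from funext fun i => ih i (congrFun hargs i)]

theorem four_mul_pair_add_inj {a b c d r : ℕ} :
    4 * Nat.pair a b + r = 4 * Nat.pair c d + r ↔ a = c ∧ b = d := by
  rw [Nat.add_right_cancel_iff, Nat.mul_left_cancel_iff (Nat.succ_pos 3), Nat.pair_eq_pair]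

theorem code_injective {n : ℕ} : Function.Injective (code : Fm L n → ℕ) := by
  intro φ
  induction φ with
  | falsum =>
    intro ψ h
    cases ψ <;> simp only [code] at h <;> first | rfl | omega
  | equal t s =>
    intro ψ h
    cases ψ <;> simp only [code] at h <;> try omega
    have hargs := four_mul_pair_add_inj.1 h
    rw [codeTm_injective hargs.1, codeTm_injective hargs.2]
  | rel R ts =>
    intro ψ h
    cases ψ <;> simp only [code] at h <;> try omega
    have hargs := four_mul_pair_add_inj.1 h
    obtain rfl := arity_eq_of_relCode_eq hargs.1
    obtain rfl := Arithmetization.relCode_injective _ hargs.1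
    have hcodes := List.ofFn_injective (encode_injective hargs.2)
    exact congrArg _ (funext fun i => codeTm_injective (congrFun hcodes i))
  | imp φ₁ φ₂ ihφ ihψ =>
    intro ψ h
    cases ψ <;> simp only [code] at h <;> try omega
    have hargs := four_mul_pair_add_inj.1 h
    rw [ihφ hargs.1, ihψ hargs.2]
  | all φ ih =>
    intro ψ h
    cases ψ <;> simp only [code] at h <;> try omega
    rw [ih (Nat.mul_left_cancel (Nat.succ_pos 3) (Nat.add_right_cancel h))]

instance countable_fm (n : ℕ) : Countable (Fm L n) := code_injective.countable

end WellFormed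

/-! ### Enumerable sets -/

section Enumerable

open Encodable

variable {α β δ : Type*} [Primcodable α] [Primcodable β]

/-- Recursive enumerability, as the existence of a computable enumeration. The enumeration may skip
indices, so that the empty set needs no special treatment. -/
def IsEnumerable (X : Set α) : Prop :=
  ∃ f : ℕ → Option α, Computable f ∧ ∀ a, a ∈ X ↔ ∃ p, f p = some a

theorem IsEnumerable.of_partial_range {f : β → Option α} (hf : Computable f) :
    IsEnumerable {a | ∃ b, f b = some a} := by
  refine ⟨fun p => (decode (α := β) p).bind f,
    Computable.option_bind Computable.decode (hf.comp .snd), fun a => ?_⟩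
  constructor
  · rintro ⟨b, hb⟩
    exact ⟨encode b, by simpa using hb⟩
  · rintro ⟨p, hp⟩
    obtain ⟨b, -, hb⟩ := Option.bind_eq_some_iff.1 hp
    exact ⟨b, hb⟩

theorem IsEnumerable.of_check {c : β → Bool} {f : β → α} (hc : Computable c)
    (hf : Computable f) :
    IsEnumerable {a | ∃ b, c b = true ∧ f b = a} := by
  have hrange := IsEnumerable.of_partial_range
    (f := fun b => if c b = true then some (f b) else none)
    (computable_ite (hc.of_eq fun b => by simp) (Computable.option_some.comp hf) (.const none))
  convert hrange using 4
  simp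

theorem IsEnumerable.union {X Y : Set α} (hX : IsEnumerable X) (hY : IsEnumerable Y) :
    IsEnumerable (X ∪ Y) := by
  obtain ⟨f, hf, hfX⟩ := hX
  obtain ⟨g, hg, hgY⟩ := hY
  refine ⟨fun p => if p % 2 = 0 then f (p / 2) else g (p / 2),
    computable_ite (computable_beq (computable_mod 2) (.const 0)) (hf.comp (computable_div 2))
      (hg.comp (computable_div 2)), fun a => ?_⟩
  rw [Set.mem_union, hfX, hgY]
  constructor
  · rintro (⟨p, hp⟩ | ⟨p, hp⟩)
    · exact ⟨2 * p, by simpa using hp⟩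
    · refine ⟨2 * p + 1, ?_⟩
      simpa only [show (2 * p + 1) / 2 = p by omega, show ¬ (2 * p + 1) % 2 = 0 by omega,
        if_false] using hp
  · rintro ⟨p, hp⟩
    simp only at hp
    split_ifs at hp
    · exact .inl ⟨_, hp⟩
    · exact .inr ⟨_, hp⟩

theorem IsEnumerable.prod {X : Set α} {Y : Set β} (hX : IsEnumerable X) (hY : IsEnumerable Y) :
    IsEnumerable (X ×ˢ Y) := by
  obtain ⟨f, hf, hfX⟩ := hX
  obtain ⟨g, hg, hgY⟩ := hY
  refine ⟨fun p => (f p.unpair.1).bind fun a => (g p.unpair.2).map fun b => (a, b), ?_, ?_⟩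
  · refine Computable.option_bind (hf.comp (Computable.fst.comp .unpair)) ?_
    refine Computable.option_map (hg.comp (Computable.snd.comp (Computable.unpair.comp .fst))) ?_
    exact Computable.pair (Computable.snd.comp .fst) .snd
  · rintro ⟨a, b⟩
    rw [Set.mem_prod, hfX, hgY]
    constructor
    · rintro ⟨⟨p, hp⟩, ⟨q, hq⟩⟩
      exact ⟨Nat.pair p q, by simp [hp, hq]⟩
    · rintro ⟨p, hp⟩
      simp only [Option.bind_eq_some_iff, Option.map_eq_some_iff, Prod.mk.injEq] at hp
      obtain ⟨a, ha, b, hb, rfl, rfl⟩ := hp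
      exact ⟨⟨_, ha⟩, ⟨_, hb⟩⟩

theorem IsEnumerable.partial_image {X : Set α} (hX : IsEnumerable X) {g : α → Option β}
    (hg : Computable g) : IsEnumerable {b | ∃ a ∈ X, g a = some b} := by
  obtain ⟨f, hf, hfX⟩ := hX
  refine ⟨fun p => (f p).bind g, Computable.option_bind hf (hg.comp .snd), fun b => ?_⟩
  simp only [Set.mem_ofPred_eq, hfX, Option.bind_eq_some_iff]
  exact ⟨fun ⟨a, ⟨p, hp⟩, h⟩ => ⟨p, a, hp, h⟩, fun ⟨p, a, hp, h⟩ => ⟨a, ⟨p, hp⟩, h⟩⟩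

theorem IsEnumerable.preimage {X : Set β} (hX : IsEnumerable X) {g : α → β} (hg : Computable g) :
    IsEnumerable (g ⁻¹' X) := by
  obtain ⟨f, hf, hfX⟩ := hX
  have hcheck := IsEnumerable.of_check (β := ℕ × α)
    (c := fun q => decide (encode (f q.1) = encode (some (g q.2)))) (f := Prod.snd)
    (computable_beq (Computable.encode.comp (hf.comp .fst))
      (Computable.encode.comp (Computable.option_some.comp (hg.comp .snd)))) .snd
  convert hcheck using 1
  ext a
  rw [Set.mem_preimage, hfX]
  simp only [decide_eq_true_eq, encode_inj, Set.mem_ofPred_eq]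
  exact ⟨fun ⟨p, hp⟩ => ⟨(p, a), hp, rfl⟩, fun ⟨q, hq, h⟩ => ⟨q.1, h ▸ hq⟩⟩

theorem IsEnumerable.rePred {X : Set α} (hX : IsEnumerable X) : REPred fun a => a ∈ X := by
  obtain ⟨f, hf, hfX⟩ := hX
  have hsearch : Partrec fun a : α => Nat.rfindOpt fun p =>
      if encode (f p) = encode (some a) then some () else none :=
    Partrec.rfindOpt (computable_ite (computable_beq (Computable.encode.comp (hf.comp .snd))
      (Computable.encode.comp (Computable.option_some.comp .fst))) (.const _) (.const _))
  refine hsearch.dom_re.of_eq fun a => ?_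
  rw [Nat.rfindOpt_dom, hfX]
  simp only [encode_inj, Option.mem_def, Option.ite_none_right_eq_some, and_true]
  exact exists_congr fun p => exists_const Unit

theorem IsEnumerable.computablePred {X : Set α} (hX : IsEnumerable X) (hXc : IsEnumerable Xᶜ) :
    ComputablePred fun a => a ∈ X :=
  ComputablePred.computable_iff_re_compl_re'.2 ⟨hX.rePred, hXc.rePred⟩

/-- The set generated from `B` by the two partial binary operations `r true` and `r false`. -/
inductive Generated (B : Set δ) (r : Bool → δ → δ → Option δ) : δ → Prop
  | base {a : δ} : a ∈ B → Generated B r a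
  | step {a b c : δ} (t : Bool) : Generated B r a → Generated B r b → r t a b = some c →
      Generated B r c

/-- The sequence enumerating the set generated from the range of `f`. The even indices enumerate the
range itself, and the odd indices code an operation together with the indices of its arguments. -/
def generatedSeq (f : ℕ → Option δ) (r : Bool → δ → δ → Option δ) (p : ℕ) : Option δ :=
  if h : p % 2 = 0 then f (p / 2)
  else (generatedSeq f r (p / 4).unpair.1).bind fun a =>
    (generatedSeq f r (p / 4).unpair.2).bind fun b => r (decide (p % 4 = 1)) a b
termination_by p
decreasing_by
  all_goals
    have hleft := Nat.unpair_left_le (p / 4)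
    have hright := Nat.unpair_right_le (p / 4)
    omega

/-- One step of the computation of `generatedSeq`, from the list of the previous values. -/
def generatedStep (f : ℕ → Option δ) (r : Bool → δ → δ → Option δ) (H : List (Option δ)) :
    Option δ :=
  if H.length % 2 = 0 then f (H.length / 2)
  else (H.getI (H.length / 4).unpair.1).bind fun a =>
    (H.getI (H.length / 4).unpair.2).bind fun b => r (decide (H.length % 4 = 1)) a b

theorem generatedStep_map (f : ℕ → Option δ) (r : Bool → δ → δ → Option δ) (p : ℕ) :
    generatedStep f r ((List.range p).map (generatedSeq f r)) = generatedSeq f r p := by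
  have hH : ∀ x < p, ((List.range p).map (generatedSeq f r)).getI x = generatedSeq f r x := by
    intro x hx
    rw [List.getI_eq_getElem _ (by simpa using hx)]
    simp
  have hleft := Nat.unpair_left_le (p / 4)
  have hright := Nat.unpair_right_le (p / 4)
  rw [generatedStep, List.length_map, List.length_range, generatedSeq]
  split_ifs
  · rfl
  · rw [hH _ (by omega), hH _ (by omega)]

theorem computable_generatedStep {f : ℕ → Option α} {r : Bool → α → α → Option α}
    (hf : Computable f) (hr : Computable fun q : Bool × α × α => r q.1 q.2.1 q.2.2) :
    Computable (generatedStep f r) := by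
  have hlen : Computable fun H : List (Option α) => H.length := Computable.list_length
  have hget : Computable₂ fun (H : List (Option α)) (x : ℕ) => H.getI x :=
    Primrec.list_getI.to_comp
  have hindices : Computable fun H : List (Option α) => (H.length / 4).unpair :=
    Computable.unpair.comp ((computable_div 4).comp hlen)
  have hleft : Computable fun H : List (Option α) => H.getI (H.length / 4).unpair.1 :=
    hget.comp .id (Computable.fst.comp hindices)
  have hright : Computable fun H : List (Option α) => H.getI (H.length / 4).unpair.2 :=
    hget.comp .id (Computable.snd.comp hindices)
  have ht : Computable fun H : List (Option α) => decide (H.length % 4 = 1) :=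
    computable_beq ((computable_mod 4).comp hlen) (.const 1)
  have hop : Computable₂ fun (q : List (Option α) × α) (b : α) =>
      r (decide (q.1.length % 4 = 1)) q.2 b :=
    hr.comp (Computable.pair (ht.comp (Computable.fst.comp .fst))
      (Computable.pair (Computable.snd.comp .fst) .snd))
  have hin : Computable₂ fun (H : List (Option α)) (a : α) =>
      (H.getI (H.length / 4).unpair.2).bind fun b => r (decide (H.length % 4 = 1)) a b :=
    Computable.option_bind (hright.comp .fst) hop
  exact computable_ite (computable_beq ((computable_mod 2).comp hlen) (.const 0))
    (hf.comp ((computable_div 2).comp hlen)) (Computable.option_bind hleft hin)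

theorem computable_generatedSeq {f : ℕ → Option α} {r : Bool → α → α → Option α}
    (hf : Computable f) (hr : Computable fun q : Bool × α × α => r q.1 q.2.1 q.2.2) :
    Computable (generatedSeq f r) := by
  have hstep : Computable₂ fun (_ : Unit) (H : List (Option α)) => some (generatedStep f r H) :=
    Computable.option_some.comp ((computable_generatedStep hf hr).comp .snd)
  have hseq : Computable₂ fun (_ : Unit) (p : ℕ) => generatedSeq f r p :=
    Computable.nat_strong_rec _ hstep fun _ p => congrArg some (generatedStep_map f r p)
  exact hseq.comp (.const ()) .id

theorem generatedSeq_two_mul (f : ℕ → Option δ) (r : Bool → δ → δ → Option δ) (p : ℕ) :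
    generatedSeq f r (2 * p) = f p := by
  rw [generatedSeq, dif_pos (by omega), Nat.mul_div_cancel_left _ Nat.two_pos]

theorem generatedSeq_step (f : ℕ → Option δ) (r : Bool → δ → δ → Option δ) (t : Bool) (p q : ℕ) :
    generatedSeq f r (4 * Nat.pair p q + if t = true then 1 else 3) =
      (generatedSeq f r p).bind fun a => (generatedSeq f r q).bind fun b => r t a b := by
  have hpair : (4 * Nat.pair p q + if t = true then 1 else 3) / 4 = Nat.pair p q := by
    split_ifs <;> omega
  have htag : decide ((4 * Nat.pair p q + if t = true then 1 else 3) % 4 = 1) = t := by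
    cases t <;> simp
  rw [generatedSeq, dif_neg (by split_ifs <;> omega), hpair, htag, Nat.unpair_pair]

theorem Generated.exists_generatedSeq_eq_some {f : ℕ → Option δ} {r : Bool → δ → δ → Option δ}
    {a : δ} (h : Generated {a | ∃ p, f p = some a} r a) : ∃ p, generatedSeq f r p = some a := by
  induction h with
  | base ha =>
    obtain ⟨p, hp⟩ := ha
    exact ⟨2 * p, by rw [generatedSeq_two_mul, hp]⟩
  | step t _ _ hr iha ihb =>
    obtain ⟨p, hp⟩ := iha
    obtain ⟨q, hq⟩ := ihb
    exact ⟨_, by rw [generatedSeq_step f r t p q, hp, hq, Option.bind_some, Option.bind_some, hr]⟩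

theorem generated_of_generatedSeq_eq_some {f : ℕ → Option δ} {r : Bool → δ → δ → Option δ}
    {p : ℕ} {a : δ} (hp : generatedSeq f r p = some a) :
    Generated {a | ∃ p, f p = some a} r a := by
  induction p using Nat.strong_induction_on generalizing a with
  | _ p ih =>
    rw [generatedSeq] at hp
    have hleft := Nat.unpair_left_le (p / 4)
    have hright := Nat.unpair_right_le (p / 4)
    split_ifs at hp
    · exact .base ⟨_, hp⟩
    · simp only [Option.bind_eq_some_iff] at hp
      obtain ⟨b, hb, c, hc, hr⟩ := hp
      exact .step _ (ih _ (by omega) hb) (ih _ (by omega) hc) hr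

theorem IsEnumerable.generated {B : Set α} (hB : IsEnumerable B) {r : Bool → α → α → Option α}
    (hr : Computable fun q : Bool × α × α => r q.1 q.2.1 q.2.2) :
    IsEnumerable {a | Generated B r a} := by
  obtain ⟨f, hf, hfB⟩ := hB
  obtain rfl : B = {a | ∃ p, f p = some a} := Set.ext hfB
  exact ⟨generatedSeq f r, computable_generatedSeq hf hr, fun a =>
    ⟨Generated.exists_generatedSeq_eq_some, fun ⟨_, hp⟩ => generated_of_generatedSeq_eq_some hp⟩⟩

end Enumerable

/-! ### Enumerating the theorems of a recursive set of axioms -/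

section Theorems

open Encodable

/-- The values of `e n` can be recognized from `n`, uniformly in `n`. This is used for the coding
functions of terms and formulas in the context of length `n`. -/
def HasDecidableRange {ι : ℕ → Type*} {β : Type*} [Primcodable β] (e : ∀ n, ι n → β) : Prop :=
  ComputablePred fun p : ℕ × β => ∃ i, e p.1 i = p.2

namespace HasDecidableRange

variable {ι κ : ℕ → Type*} {β γ : Type*} [Primcodable β] [Primcodable γ]
  {e : ∀ n, ι n → β} {d : ∀ n, κ n → γ}

theorem prod (he : HasDecidableRange e) (hd : HasDecidableRange d) :
    HasDecidableRange fun n (i : ι n × κ n) => (e n i.1, d n i.2) := by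
  obtain ⟨b, hb, hbe⟩ := ComputablePred.computable_iff.1 he
  obtain ⟨c, hc, hcd⟩ := ComputablePred.computable_iff.1 hd
  refine ComputablePred.computable_iff.2
    ⟨fun p => b (p.1, p.2.1) && c (p.1, p.2.2), Primrec.and.to_comp.comp
      (hb.comp (Computable.pair .fst (Computable.fst.comp .snd)))
      (hc.comp (Computable.pair .fst (Computable.snd.comp .snd))), funext fun p => ?_⟩
  have hfst := congrFun hbe (p.1, p.2.1)
  have hsnd := congrFun hcd (p.1, p.2.2)
  simp only at hfst hsnd
  rw [Bool.and_eq_true, ← hfst, ← hsnd]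
  simp only [Prod.exists, Prod.ext_iff, exists_and_left, exists_and_right]

theorem isEnumerable (he : HasDecidableRange e) {f : ℕ × β → γ} (hf : Computable f) :
    IsEnumerable {p : ℕ × γ | ∃ i, f (p.1, e p.1 i) = p.2} := by
  obtain ⟨c, hc, hce⟩ := ComputablePred.computable_iff.1 he
  convert IsEnumerable.of_check hc (Computable.pair .fst hf) using 1
  ext ⟨n, a⟩
  simp only [← congrFun hce, Set.mem_ofPred_eq, Prod.exists, Prod.mk.injEq]
  constructor
  · rintro ⟨i, hi⟩
    exact ⟨n, e n i, ⟨i, rfl⟩, rfl, hi⟩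
  · rintro ⟨_, _, ⟨i, rfl⟩, rfl, hi⟩
    exact ⟨i, hi⟩

end HasDecidableRange

section Recognition

variable (L : FirstOrder.Language.{u, v}) [Arithmetization L]

theorem hasDecidableRange_code : HasDecidableRange fun n (φ : Fm L n) => code φ :=
  ComputablePred.computable_iff.2
    ⟨_, computable_isFmCode L, funext fun _ => propext isFmCode_iff.symm⟩

theorem hasDecidableRange_code_succ : HasDecidableRange fun n (φ : Fm L (n + 1)) => code φ :=
  ComputablePred.computable_iff.2
    ⟨_, (computable_isFmCode L).comp (Computable.succ.comp .fst) .snd,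
      funext fun _ => propext isFmCode_iff.symm⟩

theorem hasDecidableRange_codeTm : HasDecidableRange fun n (t : Tm L n) => codeTm t :=
  ComputablePred.computable_iff.2
    ⟨_, computable_isTmCode L, funext fun _ => propext isTmCode_iff.symm⟩

end Recognition

theorem RecursiveSet.hasDecidableRange {L : FirstOrder.Language.{u, v}} [Arithmetization L]
    {A : L.Theory} (hA : RecursiveSet A) :
    HasDecidableRange fun _ (φ : A) => code (n := 0) (φ : L.Sentence) := by
  obtain ⟨c, hc, hcA⟩ := ComputablePred.computable_iff.1 hA
  refine ComputablePred.computable_iff.2 ⟨fun p => c p.2, hc.comp .snd, funext fun p => ?_⟩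
  rw [← congrFun hcA p.2]
  simp

theorem computable_two_mul : Computable fun i : ℕ => 2 * i :=
  (Primrec.nat_mul.comp (Primrec.const 2) Primrec.id).to_comp

theorem computable_renameCode_succ {α : Type*} [Primcodable α] {n : α → ℕ} {l : α → List ℕ}
    {c : α → ℕ} (hn : Computable n) (hl : Computable l) (hc : Computable c) :
    Computable fun a => renameCode (n a + 1) (l a) (c a) :=
  computable_renameCode.comp (g := fun a => (n a + 1, l a, c a))
    (Computable.pair (Computable.succ.comp hn) (Computable.pair hl hc))

/-- The codes of the axioms of the calculus over `A`, that is, of the logical axioms and of the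
sentences in `A`, each paired with the length of its context. -/
def axiomCodes {L : FirstOrder.Language.{u, v}} [Arithmetization L] (A : L.Theory) :
    Set (ℕ × ℕ) :=
  {p | ∃ φ ∈ A, code (ofSentence p.1 φ) = p.2} ∪
  ({p | ∃ φ ψ : Fm L p.1, code (φ.imp (ψ.imp φ)) = p.2} ∪
  ({p | ∃ φ ψ χ : Fm L p.1,
    code ((φ.imp (ψ.imp χ)).imp ((φ.imp ψ).imp (φ.imp χ))) = p.2} ∪
  ({p | ∃ φ : Fm L p.1, code (φ.not.not.imp φ) = p.2} ∪
  ({p | ∃ (φ : Fm L (p.1 + 1)) (t : Tm L p.1), code (φ.all.imp (inst φ t)) = p.2} ∪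
  ({p | ∃ (φ : Fm L p.1) (ψ : Fm L (p.1 + 1)),
    code (((weaken φ).imp ψ).all.imp (φ.imp ψ.all)) = p.2} ∪
  ({p | code (BoundedFormula.equal (tvar (Fin.last p.1)) (tvar (Fin.last p.1)) :
    Fm L (p.1 + 1)).ex = p.2} ∪
  ({p | ∃ t : Tm L p.1, code (.equal t t : Fm L p.1) = p.2} ∪
  {p | ∃ (φ : Fm L (p.1 + 1)) (t s : Tm L p.1),
    code ((.equal t s : Fm L p.1).imp ((inst φ t).imp (inst φ s))) = p.2})))))))

theorem RecursiveSet.isEnumerable_codes_ofSentence {L : FirstOrder.Language.{u, v}}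
    [Arithmetization L] {A : L.Theory} (hA : RecursiveSet A) :
    IsEnumerable {p : ℕ × ℕ | ∃ φ ∈ A, code (ofSentence p.1 φ) = p.2} := by
  simpa only [Subtype.exists, exists_prop, code_ofSentence] using
    hA.hasDecidableRange.isEnumerable
      (computable_renameCode.comp (Computable.pair .fst (Computable.pair (.const []) .snd)))

section AxiomSchemes

variable (L : FirstOrder.Language.{u, v}) [Arithmetization L]

theorem isEnumerable_codes_imp_intro :
    IsEnumerable {p : ℕ × ℕ | ∃ φ ψ : Fm L p.1, code (φ.imp (ψ.imp φ)) = p.2} := by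
  have hφ : Computable fun q : ℕ × ℕ × ℕ => q.2.1 := Computable.fst.comp .snd
  have hψ : Computable fun q : ℕ × ℕ × ℕ => q.2.2 := Computable.snd.comp .snd
  simpa only [Prod.exists, code_imp] using
    ((hasDecidableRange_code L).prod (hasDecidableRange_code L)).isEnumerable
      (computable_impCode.comp hφ (computable_impCode.comp hψ hφ))

theorem isEnumerable_codes_imp_distrib :
    IsEnumerable {p : ℕ × ℕ | ∃ φ ψ χ : Fm L p.1,
      code ((φ.imp (ψ.imp χ)).imp ((φ.imp ψ).imp (φ.imp χ))) = p.2} := by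
  have hφ : Computable fun q : ℕ × ℕ × ℕ × ℕ => q.2.1 := Computable.fst.comp .snd
  have hψ : Computable fun q : ℕ × ℕ × ℕ × ℕ => q.2.2.1 :=
    Computable.fst.comp (Computable.snd.comp .snd)
  have hχ : Computable fun q : ℕ × ℕ × ℕ × ℕ => q.2.2.2 :=
    Computable.snd.comp (Computable.snd.comp .snd)
  simpa only [Prod.exists, code_imp] using
    ((hasDecidableRange_code L).prod
      ((hasDecidableRange_code L).prod (hasDecidableRange_code L))).isEnumerable
      (computable_impCode.comp (computable_impCode.comp hφ (computable_impCode.comp hψ hχ))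
        (computable_impCode.comp (computable_impCode.comp hφ hψ) (computable_impCode.comp hφ hχ)))

theorem isEnumerable_codes_not_not_elim :
    IsEnumerable {p : ℕ × ℕ | ∃ φ : Fm L p.1, code (φ.not.not.imp φ) = p.2} :=
  (hasDecidableRange_code L).isEnumerable (computable_impCode.comp
    (computable_impCode.comp (computable_impCode.comp .snd (.const 0)) (.const 0)) .snd)

theorem isEnumerable_codes_all_elim :
    IsEnumerable {p : ℕ × ℕ | ∃ (φ : Fm L (p.1 + 1)) (t : Tm L p.1),
      code (φ.all.imp (inst φ t)) = p.2} := by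
  have hφ : Computable fun q : ℕ × ℕ × ℕ => q.2.1 := Computable.fst.comp .snd
  have ht : Computable fun q : ℕ × ℕ × ℕ => q.2.2 := Computable.snd.comp .snd
  simpa only [Prod.exists, code_imp, code_all, code_inst] using
    ((hasDecidableRange_code_succ L).prod (hasDecidableRange_codeTm L)).isEnumerable
      (computable_impCode.comp (computable_allCode.comp hφ)
        (computable_instCode.comp (Computable.pair .fst (Computable.pair ht hφ))))

theorem isEnumerable_codes_all_distrib :
    IsEnumerable {p : ℕ × ℕ | ∃ (φ : Fm L p.1) (ψ : Fm L (p.1 + 1)),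
      code (((weaken φ).imp ψ).all.imp (φ.imp ψ.all)) = p.2} := by
  have hφ : Computable fun q : ℕ × ℕ × ℕ => q.2.1 := Computable.fst.comp .snd
  have hψ : Computable fun q : ℕ × ℕ × ℕ => q.2.2 := Computable.snd.comp .snd
  have hweaken : Computable fun q : ℕ × ℕ × ℕ => renameCode (q.1 + 1) (List.range q.1) q.2.1 :=
    computable_renameCode_succ .fst (Primrec.list_range.to_comp.comp .fst) hφ
  simpa only [Prod.exists, code_imp, code_all, code_weaken] using
    ((hasDecidableRange_code L).prod (hasDecidableRange_code_succ L)).isEnumerable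
      (computable_impCode.comp (computable_allCode.comp (computable_impCode.comp hweaken hψ))
        (computable_impCode.comp hφ (computable_allCode.comp hψ)))

theorem isEnumerable_codes_exists_self :
    IsEnumerable {p : ℕ × ℕ | code (BoundedFormula.equal (tvar (Fin.last p.1))
      (tvar (Fin.last p.1)) : Fm L (p.1 + 1)).ex = p.2} := by
  have hcode : Computable fun n : ℕ => code (BoundedFormula.equal (tvar (Fin.last n))
      (tvar (Fin.last n)) : Fm L (n + 1)).ex :=
    computable_impCode.comp (computable_allCode.comp (computable_impCode.comp
      (computable_equalCode.comp computable_two_mul computable_two_mul) (.const 0))) (.const 0)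
  simpa only [Prod.ext_iff, id_eq, true_and, exists_eq_left] using
    IsEnumerable.of_check (.const true) (Computable.pair .id hcode)

theorem isEnumerable_codes_eq_refl :
    IsEnumerable {p : ℕ × ℕ | ∃ t : Tm L p.1, code (.equal t t : Fm L p.1) = p.2} :=
  (hasDecidableRange_codeTm L).isEnumerable (computable_equalCode.comp .snd .snd)

theorem isEnumerable_codes_eq_subst :
    IsEnumerable {p : ℕ × ℕ | ∃ (φ : Fm L (p.1 + 1)) (t s : Tm L p.1),
      code ((.equal t s : Fm L p.1).imp ((inst φ t).imp (inst φ s))) = p.2} := by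
  have hn : Computable fun q : ℕ × ℕ × ℕ × ℕ => q.1 := .fst
  have hφ : Computable fun q : ℕ × ℕ × ℕ × ℕ => q.2.1 := Computable.fst.comp .snd
  have ht : Computable fun q : ℕ × ℕ × ℕ × ℕ => q.2.2.1 :=
    Computable.fst.comp (Computable.snd.comp .snd)
  have hs : Computable fun q : ℕ × ℕ × ℕ × ℕ => q.2.2.2 :=
    Computable.snd.comp (Computable.snd.comp .snd)
  simpa only [Prod.exists, code_imp, code_equal, code_inst] using
    ((hasDecidableRange_code_succ L).prod
      ((hasDecidableRange_codeTm L).prod (hasDecidableRange_codeTm L))).isEnumerable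
      (computable_impCode.comp (computable_equalCode.comp ht hs) (computable_impCode.comp
        (computable_instCode.comp (Computable.pair hn (Computable.pair ht hφ)))
        (computable_instCode.comp (Computable.pair hn (Computable.pair hs hφ)))))

end AxiomSchemes

variable {L : FirstOrder.Language.{u, v}} [Arithmetization L] {A : L.Theory}

theorem isEnumerable_axiomCodes (hA : RecursiveSet A) : IsEnumerable (axiomCodes A) :=
  hA.isEnumerable_codes_ofSentence.union <| (isEnumerable_codes_imp_intro L).union <|
  (isEnumerable_codes_imp_distrib L).union <| (isEnumerable_codes_not_not_elim L).union <|
  (isEnumerable_codes_all_elim L).union <| (isEnumerable_codes_all_distrib L).union <|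
  (isEnumerable_codes_exists_self L).union <| (isEnumerable_codes_eq_refl L).union <|
  isEnumerable_codes_eq_subst L

theorem exists_provable_of_mem_axiomCodes {p : ℕ × ℕ} (h : p ∈ axiomCodes A) :
    ∃ φ : Fm L p.1, Provable A φ ∧ code φ = p.2 := by
  rcases h with ⟨φ, hφ, h⟩ | ⟨φ, ψ, h⟩ | ⟨φ, ψ, χ, h⟩ | ⟨φ, h⟩ | ⟨φ, t, h⟩ | ⟨φ, ψ, h⟩ | h |
    ⟨t, h⟩ | ⟨φ, t, s, h⟩
  · exact ⟨_, .ax _ hφ, h⟩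
  · exact ⟨_, .imp_intro φ ψ, h⟩
  · exact ⟨_, .imp_distrib φ ψ χ, h⟩
  · exact ⟨_, .not_not_elim φ, h⟩
  · exact ⟨_, .all_elim φ t, h⟩
  · exact ⟨_, .all_distrib φ ψ, h⟩
  · exact ⟨_, .exists_self _, h⟩
  · exact ⟨_, .eq_refl t, h⟩
  · exact ⟨_, .eq_subst φ t s, h⟩

/-- The inference rules on pairs of a context length and a formula code: modus ponens for `true`,
generalization of the first premise for `false`. The conclusion of an implication is read off from
its code as the second component of the pair which that code contains. -/
def ruleCode (t : Bool) (p q : ℕ × ℕ) : Option (ℕ × ℕ) :=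
  if t = true then
    if p.1 = q.1 then
      if p.2 = impCode q.2 (p.2 / 4).unpair.2 then some (p.1, (p.2 / 4).unpair.2) else none
    else none
  else if p.1 = 0 then none else some (p.1 - 1, allCode p.2)

theorem computable_ruleCode :
    Computable fun q : Bool × (ℕ × ℕ) × (ℕ × ℕ) => ruleCode q.1 q.2.1 q.2.2 := by
  have hp : Computable fun q : Bool × (ℕ × ℕ) × (ℕ × ℕ) => q.2.1 := Computable.fst.comp .snd
  have hq : Computable fun q : Bool × (ℕ × ℕ) × (ℕ × ℕ) => q.2.2 := Computable.snd.comp .snd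
  have hcontext := Computable.fst.comp hp
  have hcode := Computable.snd.comp hp
  have hconclusion := Computable.snd.comp (Computable.unpair.comp ((computable_div 4).comp hcode))
  refine computable_ite (Computable.fst.of_eq fun q => by simp) ?_ ?_
  · refine computable_ite (computable_beq hcontext (Computable.fst.comp hq)) ?_ (.const none)
    refine computable_ite (computable_beq hcode
      (computable_impCode.comp (Computable.snd.comp hq) hconclusion)) ?_ (.const none)
    exact Computable.option_some.comp (Computable.pair hcontext hconclusion)
  · refine computable_ite (computable_beq hcontext (.const 0)) (.const none) ?_
    exact Computable.option_some.comp (Computable.pair (Computable.pred.comp hcontext)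
      (computable_allCode.comp hcode))

theorem ruleCode_true_eq_some {p q s : ℕ × ℕ} :
    ruleCode true p q = some s ↔ ∃ n a b, p = (n, impCode a b) ∧ q = (n, a) ∧ s = (n, b) := by
  have hdiv (a b : ℕ) : (impCode a b / 4).unpair = (a, b) := by
    rw [show impCode a b / 4 = Nat.pair a b by rw [impCode]; omega, Nat.unpair_pair]
  constructor
  · obtain ⟨n, c⟩ := p
    obtain ⟨m, a⟩ := q
    intro h
    simp only [ruleCode, if_true] at h
    split_ifs at h with hcontext hcode
    exact ⟨n, a, _, by rw [← hcode], by rw [hcontext], (Option.some.inj h).symm⟩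
  · rintro ⟨n, a, b, rfl, rfl, rfl⟩
    simp [ruleCode, hdiv]

theorem ruleCode_false_eq_some {p q s : ℕ × ℕ} :
    ruleCode false p q = some s ↔ ∃ n a, p = (n + 1, a) ∧ s = (n, allCode a) := by
  obtain ⟨_ | n, a⟩ := p <;> simp [ruleCode, eq_comm]

theorem exists_eq_imp_of_code_eq {n : ℕ} {φ ψ : Fm L n} {b : ℕ}
    (h : code φ = impCode (code ψ) b) : ∃ χ : Fm L n, φ = ψ.imp χ ∧ code χ = b := by
  cases φ <;> simp only [code, impCode] at h <;> try omega
  obtain ⟨hψ, hχ⟩ := four_mul_pair_add_inj.1 h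
  exact ⟨_, by rw [code_injective hψ], hχ⟩

theorem exists_provable_of_generated {p : ℕ × ℕ} (h : Generated (axiomCodes A) ruleCode p) :
    ∃ φ : Fm L p.1, Provable A φ ∧ code φ = p.2 := by
  induction h with
  | base h => exact exists_provable_of_mem_axiomCodes h
  | step t _ _ hr ihp ihq =>
    cases t with
    | true =>
      obtain ⟨n, a, b, rfl, rfl, rfl⟩ := ruleCode_true_eq_some.1 hr
      dsimp only at ihp ihq ⊢
      obtain ⟨φ, hφ, hcode⟩ := ihp
      obtain ⟨ψ, hψ, rfl⟩ := ihq
      obtain ⟨χ, rfl, hχ⟩ := exists_eq_imp_of_code_eq hcode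
      exact ⟨χ, .mp hφ hψ, hχ⟩
    | false =>
      obtain ⟨n, a, rfl, rfl⟩ := ruleCode_false_eq_some.1 hr
      dsimp only at ihp ⊢
      obtain ⟨φ, hφ, rfl⟩ := ihp
      exact ⟨φ.all, .gen hφ, code_all φ⟩

theorem generated_of_provable {n : ℕ} {φ : Fm L n} (h : Provable A φ) :
    Generated (axiomCodes A) ruleCode (n, code φ) := by
  induction h with
  | ax n h => exact .base (.inl ⟨_, h, rfl⟩)
  | imp_intro φ ψ => exact .base (.inr (.inl ⟨_, _, rfl⟩))
  | imp_distrib φ ψ χ => exact .base (.inr (.inr (.inl ⟨_, _, _, rfl⟩)))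
  | not_not_elim φ => exact .base (.inr (.inr (.inr (.inl ⟨_, rfl⟩))))
  | all_elim φ t => exact .base (.inr (.inr (.inr (.inr (.inl ⟨_, _, rfl⟩)))))
  | all_distrib φ ψ => exact .base (.inr (.inr (.inr (.inr (.inr (.inl ⟨_, _, rfl⟩))))))
  | exists_self n => exact .base (.inr (.inr (.inr (.inr (.inr (.inr (.inl rfl)))))))
  | eq_refl t => exact .base (.inr (.inr (.inr (.inr (.inr (.inr (.inr (.inl ⟨_, rfl⟩))))))))
  | eq_subst φ t s =>
    exact .base (.inr (.inr (.inr (.inr (.inr (.inr (.inr (.inr ⟨_, _, _, rfl⟩))))))))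
  | mp _ _ ihφ ihψ => exact .step true ihφ ihψ (ruleCode_true_eq_some.2 ⟨_, _, _, rfl, rfl, rfl⟩)
  | gen _ ih => exact .step false ih ih (ruleCode_false_eq_some.2 ⟨_, _, rfl, rfl⟩)

theorem isEnumerable_theorems (hA : RecursiveSet A) :
    IsEnumerable {c : ℕ | ∃ φ : L.Sentence, Proves A φ ∧ code (n := 0) φ = c} := by
  convert ((isEnumerable_axiomCodes hA).generated computable_ruleCode).preimage
    (Computable.pair (.const 0) .id) using 1
  ext c
  exact ⟨fun ⟨φ, hφ, h⟩ => h ▸ generated_of_provable hφ, exists_provable_of_generated⟩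

theorem recursiveSet_of_isEnumerable {X : Set L.Sentence}
    (hX : IsEnumerable {c : ℕ | ∃ φ ∈ X, code (n := 0) φ = c})
    (hneg : ∀ φ : L.Sentence, φ.not ∈ X ↔ φ ∉ X) : RecursiveSet X := by
  have hcode (φ : L.Sentence) : (∃ ψ ∈ X, code (n := 0) ψ = code (n := 0) φ) ↔ φ ∈ X :=
    ⟨fun ⟨ψ, hψ, h⟩ => code_injective h ▸ hψ, fun h => ⟨φ, h, rfl⟩⟩
  have hnotFm : IsEnumerable {c : ℕ | ∃ b : ℕ, (!isFmCode L 0 b) = true ∧ b = c} :=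
    .of_check (Primrec.not.to_comp.comp ((computable_isFmCode L).comp (.const 0) .id)) .id
  have hnot := hX.preimage (computable_impCode.comp .id (.const 0))
  refine hX.computablePred ?_
  convert hnotFm.union hnot using 1
  ext c
  simp only [Set.mem_compl_iff, Set.mem_ofPred_eq, Set.mem_union, Set.mem_preimage,
    exists_eq_right, Bool.not_eq_true', ← Bool.not_eq_true, isFmCode_iff]
  by_cases hc : ∃ φ : Fm L 0, code φ = c
  · obtain ⟨φ, rfl⟩ := hc
    have hex : ∃ ψ : Fm L 0, code ψ = code φ := ⟨φ, rfl⟩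
    have himp : (∃ ψ ∈ X, code (n := 0) ψ = impCode (id (code φ)) 0) ↔ φ.not ∈ X := hcode φ.not
    rw [hcode φ, himp, hneg φ]
    tauto
  · simp only [hc, not_false_eq_true, true_or, iff_true]
    exact fun ⟨φ, _, h⟩ => hc ⟨φ, h⟩

end Theorems

/-! ### Extensions as interpretations -/

section IdentityRecursive

variable {L : FirstOrder.Language.{u, v}} [Arithmetization L]

theorem computable_map_two_mul : Computable fun l : List ℕ => l.map fun i => 2 * i :=
  (Primrec.list_map (g := fun _ i => 2 * i) Primrec.id
    (Primrec.nat_mul.comp (Primrec.const 2) Primrec.snd)).to_comp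

theorem code_rel_tvar {n k : ℕ} (R : L.Relations k) (σ : Fin k → Fin n) :
    code (.rel R fun l => tvar (σ l)) = relAppCode (Arithmetization.relCode R)
      ((List.ofFn fun l => (σ l : ℕ)).map fun i => 2 * i) := by
  rw [List.map_ofFn]
  rfl

theorem code_func_tvar {n k : ℕ} (f : L.Functions k) (σ : Fin k → Fin n) (j : Fin n) :
    code (.equal (.func f fun l => tvar (σ l)) (tvar j)) =
      equalCode (funcAppCode (Arithmetization.funcCode f)
        ((List.ofFn fun l => (σ l : ℕ)).map fun i => 2 * i)) (2 * (j : ℕ)) := by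
  rw [List.map_ofFn]
  rfl

theorem ofFn_val (k : ℕ) : (List.ofFn fun i : Fin k => (i : ℕ)) = List.range k := by
  apply List.ext_getElem <;> simp

theorem identity_isRecursive : (Translation.identity L).IsRecursive := by
  have hargs {f : ℕ → ℕ} (hf : Computable f) :
      Computable fun c => (List.range (f c)).map fun i => 2 * i :=
    computable_map_two_mul.comp (Primrec.list_range.to_comp.comp hf)
  constructor
  · have har : Computable fun c => (Arithmetization.relArity L c).getD 0 :=
      Computable.option_getD Arithmetization.relArity_computable (.const 0)
    refine ⟨_, computable_relAppCode.comp .id (hargs har), fun k R => ?_⟩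
    have hcode := code_rel_tvar R (id : Fin k → Fin k)
    rw [show (Translation.identity L).rel R = .rel R fun l => tvar (id l) from rfl, hcode]
    simp only [(Arithmetization.relArity_eq_some _ _).2 ⟨R, rfl⟩, Option.getD_some, ← ofFn_val]
    rfl
  · have har : Computable fun c => (Arithmetization.funcArity L c).getD 0 :=
      Computable.option_getD Arithmetization.funcArity_computable (.const 0)
    refine ⟨_, computable_equalCode.comp (computable_funcAppCode.comp .id (hargs har))
      (computable_two_mul.comp har), fun k f => ?_⟩
    have hcode := code_func_tvar f (Fin.castSucc : Fin k → Fin (k + 1)) (Fin.last k)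
    rw [show (Translation.identity L).func f =
      .equal (.func f fun l => tvar l.castSucc) (tvar (Fin.last k)) from rfl, hcode]
    simp only [(Arithmetization.funcArity_eq_some _ _).2 ⟨f, rfl⟩, Option.getD_some, ← ofFn_val]
    rfl

theorem Extends.interpretable {T S : L.Theory} (h : Extends S T) : Interpretable T S :=
  ⟨Translation.identity L, identity_isRecursive, Translation.identity_isInterpretation h⟩

end IdentityRecursive

/-! ### Complete extensions of decidable theories -/

section Lindenbaum

variable {L : FirstOrder.Language.{u, v}} [Arithmetization L] (S : L.Theory)

open Classical in
/-- The conjunction of the sentences with code less than `c` which are added to `S` in the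
Lindenbaum construction. The sentence with code `c` is added if `S` does not refute it from this
conjunction. -/
noncomputable def lindenbaumSeq : ℕ → L.Sentence
  | 0 => ⊤
  | c + 1 =>
    if h : ∃ φ : L.Sentence, code (n := 0) φ = c ∧ ¬ Proves S ((lindenbaumSeq c).imp φ.not) then
      lindenbaumSeq c ⊓ h.choose
    else lindenbaumSeq c

/-- The Lindenbaum completion of `S`, in which sentences are added in the order of their codes. -/
def lindenbaumExtension : L.Theory :=
  {φ | ¬ Proves S ((lindenbaumSeq S (code (n := 0) φ)).imp φ.not)}

variable {S}

theorem lindenbaumSeq_of_mem {φ : L.Sentence} (h : φ ∈ lindenbaumExtension S) :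
    lindenbaumSeq S (code (n := 0) φ + 1) = lindenbaumSeq S (code (n := 0) φ) ⊓ φ := by
  have hex : ∃ ψ : L.Sentence, code (n := 0) ψ = code (n := 0) φ ∧
      ¬ Proves S ((lindenbaumSeq S (code (n := 0) φ)).imp ψ.not) := ⟨φ, rfl, h⟩
  rw [lindenbaumSeq, dif_pos hex, code_injective hex.choose_spec.1]

theorem lindenbaumSeq_succ_eq_or (c : ℕ) :
    (∃ φ ∈ lindenbaumExtension S, code (n := 0) φ = c) ∨
      lindenbaumSeq S (c + 1) = lindenbaumSeq S c := by
  by_cases h : ∃ φ : L.Sentence, code (n := 0) φ = c ∧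
      ¬ Proves S ((lindenbaumSeq S c).imp φ.not)
  · obtain ⟨φ, rfl, hφ⟩ := h
    exact .inl ⟨φ, hφ, rfl⟩
  · rw [lindenbaumSeq, dif_neg h]
    exact .inr rfl

theorem lindenbaumSeq_mono {i j : ℕ} (h : i ≤ j) :
    Proves S ((lindenbaumSeq S j).imp (lindenbaumSeq S i)) := by
  induction j, h using Nat.le_induction with
  | base => exact Provable.imp_self _
  | succ j _ ih =>
    rcases lindenbaumSeq_succ_eq_or (S := S) j with ⟨φ, hφ, rfl⟩ | h
    · rw [lindenbaumSeq_of_mem hφ]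
      exact Provable.imp_trans (.and_left _ _) ih
    · rwa [h]

theorem lindenbaumSeq_consistent (hS : Consistent S) (c : ℕ) :
    ¬ Proves S ((lindenbaumSeq S c).imp ⊥) := by
  induction c with
  | zero => exact fun h => hS (Provable.mp h (.imp_self _))
  | succ c ih =>
    rcases lindenbaumSeq_succ_eq_or (S := S) c with ⟨φ, hφ, rfl⟩ | h
    · rw [lindenbaumSeq_of_mem hφ]
      exact fun h => hφ (Provable.curry h)
    · rwa [h]

theorem consistent_lindenbaumExtension (hS : Consistent S) :
    Consistent (lindenbaumExtension S) := by
  intro hbot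
  have hax (φ) (hφ : φ ∈ lindenbaumExtension S) : ∃ i, Proves S ((lindenbaumSeq S i).imp φ) :=
    ⟨code (n := 0) φ + 1, lindenbaumSeq_of_mem hφ ▸ Provable.and_right _ _⟩
  obtain ⟨i, hi⟩ := Provable.exists_imp_of_directed (fun _ _ => lindenbaumSeq_mono) hax hbot
  rw [ofSentence_zero] at hi
  exact lindenbaumSeq_consistent hS i hi

theorem extends_lindenbaumExtension (hS : Consistent S) : Extends (lindenbaumExtension S) S :=
  fun _ hφ => Proves.of_mem fun h =>
    lindenbaumSeq_consistent hS _ (Provable.imp_mp h (Provable.imp_const hφ _))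

theorem not_incomplete_lindenbaumExtension (hS : Consistent S) :
    ¬ Incomplete (lindenbaumExtension S) := by
  rintro ⟨φ, hφ, hnot⟩
  have refutes {ψ : L.Sentence} (h : ¬ Proves (lindenbaumExtension S) ψ) :
      Proves S ((lindenbaumSeq S (code (n := 0) ψ)).imp ψ.not) :=
    not_not.1 fun hψ => h (Proves.of_mem hψ)
  let k := max (code (n := 0) φ) (code (n := 0) φ.not)
  refine lindenbaumSeq_consistent hS k (Provable.imp_mp (φ := φ.not) ?_ ?_)
  · exact Provable.imp_trans (lindenbaumSeq_mono (le_max_right _ _)) (refutes hnot)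
  · exact Provable.imp_trans (lindenbaumSeq_mono (le_max_left _ _)) (refutes hφ)

section Decidable

variable (L) in
/-- The test on codes for adding the sentence with code `c` to the conjunction with code `d` in the
Lindenbaum construction, where `dec` decides the theorems. -/
def lindenbaumTest (dec : ℕ → Bool) (c d : ℕ) : Bool :=
  isFmCode L 0 c && !dec (impCode d (impCode c 0))

variable (L) in
/-- The sequence of the codes of `lindenbaumSeq`, where `dec` decides the theorems. -/
def lindenbaumSeqCode (dec : ℕ → Bool) : ℕ → ℕ
  | 0 => impCode 0 0
  | c + 1 =>
    if lindenbaumTest L dec c (lindenbaumSeqCode dec c) = true then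
      impCode (impCode (lindenbaumSeqCode dec c) (impCode c 0)) 0
    else lindenbaumSeqCode dec c

variable {dec : ℕ → Bool}

variable (L) in
theorem computable_lindenbaumTest (hdec : Computable dec) :
    Computable₂ (lindenbaumTest L dec) :=
  Primrec.and.to_comp.comp ((computable_isFmCode L).comp (.const 0) .fst)
    (Primrec.not.to_comp.comp
      (hdec.comp (computable_impCode.comp .snd (computable_impCode.comp .fst (.const 0)))))

variable (L) in
theorem computable_lindenbaumSeqCode (hdec : Computable dec) :
    Computable (lindenbaumSeqCode L dec) := by
  have hstep : Computable₂ fun c d => if lindenbaumTest L dec c d = true then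
      impCode (impCode d (impCode c 0)) 0 else d :=
    computable_ite ((computable_lindenbaumTest L hdec).of_eq fun _ => by simp)
      (computable_impCode.comp (computable_impCode.comp .snd
        (computable_impCode.comp .fst (.const 0))) (.const 0)) .snd
  refine (Computable.nat_rec (f := fun c : ℕ => c) .id (.const (impCode 0 0)) (hstep.comp
    (Computable.fst.comp .snd) (Computable.snd.comp .snd)).to₂).of_eq fun c => ?_
  induction c with
  | zero => rfl
  | succ c ih =>
    rw [lindenbaumSeqCode, ← ih]

theorem lindenbaumTest_code (hdec : ∀ φ : L.Sentence, dec (code (n := 0) φ) = true ↔ Proves S φ)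
    (c : ℕ) (θ : L.Sentence) : lindenbaumTest L dec c (code (n := 0) θ) = true ↔
      ∃ φ : L.Sentence, code (n := 0) φ = c ∧ ¬ Proves S (θ.imp φ.not) := by
  simp only [lindenbaumTest, Bool.and_eq_true, isFmCode_iff, Bool.not_eq_true', ← Bool.not_eq_true]
  constructor
  · rintro ⟨⟨φ, rfl⟩, h⟩
    exact ⟨φ, rfl, fun hφ => h ((hdec _).2 hφ)⟩
  · rintro ⟨φ, rfl, h⟩
    exact ⟨⟨φ, rfl⟩, fun hφ => h ((hdec (θ.imp φ.not)).1 hφ)⟩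

theorem lindenbaumSeqCode_eq
    (hdec : ∀ φ : L.Sentence, dec (code (n := 0) φ) = true ↔ Proves S φ) (c : ℕ) :
    lindenbaumSeqCode L dec c = code (n := 0) (lindenbaumSeq S c) := by
  induction c with
  | zero => rfl
  | succ c ih =>
    rw [lindenbaumSeqCode, ih]
    by_cases h : ∃ φ : L.Sentence, code (n := 0) φ = c ∧ ¬ Proves S ((lindenbaumSeq S c).imp φ.not)
    · rw [if_pos ((lindenbaumTest_code hdec c _).2 h)]
      obtain ⟨φ, rfl, hφ⟩ := h
      rw [lindenbaumSeq_of_mem hφ]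
      rfl
    · rw [if_neg fun htest => h ((lindenbaumTest_code hdec c _).1 htest), lindenbaumSeq,
        dif_neg h]

theorem recursiveSet_lindenbaumExtension (hS : DecidableTheory S) :
    RecursiveSet (lindenbaumExtension S) := by
  obtain ⟨dec, hdec, hdecS⟩ := ComputablePred.computable_iff.1 hS
  have hdec_code (φ : L.Sentence) : dec (code (n := 0) φ) = true ↔ Proves S φ := by
    rw [← congrFun hdecS]
    exact ⟨fun ⟨ψ, hψ, h⟩ => code_injective h ▸ hψ, fun h => ⟨φ, h, rfl⟩⟩
  refine ComputablePred.computable_iff.2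
    ⟨fun c => lindenbaumTest L dec c (lindenbaumSeqCode L dec c),
    (computable_lindenbaumTest L hdec).comp .id (computable_lindenbaumSeqCode L hdec),
    funext fun c => propext ?_⟩
  dsimp only
  rw [lindenbaumSeqCode_eq hdec_code, lindenbaumTest_code hdec_code]
  constructor
  · rintro ⟨φ, h, rfl⟩
    exact ⟨φ, rfl, h⟩
  · rintro ⟨φ, rfl, h⟩
    exact ⟨φ, h, rfl⟩

end Decidable

theorem EssentiallyIncomplete.essentiallyUndecidable {T : L.Theory}
    (h : EssentiallyIncomplete T) : EssentiallyUndecidable T := by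
  intro S _ hS hST hdec
  exact not_incomplete_lindenbaumExtension hS (h _
    ⟨_, recursiveSet_lindenbaumExtension hdec, fun _ => Iff.rfl⟩
    (consistent_lindenbaumExtension hS)
    fun φ hφ => extends_lindenbaumExtension hS φ (hST φ hφ))

end Lindenbaum

/-! ### Enumerating the translations of unnested formulas -/

section UnnestedCodes

section Codes

variable {L L' : FirstOrder.Language.{u, v}} [Arithmetization L'] (I : Translation L L') {n k : ℕ}

theorem code_domAt (i : Fin n) : code (I.domAt i) = renameCode n [(i : ℕ)] (code I.dom) := by
  rw [Translation.domAt, code_rename]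
  rfl

theorem code_eqAt (i j : Fin n) :
    code (I.eqAt i j) = renameCode n [(i : ℕ), (j : ℕ)] (code I.eq) := by
  rw [Translation.eqAt, code_rename]
  rfl

theorem code_funcAt (f : L.Functions k) (σ : Fin k → Fin n) (j : Fin n) :
    code (I.funcAt f σ j) =
      renameCode n ((List.ofFn fun l => (σ l : ℕ)) ++ [(j : ℕ)]) (code (I.func f)) := by
  rw [Translation.funcAt, code_rename, List.ofFn_succ']
  simp

end Codes

variable {L L' : FirstOrder.Language.{u, v}} [Arithmetization L] [Arithmetization L']

theorem hasDecidableRange_val : HasDecidableRange fun n (i : Fin n) => (i : ℕ) :=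
  ComputablePred.computable_iff.2 ⟨fun p => decide (p.2 < p.1),
    Primrec.nat_lt.decide.to_comp.comp .snd .fst,
    funext fun p => propext <| by simp [Fin.exists_iff]⟩

theorem computable_forall_mem_lt :
    Computable fun p : ℕ × ℕ × List ℕ => decide (∀ x ∈ p.2.2, x < p.1) :=
  Primrec.nat_lt.forall_mem_list.decide.to_comp.comp (Computable.snd.comp .snd) .fst

theorem exists_ofFn_val_eq {n : ℕ} {l : List ℕ} (h : ∀ x ∈ l, x < n) :
    ∃ σ : Fin l.length → Fin n, (List.ofFn fun i => (σ i : ℕ)) = l :=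
  exists_ofFn_comp_eq fun x hx => ⟨⟨x, h x hx⟩, rfl⟩

theorem HasDecidableRange.of_arity {X : ℕ → Type*} {symbolCode : ∀ {k}, X k → ℕ}
    {arity : ℕ → Option ℕ} (harity : Computable arity)
    (harity_eq : ∀ c k, arity c = some k ↔ ∃ a : X k, symbolCode a = c) :
    HasDecidableRange fun n (i : Σ k, X k × (Fin k → Fin n)) =>
      (symbolCode i.2.1, List.ofFn fun l => (i.2.2 l : ℕ)) := by
  have hcode : Computable fun p : ℕ × ℕ × List ℕ => p.2.1 := Computable.fst.comp .snd
  have hlength : Computable fun p : ℕ × ℕ × List ℕ => p.2.2.length :=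
    Computable.list_length.comp (Computable.snd.comp .snd)
  refine ComputablePred.computable_iff.2
    ⟨fun p => decide (Encodable.encode (arity p.2.1) = Encodable.encode (some p.2.2.length)) &&
      decide (∀ x ∈ p.2.2, x < p.1), Primrec.and.to_comp.comp
        (computable_beq (Computable.encode.comp (harity.comp hcode))
          (Computable.encode.comp (Computable.option_some.comp hlength)))
        computable_forall_mem_lt, funext fun ⟨n, c, l⟩ => propext ?_⟩
  simp only [Bool.and_eq_true, decide_eq_true_eq, Encodable.encode_inj, Sigma.exists, Prod.exists,
    Prod.mk.injEq]
  constructor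
  · rintro ⟨k, a, σ, rfl, rfl⟩
    rw [List.length_ofFn, List.forall_mem_ofFn_iff]
    exact ⟨(harity_eq _ _).2 ⟨a, rfl⟩, fun i => (σ i).2⟩
  · rintro ⟨hc, hl⟩
    obtain ⟨a, rfl⟩ := (harity_eq _ _).1 hc
    obtain ⟨σ, hσ⟩ := exists_ofFn_val_eq hl
    exact ⟨_, a, σ, rfl, hσ⟩

variable (I : Translation L L')

/-- The pairs of codes of unnested atomic formulas and of their translations, each with the length
of the context. -/
def unnestedAtomCodes : Set (ℕ × ℕ × ℕ) :=
  {p | (0, 0) = p.2} ∪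
  ({p | ∃ i j : Fin p.1, (code (.equal (tvar i) (tvar j) : Fm L p.1), code (I.eqAt i j)) = p.2} ∪
  ({p | ∃ (k : ℕ) (R : L.Relations k) (σ : Fin k → Fin p.1),
    (code (.rel R fun l => tvar (σ l)), code (substFm (fun l => tvar (σ l)) (I.rel R))) = p.2} ∪
  {p | ∃ (k : ℕ) (f : L.Functions k) (σ : Fin k → Fin p.1) (j : Fin p.1),
    (code (.equal (.func f fun l => tvar (σ l)) (tvar j)),
      code (.all ((I.domAt (Fin.last p.1)).imp
        ((I.funcAt f (fun l => (σ l).castSucc) (Fin.last p.1)).imp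
          (I.eqAt (Fin.last p.1) j.castSucc))))) = p.2}))

theorem isEnumerable_codes_falsum : IsEnumerable {p : ℕ × ℕ × ℕ | (0, 0) = p.2} := by
  convert IsEnumerable.of_check (α := ℕ × ℕ × ℕ) (β := ℕ) (.const true)
    (Computable.pair .id (.const (0, 0))) using 1
  ext ⟨n, a, b⟩
  simp

theorem isEnumerable_codes_eqAt : IsEnumerable {p : ℕ × ℕ × ℕ | ∃ i j : Fin p.1,
    (code (.equal (tvar i) (tvar j) : Fm L p.1), code (I.eqAt i j)) = p.2} := by
  have hi : Computable fun q : ℕ × ℕ × ℕ => q.2.1 := Computable.fst.comp .snd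
  have hj : Computable fun q : ℕ × ℕ × ℕ => q.2.2 := Computable.snd.comp .snd
  simpa only [Prod.exists, code_equal, codeTm_tvar, code_eqAt] using
    (hasDecidableRange_val.prod hasDecidableRange_val).isEnumerable (Computable.pair
      (computable_equalCode.comp (computable_two_mul.comp hi) (computable_two_mul.comp hj))
      (computable_renameCode.comp (Computable.pair .fst (Computable.pair
        (Computable.list_cons.comp hi (Computable.list_cons.comp hj (.const [])))
        (.const (code I.eq))))))

theorem isEnumerable_codes_rel {g : ℕ → ℕ} (hg : Computable g)
    (hgR : ∀ (k : ℕ) (R : L.Relations k), g (Arithmetization.relCode R) = code (I.rel R)) :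
    IsEnumerable {p : ℕ × ℕ × ℕ | ∃ (k : ℕ) (R : L.Relations k) (σ : Fin k → Fin p.1),
      (code (.rel R fun l => tvar (σ l)),
        code (substFm (fun l => tvar (σ l)) (I.rel R))) = p.2} := by
  have hR : Computable fun q : ℕ × ℕ × List ℕ => q.2.1 := Computable.fst.comp .snd
  have hσ : Computable fun q : ℕ × ℕ × List ℕ => q.2.2 := Computable.snd.comp .snd
  simpa only [Sigma.exists, Prod.exists, code_rel_tvar, code_rename, hgR] using
    (HasDecidableRange.of_arity Arithmetization.relArity_computable
      (Arithmetization.relArity_eq_some (L := L))).isEnumerable (Computable.pair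
        (computable_relAppCode.comp hR (computable_map_two_mul.comp hσ))
        (computable_renameCode.comp (Computable.pair .fst (Computable.pair hσ (hg.comp hR)))))

theorem isEnumerable_codes_func {h : ℕ → ℕ} (hh : Computable h)
    (hhf : ∀ (k : ℕ) (f : L.Functions k), h (Arithmetization.funcCode f) = code (I.func f)) :
    IsEnumerable {p : ℕ × ℕ × ℕ | ∃ (k : ℕ) (f : L.Functions k) (σ : Fin k → Fin p.1)
      (j : Fin p.1), (code (.equal (.func f fun l => tvar (σ l)) (tvar j)),
        code (.all ((I.domAt (Fin.last p.1)).imp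
          ((I.funcAt f (fun l => (σ l).castSucc) (Fin.last p.1)).imp
            (I.eqAt (Fin.last p.1) j.castSucc))))) = p.2} := by
  have hf : Computable fun q : ℕ × (ℕ × List ℕ) × ℕ => q.2.1.1 :=
    Computable.fst.comp (Computable.fst.comp .snd)
  have hσ : Computable fun q : ℕ × (ℕ × List ℕ) × ℕ => q.2.1.2 :=
    Computable.snd.comp (Computable.fst.comp .snd)
  have hj : Computable fun q : ℕ × (ℕ × List ℕ) × ℕ => q.2.2 := Computable.snd.comp .snd
  have hlast : Computable fun q : ℕ × (ℕ × List ℕ) × ℕ => [q.1] :=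
    Computable.list_cons.comp .fst (.const [])
  have hdom : Computable fun q : ℕ × (ℕ × List ℕ) × ℕ =>
      renameCode (q.1 + 1) [q.1] (code I.dom) :=
    computable_renameCode_succ .fst hlast (.const _)
  have hgraph : Computable fun q : ℕ × (ℕ × List ℕ) × ℕ =>
      renameCode (q.1 + 1) (q.2.1.2 ++ [q.1]) (h q.2.1.1) :=
    computable_renameCode_succ .fst (Computable.list_append.comp hσ hlast) (hh.comp hf)
  have heq : Computable fun q : ℕ × (ℕ × List ℕ) × ℕ =>
      renameCode (q.1 + 1) [q.1, q.2.2] (code I.eq) :=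
    computable_renameCode_succ .fst
      (Computable.list_cons.comp .fst (Computable.list_cons.comp hj (.const []))) (.const _)
  have henum := ((HasDecidableRange.of_arity Arithmetization.funcArity_computable
    (Arithmetization.funcArity_eq_some (L := L))).prod hasDecidableRange_val).isEnumerable
      (Computable.pair
        (computable_equalCode.comp
          (computable_funcAppCode.comp hf (computable_map_two_mul.comp hσ))
          (computable_two_mul.comp hj))
        (computable_allCode.comp (computable_impCode.comp hdom
          (computable_impCode.comp hgraph heq))))
  simpa only [Prod.exists, Sigma.exists, code_func_tvar, code_all, code_imp, code_domAt,
    code_funcAt, code_eqAt, hhf, Fin.val_last, Fin.val_castSucc] using henum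

theorem isEnumerable_unnestedAtomCodes (hI : I.IsRecursive) :
    IsEnumerable (unnestedAtomCodes I) := by
  obtain ⟨⟨g, hg, hgR⟩, ⟨h, hh, hhf⟩⟩ := hI
  exact isEnumerable_codes_falsum.union <| (isEnumerable_codes_eqAt I).union <|
    (isEnumerable_codes_rel I hg hgR).union (isEnumerable_codes_func I hh hhf)

/-- The clauses of `UnnestedTranslation` on codes, where `δ` is the code of the domain formula:
implication for `true`, quantification of the first premise for `false`. -/
def unnestedRule (δ : ℕ) (t : Bool) (p q : ℕ × ℕ × ℕ) : Option (ℕ × ℕ × ℕ) :=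
  if t = true then
    if p.1 = q.1 then some (p.1, impCode p.2.1 q.2.1, impCode p.2.2 q.2.2) else none
  else if p.1 = 0 then none
  else some (p.1 - 1, allCode p.2.1, allCode (impCode (renameCode p.1 [p.1 - 1] δ) p.2.2))

theorem computable_unnestedRule (δ : ℕ) :
    Computable fun q : Bool × (ℕ × ℕ × ℕ) × (ℕ × ℕ × ℕ) => unnestedRule δ q.1 q.2.1 q.2.2 := by
  have hp : Computable fun q : Bool × (ℕ × ℕ × ℕ) × (ℕ × ℕ × ℕ) => q.2.1 :=
    Computable.fst.comp .snd
  have hq : Computable fun q : Bool × (ℕ × ℕ × ℕ) × (ℕ × ℕ × ℕ) => q.2.2 :=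
    Computable.snd.comp .snd
  have hcontext := Computable.fst.comp hp
  have hpred := Computable.pred.comp hcontext
  have hsource := Computable.fst.comp (Computable.snd.comp hp)
  have htarget := Computable.snd.comp (Computable.snd.comp hp)
  refine computable_ite (Computable.fst.of_eq fun q => by simp) ?_ ?_
  · refine computable_ite (computable_beq hcontext (Computable.fst.comp hq)) ?_ (.const none)
    exact Computable.option_some.comp (Computable.pair hcontext (Computable.pair
      (computable_impCode.comp hsource (Computable.fst.comp (Computable.snd.comp hq)))
      (computable_impCode.comp htarget (Computable.snd.comp (Computable.snd.comp hq)))))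
  · refine computable_ite (computable_beq hcontext (.const 0)) (.const none) ?_
    exact Computable.option_some.comp (Computable.pair hpred (Computable.pair
      (computable_allCode.comp hsource) (computable_allCode.comp (computable_impCode.comp
        (computable_renameCode.comp (Computable.pair hcontext (Computable.pair
          (Computable.list_cons.comp hpred (.const [])) (.const δ)))) htarget))))

theorem unnestedRule_true_eq_some {δ : ℕ} {p q s : ℕ × ℕ × ℕ} :
    unnestedRule δ true p q = some s ↔ ∃ n a b a' b', p = (n, a, b) ∧ q = (n, a', b') ∧
      s = (n, impCode a a', impCode b b') := by
  constructor
  · obtain ⟨n, a, b⟩ := p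
    obtain ⟨m, a', b'⟩ := q
    intro h
    simp only [unnestedRule, if_true] at h
    split_ifs at h with hcontext
    exact ⟨n, a, b, a', b', rfl, by rw [hcontext], (Option.some.inj h).symm⟩
  · rintro ⟨n, a, b, a', b', rfl, rfl, rfl⟩
    simp [unnestedRule]

theorem unnestedRule_false_eq_some {δ : ℕ} {p q s : ℕ × ℕ × ℕ} :
    unnestedRule δ false p q = some s ↔ ∃ n a b, p = (n + 1, a, b) ∧
      s = (n, allCode a, allCode (impCode (renameCode (n + 1) [n] δ) b)) := by
  obtain ⟨_ | n, a, b⟩ := p <;> simp [unnestedRule, eq_comm]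

variable {I}

theorem exists_unnestedTranslation_of_generated {p : ℕ × ℕ × ℕ}
    (h : Generated (unnestedAtomCodes I) (unnestedRule (code I.dom)) p) :
    ∃ (φ : Fm L p.1) (ψ : Fm L' p.1), I.UnnestedTranslation φ ψ ∧ (code φ, code ψ) = p.2 := by
  induction h with
  | base h =>
    rcases h with h | ⟨i, j, h⟩ | ⟨k, R, σ, h⟩ | ⟨k, f, σ, j, h⟩
    · exact ⟨_, _, .falsum _, h⟩
    · exact ⟨_, _, .equal i j, h⟩
    · exact ⟨_, _, .rel R σ, h⟩
    · exact ⟨_, _, .func f σ j, h⟩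
  | step t _ _ hr ihp ihq =>
    cases t with
    | true =>
      obtain ⟨n, a, b, a', b', rfl, rfl, rfl⟩ := unnestedRule_true_eq_some.1 hr
      dsimp only at ihp ihq
      obtain ⟨φ, ψ, h, hcode⟩ := ihp
      obtain ⟨φ', ψ', h', hcode'⟩ := ihq
      obtain ⟨rfl, rfl⟩ := Prod.mk.inj hcode
      obtain ⟨rfl, rfl⟩ := Prod.mk.inj hcode'
      exact ⟨_, _, .imp h h', rfl⟩
    | false =>
      obtain ⟨n, a, b, rfl, rfl⟩ := unnestedRule_false_eq_some.1 hr
      dsimp only at ihp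
      obtain ⟨φ, ψ, h, hcode⟩ := ihp
      obtain ⟨rfl, rfl⟩ := Prod.mk.inj hcode
      exact ⟨_, _, .all h, by rw [code_all, code_all, code_imp, code_domAt, Fin.val_last]⟩

theorem generated_of_unnestedTranslation {n : ℕ} {φ : Fm L n} {ψ : Fm L' n}
    (h : I.UnnestedTranslation φ ψ) :
    Generated (unnestedAtomCodes I) (unnestedRule (code I.dom)) (n, code φ, code ψ) := by
  induction h with
  | falsum n => exact .base (.inl rfl)
  | equal i j => exact .base (.inr (.inl ⟨i, j, rfl⟩))
  | rel R σ => exact .base (.inr (.inr (.inl ⟨_, R, σ, rfl⟩)))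
  | func f σ j => exact .base (.inr (.inr (.inr ⟨_, f, σ, j, rfl⟩)))
  | imp _ _ ih ih' =>
    exact .step true ih ih' (unnestedRule_true_eq_some.2 ⟨_, _, _, _, _, rfl, rfl, rfl⟩)
  | all _ ih =>
    refine .step false ih ih (unnestedRule_false_eq_some.2 ⟨_, _, _, rfl, ?_⟩)
    rw [code_all, code_all, code_imp, code_domAt, Fin.val_last]

theorem isEnumerable_unnestedTranslation (hI : I.IsRecursive) :
    IsEnumerable {p : ℕ × ℕ × ℕ | ∃ (φ : Fm L p.1) (ψ : Fm L' p.1),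
      I.UnnestedTranslation φ ψ ∧ (code φ, code ψ) = p.2} := by
  convert (isEnumerable_unnestedAtomCodes I hI).generated (computable_unnestedRule (code I.dom))
    using 1
  ext ⟨n, a, b⟩
  constructor
  · rintro ⟨φ, ψ, h, hcode⟩
    dsimp only at φ ψ h hcode
    obtain ⟨rfl, rfl⟩ := Prod.mk.inj hcode
    exact generated_of_unnestedTranslation h
  · exact exists_unnestedTranslation_of_generated

end UnnestedCodes

/-! ### Undecidability and incompleteness -/

section Main

variable {L L' : FirstOrder.Language.{u, v}}

theorem models_iff_proves_of_not_incomplete {S : L.Theory} (hS : ¬ Incomplete S) {M : Type w}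
    [L.Structure M] [Nonempty M] (hM : ∀ φ ∈ S, M ⊨ φ) (φ : L.Sentence) :
    M ⊨ φ ↔ Proves S φ := by
  refine ⟨fun hφ => ?_, Proves.sound hM⟩
  by_contra hnot
  exact hS ⟨φ, hnot, fun h => Proves.sound hM h hφ⟩

variable [Arithmetization L]

variable (L) in
theorem isEnumerable_logicalTheorems :
    IsEnumerable {c : ℕ | ∃ φ : L.Sentence, Proves (∅ : L.Theory) φ ∧ code (n := 0) φ = c} := by
  refine isEnumerable_theorems ⟨fun _ => isFalse (by simp), ?_⟩
  exact (Computable.const false).of_eq fun c => by simp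

/- Every sentence is logically equivalent to an unnested one, namely to its translation under the
identity; truth in `N` of unnested sentences is provability of their translations. -/
theorem Translation.Defines.models_iff_exists_proves {I : Translation L L'} {S : L'.Theory}
    {M : Type w} {N : Type w₁} [L'.Structure M] [L.Structure N] [Nonempty N] (D : I.Defines M N)
    (hM : ∀ ψ : L'.Sentence, M ⊨ ψ ↔ Proves S ψ) (φ : L.Sentence) :
    N ⊨ φ ↔ ∃ (φ' : L.Sentence) (ψ : L'.Sentence), I.UnnestedTranslation (n := 0) φ' ψ ∧
      Proves ∅ (φ'.imp φ) ∧ Proves S ψ := by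
  constructor
  · intro hφ
    obtain ⟨ψ, hψ⟩ := Translation.IsUnnested.onFm_identity (I := I) (n := 0) φ
    have hN : N ⊨ (Translation.identity L).onFm (n := 0) φ :=
      ((Translation.identityDefines N).models_onFm φ).2 hφ
    exact ⟨_, ψ, hψ, proves_of_forall_models fun K _ _ _ =>
      ((Translation.identityDefines K).models_onFm φ).1,
      (hM ψ).1 ((D.models_unnestedTranslation hψ).2 hN)⟩
  · rintro ⟨φ', ψ, hψ, hlog, hSψ⟩
    have hN : N ⊨ φ' := (D.models_unnestedTranslation hψ).1 ((hM ψ).2 hSψ)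
    exact Proves.sound (M := N) (by simp) hlog hN

variable [Arithmetization L']

theorem isEnumerable_consequences {I : Translation L L'} (hI : I.IsRecursive) {A : L'.Theory}
    (hA : RecursiveSet A) : IsEnumerable {c : ℕ | ∃ (φ' φ : L.Sentence) (ψ : L'.Sentence),
      I.UnnestedTranslation (n := 0) φ' ψ ∧ Proves ∅ (φ'.imp φ) ∧ Proves A ψ ∧
        code (n := 0) φ = c} := by
  have hcodes : Computable fun q : (ℕ × ℕ) × ℕ => ((0, q.1), impCode q.1.1 q.2, q.1.2) :=
    Computable.pair (Computable.pair (.const 0) .fst)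
      (Computable.pair (computable_impCode.comp (Computable.fst.comp .fst) .snd)
        (Computable.snd.comp .fst))
  convert (((isEnumerable_unnestedTranslation hI).prod ((isEnumerable_logicalTheorems L).prod
    (isEnumerable_theorems hA))).preimage hcodes).partial_image
      (Computable.option_some.comp .snd) using 1
  ext c
  constructor
  · rintro ⟨φ', φ, ψ, hψ, hlog, hA, rfl⟩
    exact ⟨((code (n := 0) φ', code (n := 0) ψ), code (n := 0) φ),
      ⟨⟨φ', ψ, hψ, rfl⟩, ⟨_, hlog, rfl⟩, ⟨_, hA, rfl⟩⟩, rfl⟩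
  · rintro ⟨⟨⟨a, b⟩, d⟩, ⟨⟨φ', ψ, hψ, hcode⟩, ⟨χ, hχ, himp⟩, ⟨ψ', hψ', hb⟩⟩, h⟩
    dsimp only at φ' ψ hψ hcode himp hb
    obtain ⟨hφ', hψb⟩ := Prod.mk.inj hcode
    obtain rfl := code_injective (hψb.trans hb.symm)
    rw [← hφ'] at himp
    obtain ⟨φ, rfl, hφ⟩ := exists_eq_imp_of_code_eq himp
    exact ⟨φ', φ, ψ, hψ, hχ, hψ', hφ.trans (Option.some.inj h)⟩

theorem recursiveSet_of_defines {I : Translation L L'} (hI : I.IsRecursive) {S : L'.Theory}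
    (hS : RecursivelyAxiomatizable S) {M : Type w} {N : Type w₁} [L'.Structure M] [L.Structure N]
    [Nonempty N] (hM : ∀ ψ : L'.Sentence, M ⊨ ψ ↔ Proves S ψ) (D : I.Defines M N) :
    RecursiveSet {φ : L.Sentence | N ⊨ φ} := by
  obtain ⟨A, hA, hAS⟩ := hS
  refine recursiveSet_of_isEnumerable ?_ fun φ => Iff.rfl
  convert isEnumerable_consequences hI hA using 1
  ext c
  simp only [Set.mem_ofPred_eq, D.models_iff_exists_proves fun ψ => (hM ψ).trans (hAS ψ).symm]
  exact ⟨fun ⟨φ, ⟨φ', ψ, h, h', h''⟩, hc⟩ => ⟨φ', φ, ψ, h, h', h'', hc⟩,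
    fun ⟨φ', φ, ψ, h, h', h'', hc⟩ => ⟨φ, ⟨φ', ψ, h, h', h''⟩, hc⟩⟩

theorem EssentiallyUndecidable.g1Holds {T : L.Theory} (h : EssentiallyUndecidable T) :
    G1Holds T := by
  intro L' _ S hS hcons ⟨I, hrec, hI⟩
  by_contra hcomplete
  obtain ⟨M, _, _, hM⟩ := hcons.exists_model
  obtain ⟨N, _, _, ⟨D⟩⟩ := hI.exists_defines hM
  have hth (φ : L.Sentence) : Proves {φ : L.Sentence | N ⊨ φ} φ ↔ N ⊨ φ :=
    ⟨Proves.sound fun _ h => h, fun h => Proves.of_mem h⟩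
  have hdec : RecursiveSet {φ : L.Sentence | N ⊨ φ} :=
    recursiveSet_of_defines hrec hS (models_iff_proves_of_not_incomplete hcomplete hM) D
  have hext : Extends {φ : L.Sentence | N ⊨ φ} T := fun φ hφ =>
    (hth φ).2 ((D.models_onFm φ).1 (Proves.sound hM (hI.2 φ hφ)))
  refine h {φ | N ⊨ φ} ⟨_, hdec, fun _ => Iff.rfl⟩ (fun hbot => (hth _).1 hbot) hext ?_
  simpa only [DecidableTheory, hth] using hdec

theorem G1Holds.essentiallyIncomplete {T : L.Theory} (h : G1Holds T) : EssentiallyIncomplete T :=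
  fun S hS hcons hST => h L S hS hcons (Extends.interpretable hST)

end Main

end G1

theorem mainTheorem6_general {L : FirstOrder.Language} [G1.Arithmetization L] (T : L.Theory) :
    List.TFAE [G1.G1Holds T, G1.EssentiallyIncomplete T, G1.EssentiallyUndecidable T] := by
  tfae_have 1 → 2 := G1.G1Holds.essentiallyIncomplete
  tfae_have 2 → 3 := G1.EssentiallyIncomplete.essentiallyUndecidable
  tfae_have 3 → 1 := G1.EssentiallyUndecidable.g1Holds
  tfae_finish

theorem mainTheorem6 {L : FirstOrder.Language} [G1.Arithmetization L]
    (T : L.Theory) (hT : G1.RecursivelyAxiomatizable T) (hcon : G1.Consistent T) :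
    List.TFAE [G1.G1Holds T, G1.EssentiallyIncomplete T, G1.EssentiallyUndecidable T] :=
  mainTheorem6_general T
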